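/- Let $M=(m_{ij})$ be an irreducible (possibly periodic) stochastic $N\times N$ matrix with equilibrium distribution $\varepsilon=(\varepsilon_1,\dots,\varepsilon_N)$, $\varepsilon M=\varepsilon$. Let $0<\alpha_i<1$, $B_i>0$ and $\sigma>0$. For each $i$ let $\phi^{(i)}$ be a probability law on $(0,\infty)$ whose Laplace transform satisfies $1-\phi^{(i)}(s)\sim B_i s^{\alpha_i}$ as $s\downarrow0$. Consider the walk with internal states $J_0,J_1,\dots$, a Markov chain with transition matrix $M$ and an arbitrary initial distribution. In state $J_n$ the walker waits a time $\tau_n$ with law $\phi^{(J_n)}$ and then makes a Gaussian jump $\xi_n$ with characteristic function $e^{-\sigma^2k^2}$; given the chain, all $\tau_n$ and $\xi_n$ are independent. Let $\mathcal N(t)$ be the number of waiting periods completed by time $t$, and $x(t)=\sum_{n<\mathcal N(t)}\xi_n$. Let $g(\cdot,t)$ be the law of $x(t)$, let $g^{(i)}(\cdot,t)$ be the part of it on the event that the internal state at time $t$ is $i$, and write $g(k,s)$, $g^{(i)}(k,s)$ for their Fourier transforms in $x$ and Laplace transforms in $t$, with $k$ real and $s>0$. Put $\langle\Sigma|\Psi(s)|\mathrm{eq}\rangle=\sum_i\varepsilon_iB_is^{\alpha_i}$,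 and let $\alpha_1$ be the smallest of the $\alpha_i$. Then: (i) $g(k,s)=\sum_i g^{(i)}(k,s)$ for all $k\in\mathbb R$, $s>0$, and, jointly as $k\to0$ and $s\downarrow0$, $$g(k,s)\sim h(k,s):=\frac1s\,\frac{\langle\Sigma|\Psi(s)|\mathrm{eq}\rangle}{\langle\Sigma|\Psi(s)|\mathrm{eq}\rangle+\sigma^2k^2}.$$ (ii) The function $h$ has the form of natural-form distributed-order diffusion with $p=\sum_i\varepsilon_i\delta_{\alpha_i}$. Precisely, let $b$ be a function with $b(\alpha_i)=B_i$ for all $i$, and let $(W_t)_{t\ge0}$ be a weakly continuous family of probability measures on $\mathbb R$. Then $h$ is the Fourier–Laplace transform of $W$ (for all real $k$ and all $s>0$) if and only if $W$ is a weak solution of $$\int b(a)\,\partial_t^{a}W\,p(da)=\sigma^2\,\partial_x^2W,\qquad W_0=\delta_0,$$ with Caputo derivatives $\partial_t^a$. (A weak solution satisfies the equation integrated over $[0,t]$, for every $t\ge0$, when tested against functions in $C_c^\infty(\mathbb R)$.) (iii) $\langle x^2(t)\rangle<\infty$ for all $t\ge0$, its Laplace transform satisfies $$\int_0^\infty e^{-st}\langle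 x^2(t)\rangle\,dt\sim\frac{2\sigma^2}{s\,\langle\Sigma|\Psi(s)|\mathrm{eq}\rangle}\quad(s\downarrow0),$$ and, as $t\to\infty$, $$\langle x^2(t)\rangle\sim\frac{2\sigma^2}{\Gamma(1+\alpha_1)\sum_{i:\alpha_i=\alpha_1}\varepsilon_iB_i}\,t^{\alpha_1}.$$ In particular, if $\alpha_1<\alpha_i$ for all $i\neq1$, then with $K_{\alpha_1}=\sigma^2/B_1$ $$\langle x^2(t)\rangle\sim\frac{2K_{\alpha_1}}{\varepsilon_1\Gamma(1+\alpha_1)}\,t^{\alpha_1}.$$ None of these limits depends on the initial distribution of the internal states. -/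

import Mathlib

open MeasureTheory ProbabilityTheory Filter Topology Asymptotics
open scoped NNReal Matrix

noncomputable section

namespace FCP

/-- A waiting time law on the positive half line whose Laplace transform `Φ(s)` satisfies
`1 - Φ(s) ∼ B s ^ α` as `s ↓ 0` (asymptotic power law of exponent `α`). -/
structure IsPowerLawWaiting (μ : Measure ℝ) (α B : ℝ) : Prop where
  isProbabilityMeasure : IsProbabilityMeasure μ
  pos : ∀ᵐ u ∂μ, 0 < u
  laplace : (fun s : ℝ => 1 - ∫ u, Real.exp (-(s * u)) ∂μ) ~[𝓝[>] 0] (fun s : ℝ => B * s ^ α)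

/-- The Gaussian jump law with characteristic function `exp (-σ² k²) = 1 - σ² k² + o(k²)`,
that is, with variance `2 σ²`. -/
def jumpLaw (σ : ℝ) : Measure ℝ := gaussianReal 0 (Real.toNNReal (2 * σ ^ 2))

/-- The random inputs of a continuous time random walk with `N` internal states.
`J n` is the `n`-th internal state, `τ n` the time spent there and `ξ n` the jump made at the end
of that period. `J` is a Markov chain with initial distribution `init` and transition matrix `M`;
given `J`, all the `τ n` and `ξ n` are independent, `τ n` with law `φ (J n)` and `ξ n` with law
`Λ (J n)`. -/
structure IsMultistateWalk {N : ℕ} {Ω : Type*} [MeasurableSpace Ω] (P : Measure Ω)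
    (M : Matrix (Fin N) (Fin N) ℝ) (init : Fin N → ℝ) (φ Λ : Fin N → Measure ℝ)
    (J : ℕ → Ω → Fin N) (τ ξ : ℕ → Ω → ℝ) : Prop where
  measurable_state : ∀ n, Measurable (J n)
  measurable_wait : ∀ n, Measurable (τ n)
  measurable_jump : ∀ n, Measurable (ξ n)
  law : ∀ (n : ℕ) (j : ℕ → Fin N) (A C : ℕ → Set ℝ),
    (∀ m, MeasurableSet (A m)) → (∀ m, MeasurableSet (C m)) →
    P {ω | ∀ m ≤ n, J m ω = j m ∧ τ m ω ∈ A m ∧ ξ m ω ∈ C m} =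
      ENNReal.ofReal (init (j 0) * ∏ m ∈ Finset.range n, M (j m) (j (m + 1))) *
        ∏ m ∈ Finset.range (n + 1), φ (j m) (A m) * Λ (j m) (C m)

section Walk

variable {Ω : Type*}

/-- The number `𝒩(t)` of waiting periods completed up to time `t`: the least `n` such that
`t < τ 0 + ⋯ + τ n`. -/
def renewalCount (τ : ℕ → Ω → ℝ) (t : ℝ) (ω : Ω) : ℕ :=
  sInf {n : ℕ | t < ∑ m ∈ Finset.range (n + 1), τ m ω}

/-- The position `X(t)`, the sum of the first `𝒩(t)` jumps. -/
def position (τ ξ : ℕ → Ω → ℝ) (t : ℝ) (ω : Ω) : ℝ :=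
  ∑ m ∈ Finset.range (renewalCount τ t ω), ξ m ω

variable [MeasurableSpace Ω] (P : Measure Ω)

/-- `g(·, t)`: the law of the position at time `t`. -/
def positionLaw (τ ξ : ℕ → Ω → ℝ) (t : ℝ) : Measure ℝ := P.map (position τ ξ t)

/-- `g⁽ⁱ⁾(·, t)`: the distribution of the position at time `t` on the event that the internal state
at time `t` is `i` (a component of the vector `|G(·, t)⟩`). -/
def statePositionLaw {N : ℕ} (J : ℕ → Ω → Fin N) (τ ξ : ℕ → Ω → ℝ) (i : Fin N) (t : ℝ) :
    Measure ℝ :=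
  (P.restrict {ω | J (renewalCount τ t ω) ω = i}).map (position τ ξ t)

/-- The mean squared displacement `⟨x²(t)⟩` (the walk starts at `0`). -/
def msd (τ ξ : ℕ → Ω → ℝ) (t : ℝ) : ℝ := ∫ ω, position τ ξ t ω ^ 2 ∂P

end Walk

/-- Fourier transform in space and Laplace transform in time of a family of measures on the line:
`∫₀^∞ e^{-st} ∫ e^{ikx} ν_t(dx) dt`. -/
def fourierLaplace (ν : ℝ → Measure ℝ) (k s : ℝ) : ℂ :=
  ∫ t in Set.Ioi (0 : ℝ), (Real.exp (-(s * t)) : ℂ) * charFun (ν t) k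

/-- The matrix `Ψ(s) = diag (B₁ s^{α₁}, …, B_N s^{α_N})`. -/
def Psi {N : ℕ} (α B : Fin N → ℝ) (s : ℝ) : Matrix (Fin N) (Fin N) ℝ :=
  Matrix.diagonal fun i => B i * s ^ α i

/-- The number `⟨Σ|Ψ(s)|eq⟩`, with `⟨Σ|` the row vector of ones. -/
def braPsiKet {N : ℕ} (α B ε : Fin N → ℝ) (s : ℝ) : ℝ :=
  (fun _ : Fin N => (1 : ℝ)) ⬝ᵥ (Psi α B s *ᵥ ε)

/-- `s⁻¹ ⟨Σ|Ψ(s)|eq⟩ / (⟨Σ|Ψ(s)|eq⟩ + σ² k²)`. -/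
def limitPropagator {N : ℕ} (α B ε : Fin N → ℝ) (σ k s : ℝ) : ℝ :=
  s⁻¹ * (braPsiKet α B ε s / (braPsiKet α B ε s + σ ^ 2 * k ^ 2))

/-- The Riemann–Liouville fractional integral of order `β > 0` started at time `0`. -/
def rlIntegral (β : ℝ) (f : ℝ → ℝ) (t : ℝ) : ℝ :=
  (Real.Gamma β)⁻¹ * ∫ u in (0 : ℝ)..t, (t - u) ^ (β - 1) * f u

/-- `W` is a (measure-valued, weak) solution of the natural-form distributed-order diffusion
equation `∫ b(a) ∂ᵗ_a W p(da) = D ∂²W/∂x²`, `W(·, 0) = δ₀`, with weight `p` on the exponents and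
scale `b(a)`. Here `∂ᵗ_a w = d/dt I^{1-a} (w - w(0))` is the Caputo derivative of order `a`; the
equation is tested against smooth compactly supported functions of `x` and integrated over
`[0, t]`. -/
structure IsDistributedOrderDiffusion (p : Measure ℝ) (b : ℝ → ℝ) (D : ℝ)
    (W : ℝ≥0 → ProbabilityMeasure ℝ) : Prop where
  initial : (W 0 : Measure ℝ) = Measure.dirac 0
  equation : ∀ f : ℝ → ℝ, ContDiff ℝ (⊤ : ℕ∞) f → HasCompactSupport f → ∀ t : ℝ, 0 ≤ t →
    ∫ a, b a * rlIntegral (1 - a) (fun u => (∫ x, f x ∂(W u.toNNReal : Measure ℝ)) - f 0) t ∂p =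
      D * ∫ u in (0 : ℝ)..t, ∫ x, deriv (deriv f) x ∂(W u.toNNReal : Measure ℝ)

end FCP

end

open FCP

/-!
The Gaussian jumps are independent of the internal states and of the waiting times, so on the event
of `n` completed waiting periods the position is a sum of `n` independent jumps
(`map_position_restrict`). Writing `Φ(s)` for the diagonal matrix of the Laplace transforms of the
waiting times and `Λ(k) = exp (-σ² k²)`, one gets Neumann series for the two transforms in question:
`s g(k, s) = ⟨init| ∑ n, (Λ(k) Φ(s) M)ⁿ (1 - Φ(s)) |Σ⟩` and
`2 σ² s⁻¹ ⟨init| ∑ n ≥ 1, (Φ(s) M)ⁿ |Σ⟩` for the mean squared displacement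
(`exists_fourierLaplace_positionLaw_eq`, `exists_laplace_msd_eq`).

Up to the term `n = 0`, both series are of the form `⟨init|v⟩` with `v = d • M v + f`, where the
weights `d` tend to one. No spectral theory is needed for the limit, and periodicity plays no role.
Irreducibility bounds the oscillation of `v` by its defect from being harmonic, which is at most
`f`. Pairing the equation with the equilibrium distribution gives `∑ ε (1 - d) M v = ∑ ε f`, so `v`
is, up to a relative error of the order of `∑ ε (1 - d)`, the constant `∑ ε f / ∑ ε (1 - d)`
(`exists_perturbation_bound`, `exists_resolvent_estimate`). This constant does not involve the
initial distribution, and inserting `1 - Φᵢ(s) ∼ Bᵢ s ^ αᵢ` yields the limits in Laplace space. The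
mean squared displacement is monotone in time, so Karamata's Tauberian theorem
(`isEquivalent_of_laplace_isEquivalent`, by Weierstrass approximation in `exp (-u)`) turns the
Laplace asymptotics into asymptotics for large times.

For the diffusion equation, a family `W` has the Fourier–Laplace transform `h = limitPropagator α B
ε σ` if and only if, for each frequency `k`, its characteristic function solves a relaxation
equation with a distributed fractional integral (`relaxation_iff_laplace`, from the Laplace
transform of fractional integrals and the uniqueness of Laplace transforms). This equation is the
weak equation tested against `exp (i k x)`. Bounded test functions are reached from compactly
supported ones by cutoffs (`charFun_equation`); conversely, a compactly supported test function is a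
superposition of plane waves by Fourier inversion (`equation_of_charFun`). The initial condition
follows from the behaviour of `s h(k, s)` as `s → ∞` (`initial_eq_dirac`).
-/

noncomputable section

namespace FCP

/-! ### Nearly harmonic vectors of an irreducible stochastic matrix -/

section Stochastic

variable {N : ℕ} {M : Matrix (Fin N) (Fin N) ℝ}

lemma mulVec_apply_le (hM : M ∈ Matrix.rowStochastic ℝ (Fin N)) {u : Fin N → ℝ} {c : ℝ}
    (hu : ∀ j, u j ≤ c) (i : Fin N) : (M *ᵥ u) i ≤ c := by
  calc (M *ᵥ u) i = ∑ j, M i j * u j := rfl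
    _ ≤ ∑ j, M i j * c := Finset.sum_le_sum fun j _ =>
        mul_le_mul_of_nonneg_left (hu j) (Matrix.nonneg_of_mem_rowStochastic hM)
    _ = c := by rw [← Finset.sum_mul, Matrix.sum_row_of_mem_rowStochastic hM, one_mul]

lemma le_mulVec_apply (hM : M ∈ Matrix.rowStochastic ℝ (Fin N)) {u : Fin N → ℝ} {c : ℝ}
    (hu : ∀ j, c ≤ u j) (i : Fin N) : c ≤ (M *ᵥ u) i := by
  calc c = ∑ j, M i j * c := by
        rw [← Finset.sum_mul, Matrix.sum_row_of_mem_rowStochastic hM, one_mul]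
    _ ≤ ∑ j, M i j * u j := Finset.sum_le_sum fun j _ =>
        mul_le_mul_of_nonneg_left (hu j) (Matrix.nonneg_of_mem_rowStochastic hM)

lemma sub_pow_mulVec_le (hM : M ∈ Matrix.rowStochastic ℝ (Fin N)) {u : Fin N → ℝ} {r : ℝ}
    (hu : ∀ i, u i - (M *ᵥ u) i ≤ r) (n : ℕ) (i : Fin N) :
    u i - ((M ^ n) *ᵥ u) i ≤ n * r := by
  induction n generalizing i with
  | zero => simp
  | succ n ih =>
    have h1 : (M *ᵥ (u - (M ^ n) *ᵥ u)) i ≤ n * r := mulVec_apply_le hM (fun j => ih j) i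
    rw [Matrix.mulVec_sub, Matrix.mulVec_mulVec, ← pow_succ', Pi.sub_apply] at h1
    have h2 := hu i
    push_cast
    linarith

/-- A quantitative form of the fact that only constant vectors are harmonic for an irreducible
stochastic matrix. If `u` is maximal at `i` and `(M ^ n) i j > 0`, then
`(M ^ n) i j * (u i - u j) ≤ u i - (M ^ n u) i ≤ n r`. -/
lemma exists_oscillation_bound (hM : M ∈ Matrix.rowStochastic ℝ (Fin N))
    (hirr : M.IsIrreducible) :
    ∃ K : ℝ, 0 ≤ K ∧ ∀ (u : Fin N → ℝ) (r : ℝ), 0 ≤ r → (∀ i, u i - (M *ᵥ u) i ≤ r) →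
      ∀ i j, u i - u j ≤ K * r := by
  have hpow := (Matrix.isIrreducible_iff_exists_pow_pos (fun i j =>
    Matrix.nonneg_of_mem_rowStochastic hM)).1 hirr
  choose n _ hn using hpow
  have hterm : ∀ i j, 0 ≤ (n i j : ℝ) / (M ^ n i j) i j := fun i j =>
    div_nonneg (Nat.cast_nonneg _) (hn i j).le
  refine ⟨∑ i, ∑ j, (n i j : ℝ) / (M ^ n i j) i j,
    Finset.sum_nonneg fun i _ => Finset.sum_nonneg fun j _ => hterm i j, ?_⟩
  intro u r hr hu i j
  obtain ⟨m, -, hm⟩ := Finset.exists_max_image Finset.univ u ⟨i, Finset.mem_univ i⟩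
  have hM' : M ^ n m j ∈ Matrix.rowStochastic ℝ (Fin N) := pow_mem hM _
  have hmax : ∀ k, 0 ≤ u m - u k := fun k => sub_nonneg.2 (hm k (Finset.mem_univ k))
  have h1 : (M ^ n m j) m j * (u m - u j) ≤ n m j * r := by
    calc (M ^ n m j) m j * (u m - u j) ≤ ∑ k, (M ^ n m j) m k * (u m - u k) :=
          Finset.single_le_sum (f := fun k => (M ^ n m j) m k * (u m - u k))
            (fun k _ => mul_nonneg (Matrix.nonneg_of_mem_rowStochastic hM') (hmax k))
            (Finset.mem_univ j)
      _ = u m - ((M ^ n m j) *ᵥ u) m := by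
          simp only [mul_sub, Finset.sum_sub_distrib, ← Finset.sum_mul,
            Matrix.sum_row_of_mem_rowStochastic hM', one_mul]
          rfl
      _ ≤ n m j * r := sub_pow_mulVec_le hM hu _ _
  have h2 : u m - u j ≤ (n m j : ℝ) / (M ^ n m j) m j * r := by
    rw [div_mul_eq_mul_div, le_div_iff₀ (hn m j)]
    linarith
  have h3 : (n m j : ℝ) / (M ^ n m j) m j ≤ ∑ i, ∑ j, (n i j : ℝ) / (M ^ n i j) i j :=
    (Finset.single_le_sum (f := fun j => (n m j : ℝ) / (M ^ n m j) m j)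
      (fun k _ => hterm m k) (Finset.mem_univ j)).trans
    (Finset.single_le_sum (f := fun i => ∑ j, (n i j : ℝ) / (M ^ n i j) i j)
      (fun k _ => Finset.sum_nonneg fun j _ => hterm k j) (Finset.mem_univ m))
  have h4 := mul_le_mul_of_nonneg_right h3 hr
  have h5 := hmax i
  linarith

/-- Irreducibility spreads the mass of an equilibrium distribution over all states. -/
lemma equilibrium_pos (hM : M ∈ Matrix.rowStochastic ℝ (Fin N)) (hirr : M.IsIrreducible)
    {ε : Fin N → ℝ} (hε : ε ∈ stdSimplex ℝ (Fin N)) (hεM : ε ᵥ* M = ε) (j : Fin N) : 0 < ε j := by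
  have hpow := (Matrix.isIrreducible_iff_exists_pow_pos (fun i j =>
    Matrix.nonneg_of_mem_rowStochastic hM)).1 hirr
  obtain ⟨i, hi⟩ : ∃ i, 0 < ε i := by
    by_contra! h
    have := hε.2
    have h2 : ∑ i, ε i ≤ 0 := Finset.sum_nonpos fun i _ => h i
    linarith
  obtain ⟨n, -, hn⟩ := hpow i j
  have hinv : ∀ n : ℕ, ε ᵥ* (M ^ n) = ε := by
    intro n
    induction n with
    | zero => simp
    | succ n ih => rw [pow_succ, ← Matrix.vecMul_vecMul, ih, hεM]
  have hM' : M ^ n ∈ Matrix.rowStochastic ℝ (Fin N) := pow_mem hM _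
  calc 0 < ε i * (M ^ n) i j := mul_pos hi hn
    _ ≤ ∑ k, ε k * (M ^ n) k j := Finset.single_le_sum (f := fun k => ε k * (M ^ n) k j)
        (fun k _ => mul_nonneg (hε.1 k) (Matrix.nonneg_of_mem_rowStochastic hM'))
        (Finset.mem_univ i)
    _ = (ε ᵥ* (M ^ n)) j := rfl
    _ = ε j := by rw [hinv]

/-- The perturbation estimate that carries the limit. If `v = d • M v + f` with weights `d` close
to one, then `v` is nearly constant, and pairing the equation with the equilibrium distribution
determines the constant as `(∑ ε f) / (∑ ε (1 - d))`, up to a relative error of the order of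
`∑ ε (1 - d)`. -/
lemma exists_perturbation_bound (hM : M ∈ Matrix.rowStochastic ℝ (Fin N))
    (hirr : M.IsIrreducible) {ε : Fin N → ℝ} (hε : ε ∈ stdSimplex ℝ (Fin N))
    (hεM : ε ᵥ* M = ε) :
    ∃ K : ℝ, 0 ≤ K ∧ ∀ d v f : Fin N → ℝ, (∀ i, d i ≤ 1) → (∀ i, 0 ≤ v i) →
      (∀ i, 0 ≤ f i) → (∀ i, v i = d i * (M *ᵥ v) i + f i) →
      ∀ i, |v i * ∑ i, ε i * (1 - d i) - ∑ i, ε i * f i| ≤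
        K * (∑ i, ε i * (1 - d i)) * ∑ i, ε i * f i := by
  obtain ⟨K, hK, hosc⟩ := exists_oscillation_bound hM hirr
  have hpos := equilibrium_pos hM hirr hε hεM
  set E : ℝ := ∑ i, (ε i)⁻¹
  have hEi : ∀ i, (ε i)⁻¹ ≤ E := fun i =>
    Finset.single_le_sum (f := fun i => (ε i)⁻¹) (fun k _ => (inv_pos.2 (hpos k)).le)
      (Finset.mem_univ i)
  have hE : 0 ≤ E := Finset.sum_nonneg fun k _ => (inv_pos.2 (hpos k)).le
  refine ⟨K * E, by positivity, ?_⟩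
  intro d v f hd hv hf hvf i
  set D := ∑ i, ε i * (1 - d i)
  set F := ∑ i, ε i * f i
  have hDi : ∀ i, ε i * (1 - d i) ≤ D := fun i =>
    Finset.single_le_sum (f := fun i => ε i * (1 - d i))
      (fun k _ => mul_nonneg (hpos k).le (sub_nonneg.2 (hd k))) (Finset.mem_univ i)
  have hFi : ∀ i, ε i * f i ≤ F := fun i =>
    Finset.single_le_sum (f := fun i => ε i * f i)
      (fun k _ => mul_nonneg (hpos k).le (hf k)) (Finset.mem_univ i)
  have hD0 : 0 ≤ D := Finset.sum_nonneg fun k _ => mul_nonneg (hpos k).le (sub_nonneg.2 (hd k))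
  have hF0 : 0 ≤ F := Finset.sum_nonneg fun k _ => mul_nonneg (hpos k).le (hf k)
  -- pairing the equation with `ε` removes `M`, because `ε M = ε`
  have hbal : F = ∑ i, ε i * (1 - d i) * (M *ᵥ v) i := by
    have h1 : ∑ i, ε i * v i = ∑ i, ε i * (M *ᵥ v) i := by
      have := Matrix.dotProduct_mulVec ε M v
      rw [hεM] at this
      exact this.symm
    have h2 : ∀ i, ε i * f i = ε i * (1 - d i) * (M *ᵥ v) i + (ε i * v i - ε i * (M *ᵥ v) i) := by
      intro i
      linear_combination (-ε i) * hvf i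
    simp only [F]
    rw [Finset.sum_congr rfl fun i _ => h2 i, Finset.sum_add_distrib, Finset.sum_sub_distrib, h1]
    ring
  obtain ⟨a, -, ha⟩ := Finset.exists_max_image Finset.univ v ⟨i, Finset.mem_univ i⟩
  obtain ⟨b, -, hb⟩ := Finset.exists_min_image Finset.univ v ⟨i, Finset.mem_univ i⟩
  -- so `F / D` is a weighted mean of `M v`, hence lies between the extreme values of `v`
  have hup : F ≤ D * v a := by
    rw [hbal, Finset.sum_mul]
    exact Finset.sum_le_sum fun k _ => mul_le_mul_of_nonneg_left
      (mulVec_apply_le hM (fun j => ha j (Finset.mem_univ j)) k)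
      (mul_nonneg (hpos k).le (sub_nonneg.2 (hd k)))
  have hlow : D * v b ≤ F := by
    rw [hbal, Finset.sum_mul]
    exact Finset.sum_le_sum fun k _ => mul_le_mul_of_nonneg_left
      (le_mulVec_apply hM (fun j => hb j (Finset.mem_univ j)) k)
      (mul_nonneg (hpos k).le (sub_nonneg.2 (hd k)))
  -- the oscillation of `v` is controlled by its defect from being harmonic, which is at most `f`
  have hres : ∀ k, v k - (M *ᵥ v) k ≤ E * F := by
    intro k
    have h1 : 0 ≤ (1 - d k) * (M *ᵥ v) k :=
      mul_nonneg (sub_nonneg.2 (hd k)) (le_mulVec_apply hM hv k)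
    have h2 : f k ≤ E * F := by
      calc f k = (ε k)⁻¹ * (ε k * f k) := by rw [inv_mul_cancel_left₀ (hpos k).ne']
        _ ≤ E * F := mul_le_mul (hEi k) (hFi k) (mul_nonneg (hpos k).le (hf k)) hE
    have h3 := hvf k
    linarith
  have hosc' := hosc v (E * F) (mul_nonneg hE hF0) hres
  have hab := hosc' a b
  have hia := ha i (Finset.mem_univ i)
  have hib := hb i (Finset.mem_univ i)
  have h1 : D * v i ≤ D * v a := mul_le_mul_of_nonneg_left hia hD0
  have h2 : D * v b ≤ D * v i := mul_le_mul_of_nonneg_left hib hD0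
  have h3 : D * (v a - v b) ≤ D * (K * (E * F)) := mul_le_mul_of_nonneg_left hab hD0
  have h4 : 0 ≤ D * (K * (E * F)) := by positivity
  have h5 : 0 ≤ D * F := by positivity
  rw [abs_le]
  constructor <;> nlinarith

/-! ### The resolvent of a weighted stochastic matrix -/

lemma diagonal_mul_mulVec (d v : Fin N → ℝ) (i : Fin N) :
    ((Matrix.diagonal d * M) *ᵥ v) i = d i * (M *ᵥ v) i := by
  rw [← Matrix.mulVec_mulVec, Matrix.mulVec_diagonal]

lemma weighted_pow_bounds (hM : M ∈ Matrix.rowStochastic ℝ (Fin N)) {d f : Fin N → ℝ} {q c : ℝ}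
    (hd : ∀ i, 0 ≤ d i) (hdq : ∀ i, d i ≤ q) (hf : ∀ i, 0 ≤ f i) (hfc : ∀ i, f i ≤ c)
    (n : ℕ) (i : Fin N) :
    0 ≤ ((Matrix.diagonal d * M) ^ n *ᵥ f) i ∧
      ((Matrix.diagonal d * M) ^ n *ᵥ f) i ≤ q ^ n * c := by
  induction n generalizing i with
  | zero => simp [hf, hfc]
  | succ n ih =>
    rw [pow_succ', ← Matrix.mulVec_mulVec, diagonal_mul_mulVec]
    have h0 := le_mulVec_apply hM (fun j => (ih j).1) i
    have h1 := mulVec_apply_le hM (fun j => (ih j).2) i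
    refine ⟨mul_nonneg (hd i) h0, ?_⟩
    calc _ ≤ q * (q ^ n * c) := mul_le_mul (hdq i) h1 h0 ((hd i).trans (hdq i))
      _ = _ := by ring

/-- The Neumann series `∑ n, (d • M) ^ n f` solves `v = d • M v + f`. -/
lemma exists_weighted_resolvent (hM : M ∈ Matrix.rowStochastic ℝ (Fin N)) {d f : Fin N → ℝ} {q : ℝ}
    (hq : q < 1) (hd : ∀ i, 0 ≤ d i) (hdq : ∀ i, d i ≤ q) (hf : ∀ i, 0 ≤ f i) :
    ∃ v : Fin N → ℝ, (∀ i, 0 ≤ v i) ∧ (∀ i, v i = d i * (M *ᵥ v) i + f i) ∧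
      ∀ w : Fin N → ℝ, HasSum (fun n => w ⬝ᵥ ((Matrix.diagonal d * M) ^ n *ᵥ f)) (w ⬝ᵥ v) := by
  set A := Matrix.diagonal d * M
  set c := ∑ i, f i
  have hfc : ∀ i, f i ≤ c := fun i =>
    Finset.single_le_sum (f := f) (fun k _ => hf k) (Finset.mem_univ i)
  have hb := fun n i => weighted_pow_bounds hM hd hdq hf hfc n i
  have hsum : ∀ i, Summable fun n => (A ^ n *ᵥ f) i := by
    intro i
    have hq0 : 0 ≤ q := (hd i).trans (hdq i)
    exact Summable.of_nonneg_of_le (fun n => (hb n i).1) (fun n => (hb n i).2)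
      ((summable_geometric_of_lt_one hq0 hq).mul_right c)
  have hv : ∀ w : Fin N → ℝ, HasSum (fun n => w ⬝ᵥ (A ^ n *ᵥ f))
      (w ⬝ᵥ fun i => ∑' n, (A ^ n *ᵥ f) i) := fun w =>
    hasSum_sum fun i _ => (hsum i).hasSum.mul_left (w i)
  refine ⟨fun i => ∑' n, (A ^ n *ᵥ f) i, fun i => tsum_nonneg fun n => (hb n i).1, ?_, hv⟩
  intro i
  change (∑' n, (A ^ n *ᵥ f) i) = _
  rw [(hsum i).tsum_eq_zero_add, add_comm, ← diagonal_mul_mulVec]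
  congr 1
  · have h := (hv (A i)).tsum_eq
    change _ = A i ⬝ᵥ _
    rw [← h]
    refine tsum_congr fun n => ?_
    rw [pow_succ', ← Matrix.mulVec_mulVec]
    rfl
  · simp

/-- If `S = ⟨w|∑ n, (d • M) ^ n|f⟩` for a probability vector `w`, then
`S * ∑ ε (1 - d) = ∑ ε f`, up to a relative error of the order of `∑ ε (1 - d)`. -/
lemma exists_resolvent_estimate (hM : M ∈ Matrix.rowStochastic ℝ (Fin N))
    (hirr : M.IsIrreducible) {ε : Fin N → ℝ} (hε : ε ∈ stdSimplex ℝ (Fin N))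
    (hεM : ε ᵥ* M = ε) :
    ∃ K : ℝ, 0 ≤ K ∧ ∀ (d f w : Fin N → ℝ) (S : ℝ), (∀ i, 0 ≤ d i) → (∀ i, d i < 1) →
      (∀ i, 0 ≤ f i) → w ∈ stdSimplex ℝ (Fin N) →
      HasSum (fun n => w ⬝ᵥ ((Matrix.diagonal d * M) ^ n *ᵥ f)) S →
      |S * ∑ i, ε i * (1 - d i) - ∑ i, ε i * f i| ≤
        K * (∑ i, ε i * (1 - d i)) * ∑ i, ε i * f i := by
  obtain ⟨K, hK, h⟩ := exists_perturbation_bound hM hirr hε hεM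
  refine ⟨K, hK, fun d f w S hd hd1 hf hw hS => ?_⟩
  have hne : (Finset.univ : Finset (Fin N)).Nonempty := by
    by_contra hne
    have := hε.2
    rw [Finset.not_nonempty_iff_eq_empty.1 hne] at this
    simp at this
  obtain ⟨m, -, hm⟩ := Finset.exists_max_image Finset.univ d hne
  obtain ⟨v, hv, hvf, hsum⟩ := exists_weighted_resolvent hM (hd1 m) hd
    (fun i => hm i (Finset.mem_univ i)) hf
  rw [hS.unique (hsum w)]
  have h1 := h d v f (fun i => (hd1 i).le) hv hf hvf
  set D := ∑ i, ε i * (1 - d i)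
  set F := ∑ i, ε i * f i
  have h2 : (w ⬝ᵥ v) * D - F = ∑ i, w i * (v i * D - F) := by
    simp only [mul_sub, Finset.sum_sub_distrib, ← Finset.sum_mul, hw.2, one_mul, dotProduct,
      ← mul_assoc]
  rw [h2]
  calc |∑ i, w i * (v i * D - F)| ≤ ∑ i, |w i * (v i * D - F)| := Finset.abs_sum_le_sum_abs _ _
    _ ≤ ∑ i, w i * (K * D * F) := Finset.sum_le_sum fun i _ => by
        rw [abs_mul, abs_of_nonneg (hw.1 i)]
        exact mul_le_mul_of_nonneg_left (h1 i) (hw.1 i)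
    _ = K * D * F := by rw [← Finset.sum_mul, hw.2, one_mul]

end Stochastic

/-! ### Asymptotic equivalence of sums and quotients -/

section Asymptotic

variable {X : Type*} {l : Filter X}

lemma isEquivalent_add_of_eventually_nonneg {u v t w : X → ℝ} (hv : ∀ᶠ x in l, 0 ≤ v x)
    (hw : ∀ᶠ x in l, 0 ≤ w x) (huv : u ~[l] v) (htw : t ~[l] w) :
    (fun x => u x + t x) ~[l] fun x => v x + w x := by
  have hv' : v =ᶠ[l] fun x => |v x| := hv.mono fun x hx => (abs_of_nonneg hx).symm
  have hw' : w =ᶠ[l] fun x => |w x| := hw.mono fun x hx => (abs_of_nonneg hx).symm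
  have h := IsEquivalent.add_add_of_nonneg (fun x => abs_nonneg (v x)) (fun x => abs_nonneg (w x))
    (huv.congr_right hv') (htw.congr_right hw')
  exact h.congr_right (hv'.add hw').symm

lemma isEquivalent_sum_of_eventually_nonneg {ι : Type*} {s : Finset ι} {u v : ι → X → ℝ}
    (hv : ∀ i ∈ s, ∀ᶠ x in l, 0 ≤ v i x) (huv : ∀ i ∈ s, u i ~[l] v i) :
    (fun x => ∑ i ∈ s, u i x) ~[l] fun x => ∑ i ∈ s, v i x := by
  classical
  induction s using Finset.induction_on with
  | empty => simpa using IsEquivalent.refl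
  | insert a s ha ih =>
    simp only [Finset.sum_insert ha]
    refine isEquivalent_add_of_eventually_nonneg (hv a (by simp)) ?_ (huv a (by simp))
      (ih (fun i hi => hv i (by simp [hi])) fun i hi => huv i (by simp [hi]))
    have : ∀ᶠ x in l, ∀ i ∈ s, 0 ≤ v i x :=
      (Filter.eventually_all_finset s).2 fun i hi => hv i (by simp [hi])
    exact this.mono fun x hx => Finset.sum_nonneg hx

/-- A relative error `K D` with `D → 0` disappears in the limit. -/
lemma isEquivalent_div_of_abs_mul_sub_le {S D F : X → ℝ} {K : ℝ} (hD : Tendsto D l (𝓝 0))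
    (hD0 : ∀ᶠ x in l, 0 < D x) (hF0 : ∀ᶠ x in l, 0 ≤ F x)
    (h : ∀ᶠ x in l, |S x * D x - F x| ≤ K * D x * F x) :
    S ~[l] fun x => F x / D x := by
  have hKD : Tendsto (fun x => K * D x) l (𝓝 0) := by simpa using hD.const_mul K
  refine isLittleO_iff.2 fun c hc => ?_
  filter_upwards [hD0, hF0, h, hKD.eventually (ge_mem_nhds hc)] with x h1 h2 h3 h4
  have h5 : S x - F x / D x = (S x * D x - F x) / D x := by field_simp
  have h6 : 0 ≤ F x / D x := by positivity
  rw [Pi.sub_apply, h5, Real.norm_eq_abs, Real.norm_eq_abs, abs_div, abs_of_pos h1,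
    abs_of_nonneg h6, div_le_iff₀ h1]
  calc _ ≤ K * D x * F x := h3
    _ ≤ c * F x := mul_le_mul_of_nonneg_right h4 h2
    _ = _ := by field_simp

end Asymptotic

/-! ### Weierstrass approximation in the variable `exp (-u)` -/

section Laplace

variable {E : Type*} [NormedAddCommGroup E] [NormedSpace ℝ E]

lemma exp_neg_mem_Icc {u : ℝ} (hu : u ∈ Set.Ioi (0 : ℝ)) : Real.exp (-u) ∈ Set.Icc (0 : ℝ) 1 :=
  ⟨(Real.exp_pos _).le, Real.exp_le_one_iff.2 (neg_nonpos.2 (le_of_lt hu))⟩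

lemma integrableOn_comp_exp_smul {F : ℝ → E} (hF : IntegrableOn F (Set.Ioi 0)) {h : ℝ → ℝ}
    (hh : Continuous h) : IntegrableOn (fun u => h (Real.exp (-u)) • F u) (Set.Ioi 0) := by
  obtain ⟨c, hc⟩ := isCompact_Icc.exists_bound_of_continuousOn (s := Set.Icc (0 : ℝ) 1)
    hh.continuousOn
  refine Integrable.bdd_smul (𝕜 := ℝ) hF c
    (by fun_prop : Continuous fun u => h (Real.exp (-u))).aestronglyMeasurable ?_
  filter_upwards [ae_restrict_mem measurableSet_Ioi] with u hu
  exact hc _ (exp_neg_mem_Icc hu)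

/-- Convergence of all the integrals `∫ exp (-u) ^ n • F` gives that of `∫ h (exp (-u)) • F` for
every continuous `h`, if the masses `∫ ‖F‖` stay bounded: `h` is a uniform limit of polynomials on
`[0, 1]`. -/
lemma tendsto_integral_comp_exp_smul {X : Type*} {l : Filter X} {F : X → ℝ → E} {F₀ : ℝ → E}
    {C : ℝ} (hF : ∀ᶠ x in l, IntegrableOn (F x) (Set.Ioi 0)) (hF₀ : IntegrableOn F₀ (Set.Ioi 0))
    (hC : ∀ᶠ x in l, ∫ u in Set.Ioi 0, ‖F x u‖ ≤ C)
    (hmom : ∀ n : ℕ, Tendsto (fun x => ∫ u in Set.Ioi 0, Real.exp (-u) ^ n • F x u) l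
      (𝓝 (∫ u in Set.Ioi 0, Real.exp (-u) ^ n • F₀ u)))
    {h : ℝ → ℝ} (hh : Continuous h) :
    Tendsto (fun x => ∫ u in Set.Ioi 0, h (Real.exp (-u)) • F x u) l
      (𝓝 (∫ u in Set.Ioi 0, h (Real.exp (-u)) • F₀ u)) := by
  have hsum : ∀ (p : Polynomial ℝ) (G : ℝ → E), IntegrableOn G (Set.Ioi 0) →
      ∫ u in Set.Ioi 0, p.eval (Real.exp (-u)) • G u =
        ∑ n ∈ Finset.range (p.natDegree + 1),
          p.coeff n • ∫ u in Set.Ioi 0, Real.exp (-u) ^ n • G u := by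
    intro p G hG
    simp only [Polynomial.eval_eq_sum_range, Finset.sum_smul, mul_smul]
    rw [integral_finsetSum]
    · simp only [integral_smul]
    · intro n _
      exact (integrableOn_comp_exp_smul hG (continuous_pow n)).smul (p.coeff n)
  have hpoly : ∀ p : Polynomial ℝ,
      Tendsto (fun x => ∫ u in Set.Ioi 0, p.eval (Real.exp (-u)) • F x u) l
        (𝓝 (∫ u in Set.Ioi 0, p.eval (Real.exp (-u)) • F₀ u)) := by
    intro p
    rw [hsum p F₀ hF₀]
    refine (tendsto_finsetSum _ fun n _ => (hmom n).const_smul (p.coeff n)).congr' ?_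
    filter_upwards [hF] with x hx
    rw [hsum p _ hx]
  have hdiff : ∀ (p : Polynomial ℝ) (η : ℝ), (∀ x ∈ Set.Icc (0 : ℝ) 1, |p.eval x - h x| < η) →
      ∀ G : ℝ → E, IntegrableOn G (Set.Ioi 0) →
      ‖∫ u in Set.Ioi 0, h (Real.exp (-u)) • G u - p.eval (Real.exp (-u)) • G u‖ ≤
        η * ∫ u in Set.Ioi 0, ‖G u‖ := by
    intro p η hp G hG
    rw [← integral_const_mul]
    refine norm_integral_le_of_norm_le (hG.norm.const_mul η) ?_
    filter_upwards [ae_restrict_mem measurableSet_Ioi] with u hu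
    rw [← sub_smul, norm_smul, Real.norm_eq_abs, abs_sub_comm]
    exact mul_le_mul_of_nonneg_right (hp _ (exp_neg_mem_Icc hu)).le (norm_nonneg _)
  rw [Metric.tendsto_nhds]
  intro δ hδ
  set C₀ := ∫ u in Set.Ioi 0, ‖F₀ u‖
  have hC₀ : 0 ≤ C₀ := integral_nonneg fun _ => norm_nonneg _
  set η := δ / (2 * (|C| + C₀ + 1))
  have hη : 0 < η := by positivity
  obtain ⟨p, hp⟩ := exists_polynomial_near_of_continuousOn 0 1 h hh.continuousOn η hη
  filter_upwards [hF, hC, Metric.tendsto_nhds.1 (hpoly p) (δ / 2) (by positivity)]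
    with x h1 h2 h3
  have e1 := hdiff p η hp _ h1
  have e2 := hdiff p η hp _ hF₀
  have i1 := integrableOn_comp_exp_smul h1 hh
  have i2 := integrableOn_comp_exp_smul h1 p.continuous
  have i3 := integrableOn_comp_exp_smul hF₀ hh
  have i4 := integrableOn_comp_exp_smul hF₀ p.continuous
  rw [integral_sub i1 i2] at e1
  rw [integral_sub i3 i4] at e2
  rw [dist_eq_norm] at h3 ⊢
  have e3 : η * (∫ u in Set.Ioi 0, ‖F x u‖) ≤ η * |C| :=
    mul_le_mul_of_nonneg_left (h2.trans (le_abs_self C)) hη.le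
  have e4 : η * (|C| + C₀) < δ / 2 := by
    have : η * (|C| + C₀ + 1) = δ / 2 := by simp only [η]; field_simp
    nlinarith
  have e5 := norm_sub_le_norm_sub_add_norm_sub
    (∫ u in Set.Ioi 0, h (Real.exp (-u)) • F x u)
    (∫ u in Set.Ioi 0, p.eval (Real.exp (-u)) • F x u)
    (∫ u in Set.Ioi 0, h (Real.exp (-u)) • F₀ u)
  have e6 := norm_sub_le_norm_sub_add_norm_sub
    (∫ u in Set.Ioi 0, p.eval (Real.exp (-u)) • F x u)
    (∫ u in Set.Ioi 0, p.eval (Real.exp (-u)) • F₀ u)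
    (∫ u in Set.Ioi 0, h (Real.exp (-u)) • F₀ u)
  have e7 := norm_sub_rev (∫ u in Set.Ioi 0, p.eval (Real.exp (-u)) • F₀ u)
    (∫ u in Set.Ioi 0, h (Real.exp (-u)) • F₀ u)
  linarith

/-- A continuous function whose Laplace transform vanishes at the positive integers is zero. -/
lemma eq_zero_of_laplace_eq_zero [CompleteSpace E] {G : ℝ → E} (hG : Continuous G)
    (hint : IntegrableOn (fun u => Real.exp (-u) • G u) (Set.Ioi 0))
    (hlap : ∀ n : ℕ, ∫ u in Set.Ioi 0, Real.exp (-((n + 1) * u)) • G u = 0) {t : ℝ}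
    (ht : 0 ≤ t) : G t = 0 := by
  have key : ∀ h : ℝ → ℝ, Continuous h →
      ∫ u in Set.Ioi 0, h (Real.exp (-u)) • (Real.exp (-u) • G u) = 0 := by
    intro h hh
    have hlim := tendsto_integral_comp_exp_smul (l := (atTop : Filter ℕ))
      (F := fun _ u => Real.exp (-u) • G u) (F₀ := fun _ => (0 : E))
      (C := ∫ u in Set.Ioi 0, ‖Real.exp (-u) • G u‖)
      (Eventually.of_forall fun _ => hint) integrableOn_zero
      (Eventually.of_forall fun _ => le_rfl) (fun n => by
        have h0 := hlap n
        have : ∀ u : ℝ, Real.exp (-u) ^ n • (Real.exp (-u) • G u) =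
            Real.exp (-((n + 1) * u)) • G u := by
          intro u
          rw [smul_smul, ← pow_succ, ← Real.exp_nat_mul]
          congr 2
          push_cast
          ring
        simp only [this, h0, smul_zero, integral_zero]
        exact tendsto_const_nhds) hh
    simp only [smul_zero, integral_zero] at hlim
    exact tendsto_nhds_unique tendsto_const_nhds hlim
  -- every test function on the open half line has the form `h (exp (-u)) * exp (-u)`
  have hae : ∀ᵐ x : ℝ, x ∈ Set.Ioi (0 : ℝ) → G x = 0 := by
    refine isOpen_Ioi.ae_eq_zero_of_integral_contDiff_smul_eq_zero
      (hG.locallyIntegrable.locallyIntegrableOn _) fun g hg hgc hgs => ?_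
    obtain ⟨b, hb⟩ := hgc.isCompact.bddAbove
    -- the truncation at `exp (-(b + 1))` makes `x ↦ g (-log x) / x` continuous on the whole line
    set h : ℝ → ℝ := fun x => g (-Real.log (max x (Real.exp (-(b + 1))))) /
      max x (Real.exp (-(b + 1)))
    have hmax : ∀ x, max x (Real.exp (-(b + 1))) ≠ 0 := fun x =>
      (lt_max_of_lt_right (Real.exp_pos _)).ne'
    have hh : Continuous h := by
      refine Continuous.div (hg.continuous.comp (Continuous.neg ?_)) (by fun_prop) hmax
      exact Continuous.log (by fun_prop) hmax
    have hgb : ∀ u, b < u → g u = 0 := fun u hu => by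
      by_contra hne
      exact absurd (hb (subset_tsupport g hne)) (not_le.2 hu)
    have hval : ∀ u, h (Real.exp (-u)) • (Real.exp (-u) • G u) = g u • G u := by
      intro u
      rcases le_total u (b + 1) with hu | hu
      · have : max (Real.exp (-u)) (Real.exp (-(b + 1))) = Real.exp (-u) :=
          max_eq_left (Real.exp_le_exp.2 (by linarith))
        simp only [h, this, Real.log_exp, neg_neg, smul_smul]
        rw [div_mul_cancel₀ _ (Real.exp_pos _).ne']
      · have : max (Real.exp (-u)) (Real.exp (-(b + 1))) = Real.exp (-(b + 1)) :=
          max_eq_right (Real.exp_le_exp.2 (by linarith))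
        simp only [h, this, Real.log_exp, neg_neg]
        rw [hgb (b + 1) (by linarith), hgb u (by linarith)]
        simp
    have h0 := key h hh
    simp only [hval] at h0
    rw [← setIntegral_eq_integral_of_forall_compl_eq_zero (s := Set.Ioi 0), h0]
    intro x hx
    rw [image_eq_zero_of_notMem_tsupport fun hx' => hx (hgs hx'), zero_smul]
  have hopen : Set.EqOn G (fun _ => 0) (Set.Ioi 0) := by
    refine Measure.eqOn_open_of_ae_eq (μ := volume) ?_ isOpen_Ioi hG.continuousOn continuousOn_const
    exact (ae_restrict_iff' measurableSet_Ioi).2 hae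
  have hcl := hopen.closure hG continuous_const
  rw [closure_Ioi] at hcl
  exact hcl ht

end Laplace

/-! ### A Tauberian theorem for monotone functions -/

section Tauberian

lemma laplace_rpow {ρ s : ℝ} (hρ : 0 ≤ ρ) (hs : 0 < s) :
    ∫ u in Set.Ioi (0 : ℝ), Real.exp (-(s * u)) * (u ^ ρ / Real.Gamma (1 + ρ)) =
      s ^ (-(ρ + 1)) := by
  have h := Real.integral_rpow_mul_exp_neg_mul_Ioi (a := ρ + 1) (r := s) (by linarith) hs
  have hΓ : Real.Gamma (1 + ρ) ≠ 0 := (Real.Gamma_pos_of_pos (by linarith)).ne'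
  calc _ = ∫ u in Set.Ioi (0 : ℝ), (Real.Gamma (1 + ρ))⁻¹ *
        (u ^ (ρ + 1 - 1) * Real.exp (-(s * u))) := by
        refine integral_congr_ae (ae_of_all _ fun u => ?_)
        simp only [add_sub_cancel_right]
        ring
    _ = _ := by
        rw [integral_const_mul, h, add_comm ρ 1, one_div, Real.inv_rpow hs.le,
          ← Real.rpow_neg hs.le]
        field_simp

lemma integrableOn_laplace_rpow {ρ : ℝ} (hρ : 0 ≤ ρ) :
    IntegrableOn (fun u : ℝ => Real.exp (-u) * (u ^ ρ / Real.Gamma (1 + ρ))) (Set.Ioi 0) := by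
  have h := laplace_rpow (s := 1) hρ one_pos
  simp only [one_mul, Real.one_rpow] at h
  -- the integral of a function that is not integrable would be zero
  exact not_imp_comm.1 integral_undef (by rw [h]; exact one_ne_zero)

/-- A test weight `h (exp (-u)) * exp (-u)` concentrated on `[a, b]`. -/
lemma exists_test_weight {a b : ℝ} (ha : 0 < a) (hab : a < b) :
    ∃ h : ℝ → ℝ, Continuous h ∧ (∀ x, 0 ≤ h x) ∧
      (∀ u, u ∉ Set.Icc a b → h (Real.exp (-u)) = 0) ∧
      IntegrableOn (fun u => h (Real.exp (-u)) * Real.exp (-u)) (Set.Ioi 0) ∧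
      0 < ∫ u in Set.Ioi 0, h (Real.exp (-u)) * Real.exp (-u) := by
  set h : ℝ → ℝ := fun x => max 0 ((x - Real.exp (-b)) * (Real.exp (-a) - x))
  have hh : Continuous h := by fun_prop
  have h0 : ∀ x, 0 ≤ h x := fun x => le_max_left _ _
  have hsupp : ∀ u, u ∉ Set.Icc a b → h (Real.exp (-u)) = 0 := by
    intro u hu
    refine max_eq_left ?_
    have hlt : Real.exp (-b) < Real.exp (-a) := Real.exp_lt_exp.2 (by linarith)
    rcases not_and_or.1 hu with hu | hu
    · have : Real.exp (-a) < Real.exp (-u) := Real.exp_lt_exp.2 (by linarith)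
      exact mul_nonpos_of_nonneg_of_nonpos (by linarith) (by linarith)
    · have : Real.exp (-u) < Real.exp (-b) := Real.exp_lt_exp.2 (by linarith)
      exact mul_nonpos_of_nonpos_of_nonneg (by linarith) (by linarith)
  set w : ℝ → ℝ := fun u => h (Real.exp (-u)) * Real.exp (-u)
  have hw : Continuous w := by fun_prop
  have hwc : HasCompactSupport w := HasCompactSupport.intro (K := Set.Icc a b) isCompact_Icc
    fun u hu => by simp only [w, hsupp u hu, zero_mul]
  refine ⟨h, hh, h0, hsupp, (hw.integrable_of_hasCompactSupport hwc).integrableOn, ?_⟩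
  rw [setIntegral_eq_integral_of_forall_compl_eq_zero]
  · refine hw.integral_pos_of_hasCompactSupport_nonneg_nonzero hwc
      (fun u => mul_nonneg (h0 _) (Real.exp_pos _).le) (x := (a + b) / 2) ?_
    have h1 : Real.exp (-b) < Real.exp (-((a + b) / 2)) := Real.exp_lt_exp.2 (by linarith)
    have h2 : Real.exp (-((a + b) / 2)) < Real.exp (-a) := Real.exp_lt_exp.2 (by linarith)
    refine (mul_pos (lt_max_of_lt_right ?_) (Real.exp_pos _)).ne'
    exact mul_pos (by linarith) (by linarith)
  · intro u hu
    simp only [hsupp u fun hu' => hu (ha.trans_le hu'.1), zero_mul]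

/-- Karamata's Tauberian theorem, for a monotone function. The rescaled functions
`f (lam * u) / (C * lam ^ ρ)` have Laplace transforms converging to that of `u ^ ρ / Γ (1 + ρ)`;
integrating them against weights concentrated just to the right and just to the left of `1`, and
using monotonicity, bounds the value at `1`. -/
theorem isEquivalent_of_laplace_isEquivalent {f : ℝ → ℝ} (hmono : MonotoneOn f (Set.Ici 0))
    (hf0 : ∀ t, 0 ≤ t → 0 ≤ f t)
    (hint : ∀ s, 0 < s → IntegrableOn (fun t => Real.exp (-(s * t)) * f t) (Set.Ioi 0))
    {C ρ : ℝ} (hC : 0 < C) (hρ : 0 ≤ ρ)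
    (hlap : (fun s : ℝ => ∫ t in Set.Ioi 0, Real.exp (-(s * t)) * f t) ~[𝓝[>] 0]
      fun s => C * s ^ (-(ρ + 1))) :
    f ~[atTop] fun t => C / Real.Gamma (1 + ρ) * t ^ ρ := by
  have hΓ : 0 < Real.Gamma (1 + ρ) := Real.Gamma_pos_of_pos (by linarith)
  set G : ℝ → ℝ → ℝ := fun lam u => f (lam * u) / (C * lam ^ ρ)
  set G₀ : ℝ → ℝ := fun u => u ^ ρ / Real.Gamma (1 + ρ)
  set L : ℝ → ℝ := fun s => ∫ t in Set.Ioi 0, Real.exp (-(s * t)) * f t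
  have hexp : ∀ (n : ℕ) (u : ℝ), Real.exp (-u) ^ n * Real.exp (-u) =
      Real.exp (-((n + 1 : ℝ) * u)) := by
    intro n u
    rw [← pow_succ, ← Real.exp_nat_mul]
    congr 1
    push_cast
    ring
  have hscale : ∀ (lam : ℝ), 0 < lam → ∀ s : ℝ,
      ∫ u in Set.Ioi 0, Real.exp (-(s * u)) * G lam u =
        lam⁻¹ * L (s / lam) / (C * lam ^ ρ) := by
    intro lam hlam s
    have h := integral_comp_mul_left_Ioi (fun t => Real.exp (-(s / lam * t)) * f t) 0 hlam
    rw [mul_zero, smul_eq_mul] at h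
    rw [← h, ← integral_div]
    refine integral_congr_ae (ae_of_all _ fun u => ?_)
    simp only [G]
    rw [show s / lam * (lam * u) = s * u by field_simp]
    ring
  have hGint : ∀ lam : ℝ, 0 < lam →
      IntegrableOn (fun u => Real.exp (-u) * G lam u) (Set.Ioi 0) := by
    intro lam hlam
    have h := (integrableOn_Ioi_comp_mul_left_iff
      (fun t => Real.exp (-(1 / lam * t)) * f t) 0 hlam).2 (by
        rw [mul_zero]; exact hint _ (by positivity))
    refine (h.div_const (C * lam ^ ρ)).congr (ae_of_all _ fun u => ?_)
    simp only [G]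
    rw [show 1 / lam * (lam * u) = u by field_simp]
    ring
  -- the moments in `exp (-u)` are values of the Laplace transform at integers
  have hmom : ∀ n : ℕ, Tendsto (fun lam => ∫ u in Set.Ioi 0,
      Real.exp (-u) ^ n • (Real.exp (-u) * G lam u)) atTop
      (𝓝 (∫ u in Set.Ioi 0, Real.exp (-u) ^ n • (Real.exp (-u) * G₀ u))) := by
    intro n
    have hn : (0 : ℝ) < n + 1 := by positivity
    simp only [smul_eq_mul, ← mul_assoc, hexp]
    rw [laplace_rpow hρ hn]
    have hlim : Tendsto (fun lam : ℝ => (n + 1 : ℝ) / lam) atTop (𝓝[>] 0) := by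
      refine tendsto_nhdsWithin_iff.2 ⟨tendsto_const_nhds.div_atTop tendsto_id, ?_⟩
      filter_upwards [eventually_gt_atTop 0] with lam hlam
      exact div_pos hn hlam
    have hq := (isEquivalent_iff_tendsto_one (by
      filter_upwards [self_mem_nhdsWithin] with s (hs : 0 < s)
      positivity)).1 hlap
    have h1 := (hq.comp hlim).mul_const ((n + 1 : ℝ) ^ (-(ρ + 1)))
    rw [one_mul] at h1
    refine h1.congr' ?_
    filter_upwards [eventually_gt_atTop 0] with lam hlam
    rw [hscale lam hlam]
    simp only [Function.comp, Pi.div_apply]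
    rw [Real.div_rpow hn.le hlam.le, Real.rpow_neg hlam.le, Real.rpow_add hlam, Real.rpow_one]
    have := Real.rpow_pos_of_pos hlam ρ
    have := Real.rpow_pos_of_pos hn (-(ρ + 1))
    field_simp
  have hGnn : ∀ lam : ℝ, 0 < lam → ∀ u, 0 < u → 0 ≤ G lam u := fun lam hlam u hu =>
    div_nonneg (hf0 _ (by positivity)) (by positivity)
  have hGmono : ∀ lam : ℝ, 0 < lam → ∀ u v, 0 ≤ u → u ≤ v → G lam u ≤ G lam v :=
    fun lam hlam u v hu huv => div_le_div_of_nonneg_right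
      (hmono (Set.mem_Ici.2 (by positivity)) (Set.mem_Ici.2 (by
        have := hu.trans huv
        positivity)) (mul_le_mul_of_nonneg_left huv hlam.le)) (by positivity)
  have hmass : ∀ᶠ lam in atTop, ∫ u in Set.Ioi 0, ‖Real.exp (-u) * G lam u‖ ≤ 2 := by
    have h0 := hmom 0
    simp only [pow_zero, one_smul] at h0
    have hG₀1 : ∫ u in Set.Ioi 0, Real.exp (-u) * G₀ u = 1 := by
      simpa using laplace_rpow (s := 1) hρ one_pos
    rw [hG₀1] at h0
    filter_upwards [h0.eventually (ge_mem_nhds (by norm_num : (1 : ℝ) < 2)),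
      eventually_gt_atTop 0] with lam h1 hlam
    refine (le_of_eq ?_).trans h1
    refine setIntegral_congr_fun measurableSet_Ioi fun u hu => ?_
    exact Real.norm_of_nonneg (mul_nonneg (Real.exp_pos _).le (hGnn lam hlam u hu))
  have htrans : ∀ h : ℝ → ℝ, Continuous h →
      Tendsto (fun lam => ∫ u in Set.Ioi 0, h (Real.exp (-u)) • (Real.exp (-u) * G lam u)) atTop
        (𝓝 (∫ u in Set.Ioi 0, h (Real.exp (-u)) • (Real.exp (-u) * G₀ u))) := fun h hh =>
    tendsto_integral_comp_exp_smul (by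
      filter_upwards [eventually_gt_atTop 0] with lam hlam using hGint lam hlam)
      (integrableOn_laplace_rpow hρ) hmass hmom hh
  -- a weighted mean over `[a, b]` of a monotone function lies between its values at the ends
  have hbounds : ∀ (g : ℝ → ℝ) (h : ℝ → ℝ) (a b : ℝ), 0 < a → (∀ u v, 0 ≤ u → u ≤ v → g u ≤ g v) →
      Continuous h → (∀ x, 0 ≤ h x) → (∀ u, u ∉ Set.Icc a b → h (Real.exp (-u)) = 0) →
      IntegrableOn (fun u => h (Real.exp (-u)) * Real.exp (-u)) (Set.Ioi 0) →
      IntegrableOn (fun u => Real.exp (-u) * g u) (Set.Ioi 0) →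
      g a * (∫ u in Set.Ioi 0, h (Real.exp (-u)) * Real.exp (-u)) ≤
        ∫ u in Set.Ioi 0, h (Real.exp (-u)) • (Real.exp (-u) * g u) ∧
      ∫ u in Set.Ioi 0, h (Real.exp (-u)) • (Real.exp (-u) * g u) ≤
        g b * ∫ u in Set.Ioi 0, h (Real.exp (-u)) * Real.exp (-u) := by
    intro g h a b ha hg hh h0 hsupp hwi hgi
    have hi := integrableOn_comp_exp_smul hgi hh
    rw [← integral_const_mul, ← integral_const_mul]
    constructor
    · refine integral_mono (hwi.const_mul _) hi fun u => ?_
      simp only [smul_eq_mul]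
      by_cases hu : u ∈ Set.Icc a b
      · have := mul_le_mul_of_nonneg_right (hg a u ha.le hu.1)
          (mul_nonneg (h0 (Real.exp (-u))) (Real.exp_pos (-u)).le)
        linarith
      · simp [hsupp u hu]
    · refine integral_mono hi (hwi.const_mul _) fun u => ?_
      simp only [smul_eq_mul]
      by_cases hu : u ∈ Set.Icc a b
      · have := mul_le_mul_of_nonneg_right (hg u b (ha.le.trans hu.1) hu.2)
          (mul_nonneg (h0 (Real.exp (-u))) (Real.exp_pos (-u)).le)
        linarith
      · simp [hsupp u hu]
  have hG₀mono : ∀ u v, 0 ≤ u → u ≤ v → G₀ u ≤ G₀ v := fun u v hu huv =>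
    div_le_div_of_nonneg_right (Real.rpow_le_rpow hu huv hρ) hΓ.le
  have hG₀cont : ContinuousAt G₀ 1 :=
    (Real.continuousAt_rpow_const 1 ρ (Or.inl one_ne_zero)).div_const _
  have hone : Tendsto (fun lam => G lam 1) atTop (𝓝 (G₀ 1)) := by
    refine tendsto_order.2 ⟨fun c hc => ?_, fun c hc => ?_⟩
    · have h1 : ∀ᶠ a in 𝓝[<] (1 : ℝ), c < G₀ a :=
        nhdsWithin_le_nhds (hG₀cont.eventually (lt_mem_nhds hc))
      have h2 : ∀ᶠ a in 𝓝[<] (1 : ℝ), a ∈ Set.Ioo (0 : ℝ) 1 := Ioo_mem_nhdsLT one_pos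
      obtain ⟨a, ha1, ha2⟩ := (h1.and h2).exists
      obtain ⟨h, hh, h0, hsupp, hwi, hwpos⟩ := exists_test_weight ha2.1 ha2.2
      have hlow := (hbounds G₀ h a 1 ha2.1 hG₀mono hh h0 hsupp hwi
        (integrableOn_laplace_rpow hρ)).1
      have hlt := lt_of_lt_of_le (mul_lt_mul_of_pos_right ha1 hwpos) hlow
      filter_upwards [(htrans h hh).eventually (lt_mem_nhds hlt), eventually_gt_atTop 0]
        with lam h3 hlam
      have hup := (hbounds (G lam) h a 1 ha2.1 (hGmono lam hlam) hh h0 hsupp hwi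
        (hGint lam hlam)).2
      exact lt_of_mul_lt_mul_right (h3.trans_le hup) hwpos.le
    · have h1 : ∀ᶠ b in 𝓝[>] (1 : ℝ), G₀ b < c :=
        nhdsWithin_le_nhds (hG₀cont.eventually (gt_mem_nhds hc))
      obtain ⟨b, hb1, hb2⟩ := (h1.and self_mem_nhdsWithin).exists
      obtain ⟨h, hh, h0, hsupp, hwi, hwpos⟩ := exists_test_weight one_pos hb2
      have hup := (hbounds G₀ h 1 b one_pos hG₀mono hh h0 hsupp hwi
        (integrableOn_laplace_rpow hρ)).2
      have hlt := lt_of_le_of_lt hup (mul_lt_mul_of_pos_right hb1 hwpos)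
      filter_upwards [(htrans h hh).eventually (gt_mem_nhds hlt), eventually_gt_atTop 0]
        with lam h3 hlam
      have hlow := (hbounds (G lam) h 1 b one_pos (hGmono lam hlam) hh h0 hsupp hwi
        (hGint lam hlam)).1
      exact lt_of_mul_lt_mul_right (hlow.trans_lt h3) hwpos.le
  refine (isEquivalent_iff_tendsto_one (by
    filter_upwards [eventually_gt_atTop 0] with t ht
    positivity)).2 ?_
  have h1 := hone.mul_const (Real.Gamma (1 + ρ))
  simp only [G₀, Real.one_rpow, one_div, inv_mul_cancel₀ hΓ.ne'] at h1
  refine h1.congr' ?_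
  filter_upwards [eventually_gt_atTop 0] with t ht
  simp only [G, mul_one, Pi.div_apply]
  have := Real.rpow_pos_of_pos ht ρ
  field_simp

end Tauberian

/-! ### The joint law of waiting times and jumps -/

section PathLaw

variable {N : ℕ}

/-- The probability that the chain of internal states starts with the path `p`. -/
def pathWeight (M : Matrix (Fin N) (Fin N) ℝ) (init : Fin N → ℝ) {n : ℕ}
    (p : Fin (n + 1) → Fin N) : ℝ :=
  init (p 0) * ∏ m : Fin n, M (p m.castSucc) (p m.succ)

/-- The law of the first `n + 1` waiting times: the mixture over all paths of internal states of
the corresponding product measures. -/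
def waitLaw (M : Matrix (Fin N) (Fin N) ℝ) (init : Fin N → ℝ) (φ : Fin N → Measure ℝ) (n : ℕ) :
    Measure (Fin (n + 1) → ℝ) :=
  ∑ p : Fin (n + 1) → Fin N,
    (pathWeight M init p).toNNReal • Measure.pi fun m => φ (p m)

instance (M : Matrix (Fin N) (Fin N) ℝ) (init : Fin N → ℝ) (φ : Fin N → Measure ℝ)
    [∀ i, IsProbabilityMeasure (φ i)] (n : ℕ) : IsFiniteMeasure (waitLaw M init φ n) := by
  unfold waitLaw
  infer_instance

lemma pathWeight_nonneg {M : Matrix (Fin N) (Fin N) ℝ} (hM : M ∈ Matrix.rowStochastic ℝ (Fin N))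
    {init : Fin N → ℝ} (hi : init ∈ stdSimplex ℝ (Fin N)) {n : ℕ} (p : Fin (n + 1) → Fin N) :
    0 ≤ pathWeight M init p :=
  mul_nonneg (hi.1 _) (Finset.prod_nonneg fun _ _ => Matrix.nonneg_of_mem_rowStochastic hM)

lemma pow_mulVec_eq_sum_paths (A : Matrix (Fin N) (Fin N) ℝ) (x : Fin N → ℝ) (n : ℕ) (i : Fin N) :
    (A ^ n *ᵥ x) i = ∑ j : Fin n → Fin N,
      (∏ m : Fin n, A ((Fin.cons i j : Fin (n + 1) → Fin N) m.castSucc) (j m)) *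
        x ((Fin.cons i j : Fin (n + 1) → Fin N) (Fin.last n)) := by
  induction n generalizing i with
  | zero => simp
  | succ n ih =>
    rw [pow_succ', ← Matrix.mulVec_mulVec,
      ← (Fin.consEquiv fun _ : Fin (n + 1) => Fin N).sum_comp, Fintype.sum_prod_type]
    simp only [Matrix.mulVec, dotProduct] at ih ⊢
    refine Finset.sum_congr rfl fun k _ => ?_
    rw [ih, Finset.mul_sum]
    refine Finset.sum_congr rfl fun j _ => ?_
    rw [Fin.prod_univ_succ, ← mul_assoc]
    congr 1

lemma dotProduct_pow_mulVec_eq_sum_paths (A : Matrix (Fin N) (Fin N) ℝ) (w x : Fin N → ℝ) (n : ℕ) :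
    w ⬝ᵥ (A ^ n *ᵥ x) = ∑ p : Fin (n + 1) → Fin N,
      w (p 0) * (∏ m : Fin n, A (p m.castSucc) (p m.succ)) * x (p (Fin.last n)) := by
  rw [← (Fin.consEquiv fun _ : Fin (n + 1) => Fin N).sum_comp, Fintype.sum_prod_type]
  refine Finset.sum_congr rfl fun i _ => ?_
  rw [pow_mulVec_eq_sum_paths, Finset.mul_sum]
  refine Finset.sum_congr rfl fun j _ => ?_
  rw [← mul_assoc]
  congr 1

/-- The expectation of a product over the waiting times is a sum over paths, that is, a matrix
element of a power. -/
lemma integral_waitLaw_prod {M : Matrix (Fin N) (Fin N) ℝ} (hM : M ∈ Matrix.rowStochastic ℝ (Fin N))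
    {init : Fin N → ℝ} (hi : init ∈ stdSimplex ℝ (Fin N)) (φ : Fin N → Measure ℝ)
    [∀ i, IsProbabilityMeasure (φ i)] (n : ℕ) {f : ℝ → ℝ} (hf : Measurable f)
    {c : ℝ} (hfc : ∀ i, ∀ᵐ x ∂φ i, ‖f x‖ ≤ c) :
    ∫ x, ∏ m, f (x m) ∂waitLaw M init φ n =
      init ⬝ᵥ ((Matrix.diagonal (fun i => ∫ x, f x ∂φ i) * M) ^ n *ᵥ fun i => ∫ x, f x ∂φ i) := by
  have hint : ∀ p : Fin (n + 1) → Fin N,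
      Integrable (fun x : Fin (n + 1) → ℝ => ∏ m, f (x m)) (Measure.pi fun m => φ (p m)) :=
    fun p => Integrable.fintype_prod fun m =>
      Integrable.of_bound hf.aestronglyMeasurable c (hfc (p m))
  rw [waitLaw, integral_finsetSum_measure fun p _ => (hint p).smul_measure_nnreal,
    dotProduct_pow_mulVec_eq_sum_paths]
  refine Finset.sum_congr rfl fun p _ => ?_
  rw [integral_smul_nnreal_measure, integral_fintype_prod_eq_prod (fun _ => f), NNReal.smul_def,
    Real.coe_toNNReal _ (pathWeight_nonneg hM hi p), Fin.prod_univ_castSucc, pathWeight]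
  simp only [Matrix.diagonal_mul, Finset.prod_mul_distrib, smul_eq_mul]
  ring

end PathLaw

section JointLaw

variable {N : ℕ} {M : Matrix (Fin N) (Fin N) ℝ} {init : Fin N → ℝ} {φ : Fin N → Measure ℝ}
  {Λ : Measure ℝ} {Ω : Type*} [MeasurableSpace Ω] {P : Measure Ω}
  {J : ℕ → Ω → Fin N} {τ ξ : ℕ → Ω → ℝ}

lemma measure_rectangle (h : IsMultistateWalk P M init φ (fun _ => Λ) J τ ξ) {n : ℕ}
    {A C : Fin (n + 1) → Set ℝ} (hA : ∀ m, MeasurableSet (A m)) (hC : ∀ m, MeasurableSet (C m)) :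
    P {ω | ∀ m : Fin (n + 1), τ m ω ∈ A m ∧ ξ m ω ∈ C m} =
      ∑ p : Fin (n + 1) → Fin N, ENNReal.ofReal (pathWeight M init p) *
        ∏ m, φ (p m) (A m) * Λ (C m) := by
  have hcast₀ : Fin.ofNat (n + 1) 0 = 0 := rfl
  have hcast : ∀ m : Fin n, Fin.ofNat (n + 1) m = m.castSucc := fun m =>
    Fin.ext (Nat.mod_eq_of_lt (by omega))
  have hcast' : ∀ m : Fin n, Fin.ofNat (n + 1) (m + 1) = m.succ := fun m =>
    Fin.ext (Nat.mod_eq_of_lt (by omega))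
  have hcast'' : ∀ m : Fin (n + 1), Fin.ofNat (n + 1) m = m := fun m =>
    Fin.ext (Nat.mod_eq_of_lt m.2)
  have hpath : ∀ p : Fin (n + 1) → Fin N,
      P {ω | ∀ m : Fin (n + 1), J m ω = p m ∧ τ m ω ∈ A m ∧ ξ m ω ∈ C m} =
        ENNReal.ofReal (pathWeight M init p) * ∏ m, φ (p m) (A m) * Λ (C m) := by
    intro p
    -- `law` takes sequences indexed by `ℕ`, of which only the first `n + 1` entries matter
    have h1 := h.law n (fun m => p (Fin.ofNat (n + 1) m))
      (fun m => A (Fin.ofNat (n + 1) m)) (fun m => C (Fin.ofNat (n + 1) m))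
      (fun _ => hA _) (fun _ => hC _)
    rw [Finset.prod_range, Finset.prod_range] at h1
    simp only [hcast₀, hcast, hcast', hcast''] at h1
    rw [pathWeight, ← h1]
    congr 1
    ext ω
    simp only [Set.mem_ofPred_eq]
    constructor
    · intro hω m hm
      have := hω ⟨m, Nat.lt_succ_of_le hm⟩
      have hm' := hcast'' ⟨m, Nat.lt_succ_of_le hm⟩
      simp only at hm' this
      rwa [hm']
    · intro hω m
      have := hω m (Nat.le_of_lt_succ m.2)
      rwa [hcast''] at this
  simp only [← hpath]
  rw [← tsum_fintype (L := .unconditional _), ← measure_iUnion]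
  · congr 1
    ext ω
    simp only [Set.mem_ofPred_eq, Set.mem_iUnion]
    constructor
    · intro hω
      exact ⟨fun m => J m ω, fun m => ⟨rfl, hω m⟩⟩
    · rintro ⟨p, hp⟩ m
      exact (hp m).2
  · intro p q hpq
    refine Set.disjoint_left.2 fun ω hp hq => hpq ?_
    funext m
    rw [← (hp m).1, ← (hq m).1]
  · intro p
    have : {ω | ∀ m : Fin (n + 1), J m ω = p m ∧ τ m ω ∈ A m ∧ ξ m ω ∈ C m} =
        ⋂ m : Fin (n + 1), J m ⁻¹' {p m} ∩ (τ m ⁻¹' A m ∩ ξ m ⁻¹' C m) := by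
      ext ω; simp [Set.mem_iInter]
    rw [this]
    exact MeasurableSet.iInter fun m => (h.measurable_state m (measurableSet_singleton _)).inter
      ((h.measurable_wait m (hA m)).inter (h.measurable_jump m (hC m)))

lemma measurable_waits (h : IsMultistateWalk P M init φ (fun _ => Λ) J τ ξ) (n : ℕ) :
    Measurable (fun ω => fun m : Fin (n + 1) => τ m ω) :=
  measurable_pi_lambda _ fun m => h.measurable_wait m

lemma measurable_jumps (h : IsMultistateWalk P M init φ (fun _ => Λ) J τ ξ) (n : ℕ) :
    Measurable (fun ω => fun m : Fin (n + 1) => ξ m ω) :=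
  measurable_pi_lambda _ fun m => h.measurable_jump m

lemma waitLaw_rectangle (n : ℕ) [∀ i, IsProbabilityMeasure (φ i)] (A : Fin (n + 1) → Set ℝ) :
    waitLaw M init φ n (Set.univ.pi A) =
      ∑ p : Fin (n + 1) → Fin N, ENNReal.ofReal (pathWeight M init p) * ∏ m, φ (p m) (A m) := by
  rw [waitLaw, Measure.finsetSum_apply]
  refine Finset.sum_congr rfl fun p _ => ?_
  rw [Measure.smul_apply, Measure.pi_pi]
  rfl

/-- The jumps are independent of the waiting times, and among themselves: the jump law does not
depend on the internal state, so it factors out of the mixture over the paths. -/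
lemma map_waits_jumps (h : IsMultistateWalk P M init φ (fun _ => Λ) J τ ξ)
    [∀ i, IsProbabilityMeasure (φ i)] [IsProbabilityMeasure Λ] (n : ℕ) :
    P.map (fun ω => ((fun m : Fin (n + 1) => τ m ω), (fun m : Fin (n + 1) => ξ m ω))) =
      (waitLaw M init φ n).prod (Measure.pi fun _ => Λ) := by
  have huniv : (Set.univ : Set (Fin (n + 1) → ℝ)) ∈
      Set.univ.pi '' Set.univ.pi fun _ : Fin (n + 1) => {s : Set ℝ | MeasurableSet s} :=
    ⟨fun _ => Set.univ, fun _ _ => by simp, Set.pi_univ _⟩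
  have hspan : ∀ (μ : Measure (Fin (n + 1) → ℝ)) [IsFiniteMeasure μ], μ.FiniteSpanningSetsIn
      (Set.univ.pi '' Set.univ.pi fun _ : Fin (n + 1) => {s : Set ℝ | MeasurableSet s}) :=
    fun μ _ => ⟨fun _ => Set.univ, fun _ => huniv, fun _ => measure_lt_top μ _,
      Set.iUnion_const _⟩
  refine (Measure.prod_eq_generateFrom generateFrom_pi generateFrom_pi isPiSystem_pi isPiSystem_pi
    (hspan _) (hspan _) ?_).symm
  rintro _ ⟨A, hA, rfl⟩ _ ⟨C, hC, rfl⟩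
  have hA' : ∀ m, MeasurableSet (A m) := fun m => hA m (Set.mem_univ m)
  have hC' : ∀ m, MeasurableSet (C m) := fun m => hC m (Set.mem_univ m)
  rw [Measure.map_apply, Measure.pi_pi, waitLaw_rectangle, Finset.sum_mul]
  · refine Eq.trans ?_ ((measure_rectangle h hA' hC').trans (Finset.sum_congr rfl fun p _ => ?_))
    · congr 1
      ext ω
      simp [Set.mem_pi, forall_and]
    · rw [Finset.prod_mul_distrib, mul_assoc]
  · exact (measurable_waits h n).prodMk (measurable_jumps h n)
  · exact (MeasurableSet.univ_pi hA').prod (MeasurableSet.univ_pi hC')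

lemma map_waits (h : IsMultistateWalk P M init φ (fun _ => Λ) J τ ξ)
    [∀ i, IsProbabilityMeasure (φ i)] [IsProbabilityMeasure Λ] (n : ℕ) :
    P.map (fun ω => fun m : Fin (n + 1) => τ m ω) = waitLaw M init φ n := by
  have h1 := congrArg (Measure.map Prod.fst) (map_waits_jumps h n)
  rw [Measure.map_map measurable_fst ((measurable_waits h n).prodMk (measurable_jumps h n)),
    ← Measure.fst, Measure.fst_prod] at h1
  exact h1

lemma indepFun_waits_jumps (h : IsMultistateWalk P M init φ (fun _ => Λ) J τ ξ)
    [IsProbabilityMeasure P]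
    [∀ i, IsProbabilityMeasure (φ i)] [IsProbabilityMeasure Λ] (n : ℕ) :
    P.map (fun ω => fun m : Fin (n + 1) => ξ m ω) = Measure.pi (fun _ => Λ) ∧
    IndepFun (fun ω => fun m : Fin (n + 1) => τ m ω) (fun ω => fun m : Fin (n + 1) => ξ m ω) P := by
  have h2 : waitLaw M init φ n Set.univ = 1 := by
    rw [← map_waits h n, Measure.map_apply (measurable_waits h n) MeasurableSet.univ]
    simp
  have h1 : P.map (fun ω => fun m : Fin (n + 1) => ξ m ω) = Measure.pi (fun _ => Λ) := by
    have h3 := congrArg (Measure.map Prod.snd) (map_waits_jumps h n)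
    rw [Measure.map_map measurable_snd ((measurable_waits h n).prodMk (measurable_jumps h n)),
      Measure.map_snd_prod, h2, one_smul] at h3
    exact h3
  refine ⟨h1, (indepFun_iff_map_prod_eq_prod_map_map (measurable_waits h n).aemeasurable
    (measurable_jumps h n).aemeasurable).2 ?_⟩
  rw [map_waits_jumps h n, map_waits h n]
  congr 1
  exact h1.symm

lemma ae_wait_pos (h : IsMultistateWalk P M init φ (fun _ => Λ) J τ ξ)
    [∀ i, IsProbabilityMeasure (φ i)] [IsProbabilityMeasure Λ]
    (hφ : ∀ i, ∀ᵐ u ∂φ i, 0 < u) : ∀ᵐ ω ∂P, ∀ m, 0 < τ m ω := by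
  refine ae_all_iff.2 fun m => ?_
  have h1 : ∀ᵐ x ∂waitLaw M init φ m, 0 < x (Fin.last m) := by
    rw [ae_iff, waitLaw, Measure.finsetSum_apply]
    refine Finset.sum_eq_zero fun p _ => ?_
    have h2 : ∀ᵐ x ∂Measure.pi (fun k => φ (p k)), 0 < x (Fin.last m) :=
      (measurePreserving_eval (fun k => φ (p k)) (Fin.last m)).quasiMeasurePreserving.ae
        (hφ (p (Fin.last m)))
    rw [Measure.smul_apply, ae_iff.1 h2, smul_zero]
  rw [← map_waits h m] at h1
  simpa using ae_of_ae_map (measurable_waits h m).aemeasurable h1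

/-- The waiting periods' end times have Laplace transform `⟨init|(Φ M)ⁿ|Σ⟩`. -/
lemma integral_exp_neg_sum (hM : M ∈ Matrix.rowStochastic ℝ (Fin N))
    (hi : init ∈ stdSimplex ℝ (Fin N)) (h : IsMultistateWalk P M init φ (fun _ => Λ) J τ ξ)
    [IsProbabilityMeasure P] [∀ i, IsProbabilityMeasure (φ i)] [IsProbabilityMeasure Λ]
    (hφ : ∀ i, ∀ᵐ u ∂φ i, 0 < u) {s : ℝ} (hs : 0 < s) (n : ℕ) :
    ∫ ω, Real.exp (-(s * ∑ m ∈ Finset.range n, τ m ω)) ∂P =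
      init ⬝ᵥ ((Matrix.diagonal (fun i => ∫ u, Real.exp (-(s * u)) ∂φ i) * M) ^ n *ᵥ 1) := by
  cases n with
  | zero => simpa [dotProduct] using hi.2.symm
  | succ n =>
    have hf : Measurable fun u : ℝ => Real.exp (-(s * u)) := by fun_prop
    have hprod : ∀ ω, Real.exp (-(s * ∑ m ∈ Finset.range (n + 1), τ m ω)) =
        ∏ m : Fin (n + 1), Real.exp (-(s * τ m ω)) := by
      intro ω
      rw [← Real.exp_sum, Finset.sum_range, Finset.mul_sum, Finset.sum_neg_distrib]
    simp only [hprod]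
    have h1 := integral_waitLaw_prod hM hi φ n hf (c := 1) (fun i => by
      filter_upwards [hφ i] with u hu
      rw [Real.norm_of_nonneg (Real.exp_pos _).le, Real.exp_le_one_iff]
      nlinarith)
    rw [← map_waits h n, integral_map (measurable_waits h n).aemeasurable
      (by fun_prop : Measurable fun x : Fin (n + 1) → ℝ =>
        ∏ m, Real.exp (-(s * x m))).aestronglyMeasurable] at h1
    -- the last factor `M` may be appended since `M` maps the vector of ones to itself
    rw [h1, pow_succ, ← Matrix.mulVec_mulVec]
    congr 2
    ext i
    rw [diagonal_mul_mulVec, Matrix.one_vecMul_of_mem_rowStochastic hM, Pi.one_apply, mul_one]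

end JointLaw

section GaussianJumps

variable {N : ℕ} {M : Matrix (Fin N) (Fin N) ℝ} {init : Fin N → ℝ} {φ : Fin N → Measure ℝ}
  {σ : ℝ} {Ω : Type*} [MeasurableSpace Ω] {P : Measure Ω} [IsProbabilityMeasure P]
  {J : ℕ → Ω → Fin N} {τ ξ : ℕ → Ω → ℝ}

instance (σ : ℝ) : IsProbabilityMeasure (jumpLaw σ) := by
  unfold jumpLaw
  infer_instance

lemma map_sum_jumps (h : IsMultistateWalk P M init φ (fun _ => jumpLaw σ) J τ ξ)
    [∀ i, IsProbabilityMeasure (φ i)] (n : ℕ) :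
    P.map (fun ω => ∑ m ∈ Finset.range n, ξ m ω) =
      gaussianReal 0 (n * Real.toNNReal (2 * σ ^ 2)) := by
  have hX : Measurable (fun ω => ∑ m ∈ Finset.range n, ξ m ω) :=
    Finset.measurable_sum _ fun m _ => h.measurable_jump m
  have : IsProbabilityMeasure (P.map (fun ω => ∑ m ∈ Finset.range n, ξ m ω)) :=
    Measure.isProbabilityMeasure_map hX.aemeasurable
  refine Measure.ext_of_charFun ?_
  ext k
  rw [charFun_gaussianReal, charFun_apply_real,
    integral_map hX.aemeasurable (by fun_prop : Measurable _).aestronglyMeasurable]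
  -- the last of the `n + 1` jumps does not enter the sum: its factor is the constant one
  have hprod : ∀ ω, Complex.exp (k * (∑ m ∈ Finset.range n, ξ m ω : ℝ) * Complex.I) =
      ∏ m : Fin (n + 1), (if m = Fin.last n then fun _ : ℝ => (1 : ℂ) else
        fun x : ℝ => Complex.exp (k * x * Complex.I)) (ξ m ω) := by
    intro ω
    rw [Fin.prod_univ_castSucc]
    simp only [Fin.castSucc_ne_last, if_false, if_true, mul_one, Fin.val_castSucc]
    rw [← Complex.exp_sum, Finset.sum_range]
    push_cast
    rw [Finset.mul_sum, Finset.sum_mul]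
  simp only [hprod]
  rw [← integral_map (f := fun x : Fin (n + 1) → ℝ => ∏ m : Fin (n + 1),
    (if m = Fin.last n then fun _ : ℝ => (1 : ℂ) else
        fun x : ℝ => Complex.exp (k * x * Complex.I)) (x m)) (measurable_jumps h n).aemeasurable,
    (indepFun_waits_jumps h n).1, integral_fintype_prod_eq_prod, Fin.prod_univ_castSucc]
  · simp only [Fin.castSucc_ne_last, if_false, if_true, integral_const, probReal_univ, one_smul,
      mul_one, ← charFun_apply_real, Finset.prod_const, Finset.card_univ, Fintype.card_fin]
    rw [jumpLaw, charFun_gaussianReal, ← Complex.exp_nat_mul]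
    congr 1
    push_cast
    ring
  · refine Measurable.aestronglyMeasurable (Finset.measurable_prod _ fun m _ => ?_)
    split_ifs <;> fun_prop

/-- The position after `n` jumps is independent of the first `n + 1` waiting times. -/
lemma indepFun_waits_sum_jumps (h : IsMultistateWalk P M init φ (fun _ => jumpLaw σ) J τ ξ)
    [∀ i, IsProbabilityMeasure (φ i)] (n : ℕ) :
    IndepFun (fun ω => fun m : Fin (n + 1) => τ m ω)
      (fun ω => ∑ m ∈ Finset.range n, ξ m ω) P := by
  have h1 := (indepFun_waits_jumps h n).2.comp (measurable_id)
    (by fun_prop : Measurable fun x : Fin (n + 1) → ℝ => ∑ m : Fin n, x m.castSucc)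
  convert! h1 using 1
  funext ω
  simp [Finset.sum_range]

end GaussianJumps

/-! ### The renewal process of waiting periods -/

section Renewal

variable {Ω : Type*}

/-- The end `τ 0 + ⋯ + τ (n - 1)` of the `n`-th waiting period. -/
def epoch (τ : ℕ → Ω → ℝ) (n : ℕ) (ω : Ω) : ℝ := ∑ m ∈ Finset.range n, τ m ω

lemma epoch_mono {τ : ℕ → Ω → ℝ} {ω : Ω} (hpos : ∀ m, 0 < τ m ω) : Monotone fun n => epoch τ n ω :=
  monotone_nat_of_le_succ fun n => by
    simp only [epoch, Finset.sum_range_succ]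
    linarith [hpos n]

lemma epoch_nonneg {τ : ℕ → Ω → ℝ} {ω : Ω} (hpos : ∀ m, 0 < τ m ω) (n : ℕ) : 0 ≤ epoch τ n ω :=
  Finset.sum_nonneg fun m _ => (hpos m).le

lemma lt_renewalCount_iff {τ : ℕ → Ω → ℝ} {ω : Ω} (hpos : ∀ m, 0 < τ m ω) {t : ℝ}
    (hdiv : ∃ n, t < epoch τ (n + 1) ω) (n : ℕ) :
    n < renewalCount τ t ω ↔ epoch τ (n + 1) ω ≤ t := by
  constructor
  · intro h
    by_contra! hlt
    exact absurd (Nat.sInf_le (s := {n : ℕ | t < ∑ m ∈ Finset.range (n + 1), τ m ω}) hlt)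
      (not_le.2 h)
  · intro h
    by_contra! hle
    have hmem : t < epoch τ (renewalCount τ t ω + 1) ω :=
      Nat.sInf_mem (s := {n : ℕ | t < ∑ m ∈ Finset.range (n + 1), τ m ω}) hdiv
    have := epoch_mono hpos (Nat.succ_le_succ hle)
    exact absurd (hmem.trans_le this) (not_lt.2 h)

lemma renewalCount_eq_iff {τ : ℕ → Ω → ℝ} {ω : Ω} (hpos : ∀ m, 0 < τ m ω) {t : ℝ} (ht : 0 ≤ t)
    (hdiv : ∃ n, t < epoch τ (n + 1) ω) (n : ℕ) :
    renewalCount τ t ω = n ↔ epoch τ n ω ≤ t ∧ t < epoch τ (n + 1) ω := by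
  have h1 := lt_renewalCount_iff hpos hdiv n
  rw [← not_le, ← h1]
  cases n with
  | zero =>
    have : epoch τ 0 ω ≤ t := by simpa [epoch] using ht
    simp only [this, true_and]
    omega
  | succ n =>
    rw [← lt_renewalCount_iff hpos hdiv n]
    omega

variable [MeasurableSpace Ω] {P : Measure Ω} {τ ξ : ℕ → Ω → ℝ}

lemma measurable_epoch (hτ : ∀ n, Measurable (τ n)) (n : ℕ) : Measurable (epoch τ n) :=
  Finset.measurable_sum _ fun m _ => hτ m

lemma measurable_renewalCount (hτ : ∀ n, Measurable (τ n)) :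
    Measurable fun q : ℝ × Ω => renewalCount τ q.1 q.2 := by
  have hset : ∀ n, MeasurableSet {q : ℝ × Ω | q.1 < epoch τ (n + 1) q.2} := fun n =>
    measurableSet_lt measurable_fst ((measurable_epoch hτ (n + 1)).comp measurable_snd)
  refine measurable_to_countable' fun n => ?_
  -- `sInf ∅ = 0` puts the paths whose epochs never exceed `t` into the event `𝒩(t) = 0`
  have : (fun q : ℝ × Ω => renewalCount τ q.1 q.2) ⁻¹' {n} =
      ({q : ℝ × Ω | q.1 < epoch τ (n + 1) q.2} ∩
        ⋂ m ∈ Finset.range n, {q : ℝ × Ω | q.1 < epoch τ (m + 1) q.2}ᶜ) ∪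
      (if n = 0 then ⋂ m, {q : ℝ × Ω | q.1 < epoch τ (m + 1) q.2}ᶜ else ∅) := by
    ext ⟨t, ω⟩
    simp only [Set.mem_preimage, Set.mem_singleton_iff, Set.mem_union, Set.mem_inter_iff,
      Set.mem_ofPred_eq, Set.mem_iInter, Finset.mem_range, Set.mem_compl_iff]
    have hdef : renewalCount τ t ω = sInf {n : ℕ | t < epoch τ (n + 1) ω} := rfl
    constructor
    · intro h
      rcases Set.eq_empty_or_nonempty {n : ℕ | t < epoch τ (n + 1) ω} with he | hne
      · right
        rw [hdef, he, Nat.sInf_empty] at h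
        rw [if_pos h.symm]
        refine Set.mem_iInter.2 fun m hm => ?_
        exact (Set.eq_empty_iff_forall_notMem.1 he m) hm
      · left
        refine ⟨?_, fun m hm hlt => ?_⟩
        · have := Nat.sInf_mem hne
          rwa [← hdef, h] at this
        · have := Nat.sInf_le (s := {n : ℕ | t < epoch τ (n + 1) ω}) hlt
          rw [← hdef, h] at this
          omega
    · rintro (⟨h1, h2⟩ | h)
      · refine le_antisymm (Nat.sInf_le h1) ?_
        by_contra! hlt
        exact h2 _ hlt (Nat.sInf_mem (s := {n : ℕ | t < epoch τ (n + 1) ω}) ⟨n, h1⟩)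
      · split_ifs at h with hn
        · have he : {n : ℕ | t < epoch τ (n + 1) ω} = ∅ :=
            Set.eq_empty_iff_forall_notMem.2 fun m hm => Set.mem_iInter.1 h m hm
          rw [hdef, he, Nat.sInf_empty, hn]
        · exact absurd h (Set.notMem_empty _)
  rw [this]
  refine MeasurableSet.union ((hset n).inter
    (Finset.measurableSet_biInter _ fun m _ => (hset m).compl)) ?_
  split_ifs
  · exact MeasurableSet.iInter fun m => (hset m).compl
  · exact MeasurableSet.empty

lemma measurable_position (hτ : ∀ n, Measurable (τ n)) (hξ : ∀ n, Measurable (ξ n)) :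
    Measurable fun q : ℝ × Ω => position τ ξ q.1 q.2 := by
  have h1 : Measurable fun q : ℕ × Ω => ∑ m ∈ Finset.range q.1, ξ m q.2 :=
    measurable_from_prod_countable_right fun n =>
      Finset.measurable_sum (Finset.range n) fun m _ => hξ m
  exact h1.comp ((measurable_renewalCount hτ).prodMk measurable_snd)

/-- Up to a null set, `𝒩(t) = n` is the event that `t` lies between the `n`-th and the `n + 1`-st
epoch. -/
lemma renewalCount_ae_eq (hpos : ∀ᵐ ω ∂P, ∀ m, 0 < τ m ω)
    (hdiv : ∀ᵐ ω ∂P, ∀ t : ℝ, ∃ n, t < epoch τ (n + 1) ω) {t : ℝ} (ht : 0 ≤ t) (n : ℕ) :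
    {ω | renewalCount τ t ω = n} =ᵐ[P] {ω | epoch τ n ω ≤ t ∧ t < epoch τ (n + 1) ω} := by
  filter_upwards [hpos, hdiv] with ω h1 h2
  exact propext (renewalCount_eq_iff h1 ht (h2 t) n)

variable [IsProbabilityMeasure P]

/-- If the Laplace transforms of the epochs are summable, then almost surely only finitely many
waiting periods end by any given time. -/
lemma ae_exists_lt_epoch (hτ : ∀ n, Measurable (τ n)) (hpos : ∀ᵐ ω ∂P, ∀ m, 0 < τ m ω)
    (hsum : Summable fun n => ∫ ω, Real.exp (-(1 * epoch τ n ω)) ∂P) :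
    ∀ᵐ ω ∂P, ∀ t : ℝ, ∃ n, t < epoch τ (n + 1) ω := by
  have hmeas : ∀ n, Measurable fun ω => Real.exp (-(1 * epoch τ n ω)) := fun n =>
    Real.measurable_exp.comp ((measurable_epoch hτ n).const_mul 1).neg
  have hint : ∀ n, Integrable (fun ω => Real.exp (-(1 * epoch τ n ω))) P := by
    intro n
    refine Integrable.of_bound (hmeas n).aestronglyMeasurable 1 ?_
    filter_upwards [hpos] with ω hω
    rw [Real.norm_of_nonneg (Real.exp_pos _).le, Real.exp_le_one_iff]
    linarith [epoch_nonneg hω n]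
  have hfin : ∫⁻ ω, ∑' n, ENNReal.ofReal (Real.exp (-(1 * epoch τ n ω))) ∂P ≠ ⊤ := by
    rw [lintegral_tsum fun n => (hmeas n).ennreal_ofReal.aemeasurable]
    have : ∀ n, ∫⁻ ω, ENNReal.ofReal (Real.exp (-(1 * epoch τ n ω))) ∂P =
        ENNReal.ofReal (∫ ω, Real.exp (-(1 * epoch τ n ω)) ∂P) := fun n =>
      (ofReal_integral_eq_lintegral_ofReal (hint n) (ae_of_all _ fun ω => (Real.exp_pos _).le)).symm
    simp only [this]
    exact hsum.tsum_ofReal_ne_top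
  have hlt := ae_lt_top (Measurable.tsum fun n => (hmeas n).ennreal_ofReal) hfin
  filter_upwards [hlt] with ω hω t
  have h0 := ENNReal.tendsto_atTop_zero_of_tsum_ne_top hω.ne
  have h1 : ∀ᶠ n in atTop, ENNReal.ofReal (Real.exp (-(1 * epoch τ n ω))) <
      ENNReal.ofReal (Real.exp (-t)) :=
    h0.eventually (gt_mem_nhds (ENNReal.ofReal_pos.2 (Real.exp_pos _)))
  obtain ⟨n, hn⟩ := ((tendsto_add_atTop_nat 1).eventually h1).exists
  refine ⟨n, ?_⟩
  rw [ENNReal.ofReal_lt_ofReal_iff (Real.exp_pos _), Real.exp_lt_exp] at hn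
  linarith

/-- The Laplace transform of `t ↦ P (epoch n ≤ t)`. -/
lemma laplace_epoch_le (hτ : ∀ n, Measurable (τ n)) (hpos : ∀ᵐ ω ∂P, ∀ m, 0 < τ m ω) {s : ℝ}
    (hs : 0 < s) (n : ℕ) :
    IntegrableOn (fun t => Real.exp (-(s * t)) * P.real {ω | epoch τ n ω ≤ t}) (Set.Ioi 0) ∧
    ∫ t in Set.Ioi 0, Real.exp (-(s * t)) * P.real {ω | epoch τ n ω ≤ t} =
      (∫ ω, Real.exp (-(s * epoch τ n ω)) ∂P) / s := by
  set f : ℝ → Ω → ℝ := fun t ω =>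
    Real.exp (-(s * t)) * Set.indicator {ω | epoch τ n ω ≤ t} (fun _ => (1 : ℝ)) ω
  have hexp : IntegrableOn (fun t : ℝ => Real.exp (-(s * t))) (Set.Ioi 0) := by
    simpa only [neg_mul] using exp_neg_integrableOn_Ioi 0 hs
  have hset : MeasurableSet {q : ℝ × Ω | epoch τ n q.2 ≤ q.1} :=
    measurableSet_le ((measurable_epoch hτ n).comp measurable_snd) measurable_fst
  have hf : Integrable (Function.uncurry f) ((volume.restrict (Set.Ioi 0)).prod P) := by
    have h1 : Integrable (fun q : ℝ × Ω => Real.exp (-(s * q.1)))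
        ((volume.restrict (Set.Ioi 0)).prod P) := hexp.comp_fst P
    refine (h1.indicator hset).congr (ae_of_all _ fun q => ?_)
    simp only [Function.uncurry, f, Set.indicator]
    by_cases hq : epoch τ n q.2 ≤ q.1 <;> simp [hq]
  have hin : ∀ t, ∫ ω, f t ω ∂P = Real.exp (-(s * t)) * P.real {ω | epoch τ n ω ≤ t} := by
    intro t
    simp only [f]
    rw [integral_const_mul, integral_indicator_const _
      (measurableSet_le (measurable_epoch hτ n) measurable_const)]
    simp
  refine ⟨?_, ?_⟩
  · have := hf.integral_prod_left
    rw [IntegrableOn]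
    simpa only [Function.uncurry_apply_pair, hin] using this
  · simp only [← hin]
    rw [integral_integral_swap hf, ← integral_div]
    refine integral_congr_ae ?_
    filter_upwards [hpos] with ω hω
    have h0 := epoch_nonneg hω n
    have h1 : ∀ t, f t ω = Set.indicator (Set.Ici (epoch τ n ω))
        (fun t => Real.exp (-s * t)) t := by
      intro t
      simp only [f, Set.indicator, Set.mem_Ici, Set.mem_ofPred_eq]
      split_ifs <;> simp
    simp only [h1]
    rw [setIntegral_indicator measurableSet_Ici]
    have h2 : (Set.Ioi 0 ∩ Set.Ici (epoch τ n ω) : Set ℝ) =ᵐ[volume] Set.Ioi (epoch τ n ω) := by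
      have e1 : (Set.Ici (epoch τ n ω) : Set ℝ) =ᵐ[volume] Set.Ioi (epoch τ n ω) :=
        Ioi_ae_eq_Ici.symm
      have e2 := (ae_eq_refl (Set.Ioi (0 : ℝ))).inter e1
      rwa [Set.inter_eq_self_of_subset_right (Set.Ioi_subset_Ioi h0)] at e2
    rw [setIntegral_congr_set h2, integral_exp_mul_Ioi (neg_lt_zero.2 hs)]
    simp only [neg_mul, neg_div_neg_eq]

/-- Chernoff's bound. -/
lemma probReal_epoch_le_bound (hτ : ∀ n, Measurable (τ n)) (hpos : ∀ᵐ ω ∂P, ∀ m, 0 < τ m ω)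
    (t : ℝ) (n : ℕ) :
    P.real {ω | epoch τ n ω ≤ t} ≤ Real.exp t * ∫ ω, Real.exp (-(1 * epoch τ n ω)) ∂P := by
  have hset : MeasurableSet {ω | epoch τ n ω ≤ t} :=
    measurableSet_le (measurable_epoch hτ n) measurable_const
  have hint : Integrable (fun ω => Real.exp (-(1 * epoch τ n ω))) P := by
    refine Integrable.of_bound (Real.measurable_exp.comp
      ((measurable_epoch hτ n).const_mul 1).neg).aestronglyMeasurable 1 ?_
    filter_upwards [hpos] with ω hω
    rw [Real.norm_of_nonneg (Real.exp_pos _).le, Real.exp_le_one_iff]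
    linarith [epoch_nonneg hω n]
  have h1 : P.real {ω | epoch τ n ω ≤ t} =
      ∫ ω, Set.indicator {ω | epoch τ n ω ≤ t} (fun _ => (1 : ℝ)) ω ∂P := by
    rw [integral_indicator_const _ hset]
    simp
  rw [h1, ← integral_const_mul]
  refine integral_mono ((integrable_const _).indicator hset) (hint.const_mul _) fun ω => ?_
  simp only [Set.indicator, Set.mem_ofPred_eq]
  split_ifs with h
  · rw [← Real.exp_add, Real.one_le_exp_iff]
    linarith
  · positivity

lemma probReal_renewalCount_eq (hτ : ∀ n, Measurable (τ n)) (hpos : ∀ᵐ ω ∂P, ∀ m, 0 < τ m ω)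
    (hdiv : ∀ᵐ ω ∂P, ∀ t : ℝ, ∃ n, t < epoch τ (n + 1) ω) {t : ℝ} (ht : 0 ≤ t) (n : ℕ) :
    P.real {ω | renewalCount τ t ω = n} =
      P.real {ω | epoch τ n ω ≤ t} - P.real {ω | epoch τ (n + 1) ω ≤ t} := by
  have hset : ∀ n, MeasurableSet {ω | epoch τ n ω ≤ t} := fun n =>
    measurableSet_le (measurable_epoch hτ n) measurable_const
  have h1 : {ω | epoch τ n ω ≤ t ∧ t < epoch τ (n + 1) ω} =
      {ω | epoch τ n ω ≤ t} \ {ω | epoch τ (n + 1) ω ≤ t} := by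
    ext ω; simp
  have h2 : ({ω | epoch τ n ω ≤ t} ∩ {ω | epoch τ (n + 1) ω ≤ t} : Set Ω) =ᵐ[P]
      {ω | epoch τ (n + 1) ω ≤ t} := by
    filter_upwards [hpos] with ω hω
    exact propext ⟨fun h => h.2, fun h => ⟨(epoch_mono hω (Nat.le_succ n)).trans h, h⟩⟩
  rw [measureReal_congr (renewalCount_ae_eq hpos hdiv ht n), h1, ← measureReal_congr h2,
    ← measureReal_sdiff_add_inter (s := {ω | epoch τ n ω ≤ t}) (hset (n + 1))]
  ring

end Renewal

/-! ### The position of the walker -/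

section Position

variable {N : ℕ} {M : Matrix (Fin N) (Fin N) ℝ} {init : Fin N → ℝ} {φ : Fin N → Measure ℝ}
  {σ : ℝ} {Ω : Type*} [MeasurableSpace Ω] {P : Measure Ω} [IsProbabilityMeasure P]
  {J : ℕ → Ω → Fin N} {τ ξ : ℕ → Ω → ℝ}

/-- On the event `𝒩(t) = n` the position has the law of a sum of `n` independent jumps. -/
lemma map_position_restrict (h : IsMultistateWalk P M init φ (fun _ => jumpLaw σ) J τ ξ)
    [∀ i, IsProbabilityMeasure (φ i)] (hpos : ∀ᵐ ω ∂P, ∀ m, 0 < τ m ω)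
    (hdiv : ∀ᵐ ω ∂P, ∀ t : ℝ, ∃ n, t < epoch τ (n + 1) ω) {t : ℝ} (ht : 0 ≤ t) (n : ℕ) :
    (P.restrict {ω | renewalCount τ t ω = n}).map (position τ ξ t) =
      P {ω | renewalCount τ t ω = n} • gaussianReal 0 (n * Real.toNNReal (2 * σ ^ 2)) := by
  have hX : Measurable (fun ω => ∑ m ∈ Finset.range n, ξ m ω) :=
    Finset.measurable_sum _ fun m _ => h.measurable_jump m
  have hN : MeasurableSet {ω | renewalCount τ t ω = n} :=
    ((measurable_renewalCount h.measurable_wait).comp measurable_prodMk_left)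
      (measurableSet_singleton n)
  have hE : MeasurableSet {ω | epoch τ n ω ≤ t ∧ t < epoch τ (n + 1) ω} :=
    (measurableSet_le (measurable_epoch h.measurable_wait n) measurable_const).inter
      (measurableSet_lt measurable_const (measurable_epoch h.measurable_wait (n + 1)))
  set B : Set (Fin (n + 1) → ℝ) := {x | ∑ m : Fin n, x m.castSucc ≤ t ∧ t < ∑ m, x m}
  have hB : MeasurableSet B :=
    (measurableSet_le (f := fun x : Fin (n + 1) → ℝ => ∑ m : Fin n, x m.castSucc) (by fun_prop)
      measurable_const).inter
    (measurableSet_lt (g := fun x : Fin (n + 1) → ℝ => ∑ m, x m) measurable_const (by fun_prop))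
  have hBE : (fun ω => fun m : Fin (n + 1) => τ m ω) ⁻¹' B =
      {ω | epoch τ n ω ≤ t ∧ t < epoch τ (n + 1) ω} := by
    ext ω
    simp [B, epoch, Finset.sum_range]
  have hae := renewalCount_ae_eq hpos hdiv ht n
  have h1 : (P.restrict {ω | renewalCount τ t ω = n}).map (position τ ξ t) =
      (P.restrict {ω | renewalCount τ t ω = n}).map (fun ω => ∑ m ∈ Finset.range n, ξ m ω) := by
    refine Measure.map_congr ?_
    filter_upwards [ae_restrict_mem hN] with ω hω
    rw [position, hω]
  rw [h1, Measure.restrict_congr_set hae, measure_congr hae, ← map_sum_jumps h n]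
  ext C hC
  rw [Measure.map_apply hX hC, Measure.restrict_apply (hX hC), Measure.smul_apply,
    Measure.map_apply hX hC, smul_eq_mul, ← hBE, Set.inter_comm]
  exact (indepFun_waits_sum_jumps h n).measure_inter_preimage_eq_mul _ _ hB hC

lemma positionLaw_eq_sum (h : IsMultistateWalk P M init φ (fun _ => jumpLaw σ) J τ ξ)
    [∀ i, IsProbabilityMeasure (φ i)] (hpos : ∀ᵐ ω ∂P, ∀ m, 0 < τ m ω)
    (hdiv : ∀ᵐ ω ∂P, ∀ t : ℝ, ∃ n, t < epoch τ (n + 1) ω) {t : ℝ} (ht : 0 ≤ t) :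
    positionLaw P τ ξ t = Measure.sum fun n : ℕ =>
      P {ω | renewalCount τ t ω = n} • gaussianReal 0 (n * Real.toNNReal (2 * σ ^ 2)) := by
  have hmeas : Measurable (position τ ξ t) :=
    (measurable_position h.measurable_wait h.measurable_jump).comp measurable_prodMk_left
  have hN : Measurable (renewalCount τ t) :=
    (measurable_renewalCount h.measurable_wait).comp measurable_prodMk_left
  simp only [← map_position_restrict h hpos hdiv ht]
  rw [← Measure.map_sum hmeas.aemeasurable, ← Measure.restrict_iUnion]
  · rw [positionLaw]
    congr 1
    have : (⋃ n, {ω | renewalCount τ t ω = n}) = Set.univ := by ext ω; simp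
    rw [this, Measure.restrict_univ]
  · intro m n hmn
    exact Set.disjoint_left.2 fun ω h1 h2 => hmn (h1.symm.trans h2)
  · exact fun n => hN (measurableSet_singleton n)

/-- The characteristic function of the position: `∑ n, exp (-n σ² k²) P(𝒩(t) = n)`. -/
lemma hasSum_charFun_positionLaw
    (h : IsMultistateWalk P M init φ (fun _ => jumpLaw σ) J τ ξ)
    [∀ i, IsProbabilityMeasure (φ i)] (hpos : ∀ᵐ ω ∂P, ∀ m, 0 < τ m ω)
    (hdiv : ∀ᵐ ω ∂P, ∀ t : ℝ, ∃ n, t < epoch τ (n + 1) ω) {t : ℝ} (ht : 0 ≤ t) (k : ℝ) :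
    HasSum (fun n : ℕ => ((Real.exp (-(σ ^ 2 * k ^ 2)) ^ n *
      (P.real {ω | epoch τ n ω ≤ t} - P.real {ω | epoch τ (n + 1) ω ≤ t}) : ℝ) : ℂ))
      (charFun (positionLaw P τ ξ t) k) := by
  have hmeas : Measurable (position τ ξ t) :=
    (measurable_position h.measurable_wait h.measurable_jump).comp measurable_prodMk_left
  have : IsProbabilityMeasure (positionLaw P τ ξ t) :=
    Measure.isProbabilityMeasure_map hmeas.aemeasurable
  have hint : Integrable (fun x : ℝ => Complex.exp (k * x * Complex.I)) (positionLaw P τ ξ t) := by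
    refine Integrable.of_bound (by fun_prop : Measurable _).aestronglyMeasurable 1
      (ae_of_all _ fun x => ?_)
    rw [show (k * x * Complex.I : ℂ) = ((k * x : ℝ) : ℂ) * Complex.I by push_cast; ring,
      Complex.norm_exp_ofReal_mul_I]
  rw [charFun_apply_real]
  rw [positionLaw_eq_sum h hpos hdiv ht] at hint ⊢
  convert! hasSum_integral_measure hint using 1
  funext n
  rw [integral_smul_measure, ← charFun_apply_real, charFun_gaussianReal,
    ← probReal_renewalCount_eq h.measurable_wait hpos hdiv ht n, Measure.real, Complex.real_smul,
    Complex.ofReal_mul, mul_comm]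
  congr 1
  rw [← Real.exp_nat_mul, Complex.ofReal_exp]
  congr 1
  push_cast
  rw [Real.coe_toNNReal _ (by positivity)]
  push_cast
  ring

lemma lintegral_sq_gaussianReal (v : ℝ≥0) :
    ∫⁻ x, ENNReal.ofReal (x ^ 2) ∂gaussianReal 0 v = v := by
  have hint : Integrable (fun x : ℝ => x ^ 2) (gaussianReal 0 v) :=
    (memLp_id_gaussianReal 2).integrable_sq
  rw [← ofReal_integral_eq_lintegral_ofReal hint (ae_of_all _ fun x => sq_nonneg x)]
  have h1 := variance_id_gaussianReal (μ := 0) (v := v)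
  rw [variance_eq_integral aemeasurable_id] at h1
  simp only [id, integral_id_gaussianReal, sub_zero] at h1
  rw [h1, ENNReal.ofReal_coe_nnreal]

lemma natCast_eq_tsum_indicator (a : ℕ) :
    (a : ENNReal) = ∑' n : ℕ, Set.indicator {n | n < a} (fun _ => (1 : ENNReal)) n := by
  rw [tsum_eq_sum (s := Finset.range a)]
  · rw [Finset.sum_congr rfl (g := fun _ => 1)]
    · simp
    · intro n hn
      exact Set.indicator_of_mem (s := {n | n < a}) (Finset.mem_range.1 hn) _
  · intro n hn
    exact Set.indicator_of_notMem (s := {n | n < a}) (fun h => hn (Finset.mem_range.2 h)) _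

/-- The mean squared displacement is `2 σ²` times the mean number of completed periods,
`∑ n, P(epoch (n + 1) ≤ t)`. -/
lemma lintegral_sq_position (h : IsMultistateWalk P M init φ (fun _ => jumpLaw σ) J τ ξ)
    [∀ i, IsProbabilityMeasure (φ i)] (hpos : ∀ᵐ ω ∂P, ∀ m, 0 < τ m ω)
    (hdiv : ∀ᵐ ω ∂P, ∀ t : ℝ, ∃ n, t < epoch τ (n + 1) ω) {t : ℝ} (ht : 0 ≤ t) :
    ∫⁻ ω, ENNReal.ofReal (position τ ξ t ω ^ 2) ∂P =
      ENNReal.ofReal (2 * σ ^ 2) * ∑' n : ℕ, P {ω | epoch τ (n + 1) ω ≤ t} := by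
  have hmeas : Measurable (position τ ξ t) :=
    (measurable_position h.measurable_wait h.measurable_jump).comp measurable_prodMk_left
  have hN : Measurable (renewalCount τ t) :=
    (measurable_renewalCount h.measurable_wait).comp measurable_prodMk_left
  have h1 : ∫⁻ ω, ENNReal.ofReal (position τ ξ t ω ^ 2) ∂P =
      ∫⁻ x, ENNReal.ofReal (x ^ 2) ∂positionLaw P τ ξ t := by
    rw [positionLaw, lintegral_map (by fun_prop) hmeas]
  have h2 : ∫⁻ ω, (renewalCount τ t ω : ENNReal) ∂P =
      ∑' n : ℕ, P {ω | epoch τ (n + 1) ω ≤ t} := by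
    simp only [natCast_eq_tsum_indicator (renewalCount τ t _)]
    have hset : ∀ n : ℕ, MeasurableSet {ω | n < renewalCount τ t ω} := fun n =>
      hN (measurableSet_Ioi (a := n))
    have hind : ∀ (n : ℕ) (ω : Ω), Set.indicator {m | m < renewalCount τ t ω}
        (fun _ => (1 : ENNReal)) n = Set.indicator {ω | n < renewalCount τ t ω} 1 ω := by
      intro n ω
      simp [Set.indicator]
    simp only [hind]
    rw [lintegral_tsum fun n => (measurable_one.indicator (hset n)).aemeasurable]
    refine tsum_congr fun n => ?_
    rw [lintegral_indicator_one (hset n)]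
    refine measure_congr ?_
    filter_upwards [hpos, hdiv] with ω h3 h4
    exact propext (lt_renewalCount_iff h3 (h4 t) n)
  have h3 : ∫⁻ ω, (renewalCount τ t ω : ENNReal) ∂P =
      ∑' n : ℕ, (n : ENNReal) * P {ω | renewalCount τ t ω = n} := by
    rw [← lintegral_map (f := fun n : ℕ => (n : ENNReal)) (by fun_prop) hN, lintegral_countable']
    refine tsum_congr fun n => ?_
    rw [Measure.map_apply hN (measurableSet_singleton n)]
    rfl
  rw [h1, positionLaw_eq_sum h hpos hdiv ht, lintegral_sum_measure, ← h2, h3,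
    ← ENNReal.tsum_mul_left]
  refine tsum_congr fun n => ?_
  rw [lintegral_smul_measure, lintegral_sq_gaussianReal, smul_eq_mul]
  push_cast
  change _ * (_ * ENNReal.ofReal (2 * σ ^ 2)) = _
  ring

end Position

/-! ### Transforms of the propagator and of the mean squared displacement -/

section Transforms

/-- The Laplace transforms of the waiting time laws. -/
def waitLaplace {N : ℕ} (φ : Fin N → Measure ℝ) (s : ℝ) (i : Fin N) : ℝ :=
  ∫ u, Real.exp (-(s * u)) ∂φ i

variable {N : ℕ} {M : Matrix (Fin N) (Fin N) ℝ} {init : Fin N → ℝ} {φ : Fin N → Measure ℝ}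
  {σ : ℝ}

lemma integrable_exp_neg_mul {μ : Measure ℝ} [IsProbabilityMeasure μ] (hμ : ∀ᵐ u ∂μ, 0 < u)
    {s : ℝ} (hs : 0 < s) : Integrable (fun u => Real.exp (-(s * u))) μ := by
  refine Integrable.of_bound (by fun_prop : Measurable _).aestronglyMeasurable 1 ?_
  filter_upwards [hμ] with u hu
  rw [Real.norm_of_nonneg (Real.exp_pos _).le, Real.exp_le_one_iff]
  nlinarith

lemma waitLaplace_nonneg (s : ℝ) (i : Fin N) : 0 ≤ waitLaplace φ s i :=
  integral_nonneg fun _ => (Real.exp_pos _).le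

lemma waitLaplace_lt_one [∀ i, IsProbabilityMeasure (φ i)] (hφ : ∀ i, ∀ᵐ u ∂φ i, 0 < u) {s : ℝ}
    (hs : 0 < s) (i : Fin N) : waitLaplace φ s i < 1 := by
  have hlt : ∀ᵐ u ∂φ i, Real.exp (-(s * u)) < 1 := by
    filter_upwards [hφ i] with u hu
    rw [Real.exp_lt_one_iff]
    nlinarith
  have hint : Integrable (fun u => 1 - Real.exp (-(s * u))) (φ i) :=
    (integrable_const 1).sub (integrable_exp_neg_mul (hφ i) hs)
  have hpos : 0 < ∫ u, (1 - Real.exp (-(s * u))) ∂φ i := by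
    rw [integral_pos_iff_support_of_nonneg_ae (hlt.mono fun u hu => sub_nonneg.2 hu.le) hint]
    have : Function.support (fun u => 1 - Real.exp (-(s * u))) =ᵐ[φ i] Set.univ := by
      filter_upwards [hlt] with u hu
      exact propext ⟨fun _ => trivial, fun _ => (sub_pos.2 hu).ne'⟩
    rw [measure_congr this]
    simp
  rw [integral_sub (integrable_const 1) (integrable_exp_neg_mul (hφ i) hs)] at hpos
  simpa [waitLaplace] using hpos

lemma exists_sup_lt_one {d : Fin N → ℝ} (hd : ∀ i, d i < 1) : ∃ q < 1, ∀ i, d i ≤ q := by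
  rcases isEmpty_or_nonempty (Fin N) with he | he
  · exact ⟨0, one_pos, fun i => isEmptyElim i⟩
  · obtain ⟨m, hm⟩ := Finite.exists_max d
    exact ⟨d m, hd m, hm⟩

variable {Ω : Type*} [MeasurableSpace Ω] {P : Measure Ω} [IsProbabilityMeasure P]
  {J : ℕ → Ω → Fin N} {τ ξ : ℕ → Ω → ℝ}

lemma integral_exp_neg_epoch (hM : M ∈ Matrix.rowStochastic ℝ (Fin N))
    (hi : init ∈ stdSimplex ℝ (Fin N))
    (h : IsMultistateWalk P M init φ (fun _ => jumpLaw σ) J τ ξ)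
    [∀ i, IsProbabilityMeasure (φ i)] (hφ : ∀ i, ∀ᵐ u ∂φ i, 0 < u) {s : ℝ} (hs : 0 < s) (n : ℕ) :
    ∫ ω, Real.exp (-(s * epoch τ n ω)) ∂P =
      init ⬝ᵥ ((Matrix.diagonal (waitLaplace φ s) * M) ^ n *ᵥ 1) :=
  integral_exp_neg_sum hM hi h hφ hs n

lemma summable_integral_exp_neg_epoch (hM : M ∈ Matrix.rowStochastic ℝ (Fin N))
    (hi : init ∈ stdSimplex ℝ (Fin N))
    (h : IsMultistateWalk P M init φ (fun _ => jumpLaw σ) J τ ξ)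
    [∀ i, IsProbabilityMeasure (φ i)] (hφ : ∀ i, ∀ᵐ u ∂φ i, 0 < u) {s : ℝ} (hs : 0 < s) :
    Summable fun n => ∫ ω, Real.exp (-(s * epoch τ n ω)) ∂P := by
  obtain ⟨q, hq, hqd⟩ := exists_sup_lt_one (waitLaplace_lt_one hφ hs)
  obtain ⟨v, -, -, hv⟩ := exists_weighted_resolvent hM (f := 1) hq (waitLaplace_nonneg s) hqd
    (fun _ => zero_le_one)
  simp only [integral_exp_neg_epoch hM hi h hφ hs]
  exact (hv init).summable

lemma ae_exists_lt_epoch_of_walk (hM : M ∈ Matrix.rowStochastic ℝ (Fin N))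
    (hi : init ∈ stdSimplex ℝ (Fin N))
    (h : IsMultistateWalk P M init φ (fun _ => jumpLaw σ) J τ ξ)
    [∀ i, IsProbabilityMeasure (φ i)] (hφ : ∀ i, ∀ᵐ u ∂φ i, 0 < u) :
    ∀ᵐ ω ∂P, ∀ t : ℝ, ∃ n, t < epoch τ (n + 1) ω :=
  ae_exists_lt_epoch h.measurable_wait (ae_wait_pos h hφ)
    (summable_integral_exp_neg_epoch hM hi h hφ one_pos)

/-- The propagator in Fourier–Laplace space:
`s g(k, s) = ⟨init| ∑ n, (Λ(k) Φ(s) M)ⁿ (1 - Φ(s)) |Σ⟩`. -/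
lemma exists_fourierLaplace_positionLaw_eq (hM : M ∈ Matrix.rowStochastic ℝ (Fin N))
    (hi : init ∈ stdSimplex ℝ (Fin N))
    (h : IsMultistateWalk P M init φ (fun _ => jumpLaw σ) J τ ξ)
    [∀ i, IsProbabilityMeasure (φ i)] (hφ : ∀ i, ∀ᵐ u ∂φ i, 0 < u) (k : ℝ) {s : ℝ} (hs : 0 < s) :
    ∃ S : ℝ, HasSum (fun n => init ⬝ᵥ ((Matrix.diagonal
        (fun i => Real.exp (-(σ ^ 2 * k ^ 2)) * waitLaplace φ s i) * M) ^ n *ᵥ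
          fun i => 1 - waitLaplace φ s i)) S ∧
      fourierLaplace (positionLaw P τ ξ) k s = ((S / s : ℝ) : ℂ) := by
  have hpos := ae_wait_pos h hφ
  have hdiv := ae_exists_lt_epoch_of_walk hM hi h hφ
  set a : ℕ → ℝ := fun n => ∫ ω, Real.exp (-(s * epoch τ n ω)) ∂P
  set p : ℕ → ℝ → ℝ := fun n t => P.real {ω | epoch τ n ω ≤ t}
  set q : ℝ := Real.exp (-(σ ^ 2 * k ^ 2))
  have hq0 : 0 ≤ q := (Real.exp_pos _).le
  have hq1 : q ≤ 1 := Real.exp_le_one_iff.2 (neg_nonpos.2 (by positivity))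
  have ha : Summable a := summable_integral_exp_neg_epoch hM hi h hφ hs
  -- as `1 - Φ = (1 - Φ M) Σ`, the terms are differences of the transforms of successive epochs
  have hterm : ∀ n, init ⬝ᵥ ((Matrix.diagonal (fun i => q * waitLaplace φ s i) * M) ^ n *ᵥ
      fun i => 1 - waitLaplace φ s i) = q ^ n * (a n - a (n + 1)) := by
    intro n
    have h1 : Matrix.diagonal (fun i => q * waitLaplace φ s i) * M =
        q • (Matrix.diagonal (waitLaplace φ s) * M) := by
      rw [← Matrix.smul_mul, ← Matrix.diagonal_smul]
      rfl
    have h2 : (fun i => 1 - waitLaplace φ s i) =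
        1 - (Matrix.diagonal (waitLaplace φ s) * M) *ᵥ 1 := by
      ext i
      rw [Pi.sub_apply, diagonal_mul_mulVec, Matrix.one_vecMul_of_mem_rowStochastic hM]
      simp
    simp only [a]
    rw [integral_exp_neg_epoch hM hi h hφ hs, integral_exp_neg_epoch hM hi h hφ hs, h1, h2,
      smul_pow, Matrix.smul_mulVec, dotProduct_smul, Matrix.mulVec_sub, Matrix.mulVec_mulVec,
      ← pow_succ, dotProduct_sub, smul_eq_mul]
  set F : ℕ → ℝ → ℝ := fun n t => Real.exp (-(s * t)) * (q ^ n * (p n t - p (n + 1) t))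
  have hlap := fun n => laplace_epoch_le h.measurable_wait hpos hs n
  have hF : ∀ n, IntegrableOn (F n) (Set.Ioi 0) := fun n =>
    (((hlap n).1.sub (hlap (n + 1)).1).const_mul (q ^ n)).congr (ae_of_all _ fun t => by
      simp only [F, p, Pi.sub_apply]; ring)
  have hFint : ∀ n, ∫ t in Set.Ioi 0, F n t = q ^ n * (a n - a (n + 1)) / s := by
    intro n
    have : ∀ t, F n t = q ^ n * (Real.exp (-(s * t)) * p n t - Real.exp (-(s * t)) * p (n + 1) t) :=
      fun t => by simp only [F]; ring
    simp only [this]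
    rw [integral_const_mul, integral_sub (hlap n).1 (hlap (n + 1)).1, (hlap n).2, (hlap (n + 1)).2]
    ring
  have hFnn : ∀ n, ∀ t ∈ Set.Ioi (0 : ℝ), 0 ≤ F n t := fun n t ht => by
    have h1 := probReal_renewalCount_eq h.measurable_wait hpos hdiv (le_of_lt ht) n
    simp only [F, p]
    rw [← h1]
    positivity
  have hFnorm : ∀ n, ∫ t in Set.Ioi 0, ‖(F n t : ℂ)‖ = q ^ n * (a n - a (n + 1)) / s := by
    intro n
    rw [← hFint n]
    refine setIntegral_congr_fun measurableSet_Ioi fun t ht => ?_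
    simp only [Complex.norm_real, Real.norm_of_nonneg (hFnn n t ht)]
  have hdiff : Summable fun n => (a n - a (n + 1)) / s :=
    (ha.sub ((summable_nat_add_iff 1).2 ha)).div_const s
  have hqs : Summable fun n => q ^ n * (a n - a (n + 1)) / s := by
    have h0 : ∀ n, 0 ≤ q ^ n * (a n - a (n + 1)) / s := fun n => by
      rw [← hFnorm]
      exact integral_nonneg fun _ => norm_nonneg _
    have hann : ∀ n, 0 ≤ a n - a (n + 1) := fun n => by
      have h1 := h0 n
      have h2 : 0 < q ^ n := pow_pos (Real.exp_pos _) n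
      by_contra! h3
      exact absurd h1 (not_le.2 (div_neg_of_neg_of_pos (mul_neg_of_pos_of_neg h2 h3) hs))
    refine Summable.of_nonneg_of_le h0 (fun n => ?_) hdiff
    exact div_le_div_of_nonneg_right
      (mul_le_of_le_one_left (hann n) (pow_le_one₀ hq0 hq1)) hs.le
  have hsum := hasSum_integral_of_summable_integral_norm (μ := volume.restrict (Set.Ioi 0))
    (F := fun n t => (F n t : ℂ)) (fun n => (hF n).ofReal) (by simpa only [hFnorm] using hqs)
  have hlhs : ∀ n, ∫ t in Set.Ioi 0, (F n t : ℂ) = ((q ^ n * (a n - a (n + 1)) / s : ℝ) : ℂ) :=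
    fun n => by rw [← hFint]; exact integral_complex_ofReal
  have hrhs : ∫ t in Set.Ioi 0, ∑' n, (F n t : ℂ) = fourierLaplace (positionLaw P τ ξ) k s := by
    refine setIntegral_congr_fun measurableSet_Ioi fun t ht => ?_
    have h1 := (hasSum_charFun_positionLaw h hpos hdiv (le_of_lt ht) k).mul_left
      (Real.exp (-(s * t)) : ℂ)
    rw [← h1.tsum_eq]
    refine tsum_congr fun n => ?_
    simp only [F, p, Complex.ofReal_mul, q]
  simp only [hlhs] at hsum
  rw [hrhs] at hsum
  have hS : HasSum (fun n => q ^ n * (a n - a (n + 1)) / s)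
      (∑' n, q ^ n * (a n - a (n + 1)) / s) := hqs.hasSum
  refine ⟨s * ∑' n, q ^ n * (a n - a (n + 1)) / s, ?_, ?_⟩
  · simp only [hterm]
    refine (hS.mul_left s).congr_fun fun n => ?_
    field_simp
  · rw [mul_div_cancel_left₀ _ hs.ne']
    exact hsum.unique (Complex.hasSum_ofReal.2 hS)

/-- The second moment of the position is finite, and the mean squared displacement is a series over
the epochs. -/
lemma hasSum_msd (hM : M ∈ Matrix.rowStochastic ℝ (Fin N))
    (hi : init ∈ stdSimplex ℝ (Fin N))
    (h : IsMultistateWalk P M init φ (fun _ => jumpLaw σ) J τ ξ)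
    [∀ i, IsProbabilityMeasure (φ i)] (hφ : ∀ i, ∀ᵐ u ∂φ i, 0 < u) {t : ℝ} (ht : 0 ≤ t) :
    Integrable (fun ω => position τ ξ t ω ^ 2) P ∧
    HasSum (fun n => 2 * σ ^ 2 * P.real {ω | epoch τ (n + 1) ω ≤ t}) (msd P τ ξ t) := by
  have hpos := ae_wait_pos h hφ
  have hdiv := ae_exists_lt_epoch_of_walk hM hi h hφ
  have hmeas : Measurable (position τ ξ t) :=
    (measurable_position h.measurable_wait h.measurable_jump).comp measurable_prodMk_left
  have hl := lintegral_sq_position h hpos hdiv ht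
  have hsum : Summable fun n => P.real {ω | epoch τ (n + 1) ω ≤ t} := by
    refine Summable.of_nonneg_of_le (fun _ => measureReal_nonneg)
      (fun n => probReal_epoch_le_bound h.measurable_wait hpos t (n + 1)) ?_
    exact ((summable_nat_add_iff 1).2
      (summable_integral_exp_neg_epoch hM hi h hφ one_pos)).mul_left _
  have htsum : ∑' n : ℕ, P {ω | epoch τ (n + 1) ω ≤ t} =
      ENNReal.ofReal (∑' n, P.real {ω | epoch τ (n + 1) ω ≤ t}) := by
    rw [ENNReal.ofReal_tsum_of_nonneg (fun _ => measureReal_nonneg) hsum]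
    exact tsum_congr fun n => (ofReal_measureReal).symm
  rw [htsum, ← ENNReal.ofReal_mul (by positivity)] at hl
  have hint : Integrable (fun ω => position τ ξ t ω ^ 2) P := by
    refine ⟨(hmeas.pow_const 2).aestronglyMeasurable, ?_⟩
    rw [hasFiniteIntegral_iff_ofReal (ae_of_all _ fun ω => sq_nonneg _), hl]
    exact ENNReal.ofReal_lt_top
  refine ⟨hint, ?_⟩
  have hmsd : msd P τ ξ t = 2 * σ ^ 2 * ∑' n, P.real {ω | epoch τ (n + 1) ω ≤ t} := by
    rw [msd, integral_eq_lintegral_of_nonneg_ae (ae_of_all _ fun ω => sq_nonneg _)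
      (hmeas.pow_const 2).aestronglyMeasurable, hl, ENNReal.toReal_ofReal]
    exact mul_nonneg (by positivity) (tsum_nonneg fun _ => measureReal_nonneg)
  rw [hmsd]
  exact hsum.hasSum.mul_left _

lemma monotoneOn_msd (hM : M ∈ Matrix.rowStochastic ℝ (Fin N))
    (hi : init ∈ stdSimplex ℝ (Fin N))
    (h : IsMultistateWalk P M init φ (fun _ => jumpLaw σ) J τ ξ)
    [∀ i, IsProbabilityMeasure (φ i)] (hφ : ∀ i, ∀ᵐ u ∂φ i, 0 < u) :
    MonotoneOn (msd P τ ξ) (Set.Ici 0) := by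
  intro t ht u hu htu
  refine hasSum_le (fun n => ?_) (hasSum_msd hM hi h hφ ht).2 (hasSum_msd hM hi h hφ hu).2
  exact mul_le_mul_of_nonneg_left (measureReal_mono fun ω hω => le_trans hω htu) (by positivity)

/-- The mean squared displacement in Laplace space:
`⟨init| ∑ n ≥ 1, (Φ(s) M)ⁿ |Σ⟩ 2 σ² / s`. -/
lemma exists_laplace_msd_eq (hM : M ∈ Matrix.rowStochastic ℝ (Fin N))
    (hi : init ∈ stdSimplex ℝ (Fin N))
    (h : IsMultistateWalk P M init φ (fun _ => jumpLaw σ) J τ ξ)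
    [∀ i, IsProbabilityMeasure (φ i)] (hφ : ∀ i, ∀ᵐ u ∂φ i, 0 < u) {s : ℝ} (hs : 0 < s) :
    ∃ S : ℝ, HasSum (fun n => init ⬝ᵥ ((Matrix.diagonal (waitLaplace φ s) * M) ^ n *ᵥ 1)) S ∧
      ∫ t in Set.Ioi 0, Real.exp (-(s * t)) * msd P τ ξ t = 2 * σ ^ 2 / s * (S - 1) := by
  have hpos := ae_wait_pos h hφ
  set a : ℕ → ℝ := fun n => ∫ ω, Real.exp (-(s * epoch τ n ω)) ∂P
  have ha : Summable a := summable_integral_exp_neg_epoch hM hi h hφ hs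
  set F : ℕ → ℝ → ℝ := fun n t =>
    Real.exp (-(s * t)) * (2 * σ ^ 2 * P.real {ω | epoch τ (n + 1) ω ≤ t})
  have hlap := fun n => laplace_epoch_le h.measurable_wait hpos hs (n + 1)
  have hF : ∀ n, IntegrableOn (F n) (Set.Ioi 0) := fun n =>
    ((hlap n).1.const_mul (2 * σ ^ 2)).congr (ae_of_all _ fun t => by simp only [F]; ring)
  have hFint : ∀ n, ∫ t in Set.Ioi 0, F n t = 2 * σ ^ 2 / s * a (n + 1) := by
    intro n
    have : ∀ t, F n t = 2 * σ ^ 2 * (Real.exp (-(s * t)) * P.real {ω | epoch τ (n + 1) ω ≤ t}) :=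
      fun t => by simp only [F]; ring
    simp only [this]
    rw [integral_const_mul, (hlap n).2]
    simp only [a]
    ring
  have hFnorm : ∀ n, ∫ t in Set.Ioi 0, ‖F n t‖ = 2 * σ ^ 2 / s * a (n + 1) := by
    intro n
    rw [← hFint n]
    refine integral_congr_ae (ae_of_all _ fun t => Real.norm_of_nonneg ?_)
    simp only [F]
    positivity
  have hsum := hasSum_integral_of_summable_integral_norm hF (by
    simpa only [hFnorm] using ((summable_nat_add_iff 1).2 ha).mul_left _)
  have hrhs : ∫ t in Set.Ioi 0, ∑' n, F n t =
      ∫ t in Set.Ioi 0, Real.exp (-(s * t)) * msd P τ ξ t := by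
    refine setIntegral_congr_fun measurableSet_Ioi fun t ht => ?_
    exact ((hasSum_msd hM hi h hφ (le_of_lt ht)).2.mul_left (Real.exp (-(s * t)))).tsum_eq
  simp only [hFint] at hsum
  rw [hrhs] at hsum
  refine ⟨∑' n, a n, ?_, ?_⟩
  · simp only [← integral_exp_neg_epoch hM hi h hφ hs]
    exact ha.hasSum
  · have h1 := (((hasSum_nat_add_iff' 1).2 ha.hasSum).mul_left (2 * σ ^ 2 / s))
    rw [hsum.unique h1]
    simp [a, epoch]

lemma charFun_positionLaw_eq_sum (h : IsMultistateWalk P M init φ (fun _ => jumpLaw σ) J τ ξ)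
    (k t : ℝ) : charFun (positionLaw P τ ξ t) k =
      ∑ i, charFun (statePositionLaw P J τ ξ i t) k := by
  have hmeas : Measurable (position τ ξ t) :=
    (measurable_position h.measurable_wait h.measurable_jump).comp measurable_prodMk_left
  have hJ : Measurable fun ω => J (renewalCount τ t ω) ω := by
    have h1 : Measurable fun q : ℕ × Ω => J q.1 q.2 :=
      measurable_from_prod_countable_right fun n => h.measurable_state n
    exact h1.comp (((measurable_renewalCount h.measurable_wait).comp
      measurable_prodMk_left).prodMk measurable_id)
  have hint : Integrable (fun ω => Complex.exp (k * position τ ξ t ω * Complex.I)) P := by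
    refine Integrable.of_bound (by fun_prop : Measurable _).aestronglyMeasurable 1
      (ae_of_all _ fun x => ?_)
    rw [show (k * position τ ξ t x * Complex.I : ℂ) =
      ((k * position τ ξ t x : ℝ) : ℂ) * Complex.I by push_cast; ring,
      Complex.norm_exp_ofReal_mul_I]
  have hm : ∀ μ : Measure Ω, charFun (μ.map (position τ ξ t)) k =
      ∫ ω, Complex.exp (k * position τ ξ t ω * Complex.I) ∂μ := fun μ => by
    rw [charFun_apply_real, integral_map hmeas.aemeasurable
      (by fun_prop : Measurable _).aestronglyMeasurable]
  simp only [positionLaw, statePositionLaw, hm]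
  rw [← integral_iUnion_fintype (s := fun i => {ω | J (renewalCount τ t ω) ω = i})
    (fun i => hJ (measurableSet_singleton i)) _ fun i => hint.integrableOn]
  · have : (⋃ i, {ω | J (renewalCount τ t ω) ω = i}) = Set.univ := by ext ω; simp
    rw [this, setIntegral_univ]
  · intro i j hij
    exact Set.disjoint_left.2 fun ω h1 h2 => hij (h1.symm.trans h2)

lemma fourierLaplace_positionLaw_eq_sum
    (h : IsMultistateWalk P M init φ (fun _ => jumpLaw σ) J τ ξ) (k : ℝ) {s : ℝ} (hs : 0 < s) :
    fourierLaplace (positionLaw P τ ξ) k s =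
      ∑ i, fourierLaplace (statePositionLaw P J τ ξ i) k s := by
  have hpos := measurable_position h.measurable_wait h.measurable_jump
  have hJ : Measurable fun q : ℝ × Ω => J (renewalCount τ q.1 q.2) q.2 := by
    have h1 : Measurable fun q : ℕ × Ω => J q.1 q.2 :=
      measurable_from_prod_countable_right fun n => h.measurable_state n
    exact h1.comp ((measurable_renewalCount h.measurable_wait).prodMk measurable_snd)
  have hexp : IntegrableOn (fun t : ℝ => Real.exp (-(s * t))) (Set.Ioi 0) := by
    simpa only [neg_mul] using exp_neg_integrableOn_Ioi 0 hs
  simp only [fourierLaplace, charFun_positionLaw_eq_sum h, Finset.mul_sum]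
  refine integral_finsetSum _ fun i _ => ?_
  have hchar : ∀ t, charFun (statePositionLaw P J τ ξ i t) k = ∫ ω,
      Set.indicator {q : ℝ × Ω | J (renewalCount τ q.1 q.2) q.2 = i}
        (fun q => Complex.exp (k * position τ ξ q.1 q.2 * Complex.I)) (t, ω) ∂P := by
    intro t
    have hm : Measurable (position τ ξ t) := hpos.comp measurable_prodMk_left
    have hset : MeasurableSet {ω | J (renewalCount τ t ω) ω = i} :=
      (hJ.comp measurable_prodMk_left) (measurableSet_singleton i)
    rw [statePositionLaw, charFun_apply_real, integral_map hm.aemeasurable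
      (by fun_prop : Measurable _).aestronglyMeasurable, ← integral_indicator hset]
    rfl
  have hsm : StronglyMeasurable fun t => charFun (statePositionLaw P J τ ξ i t) k := by
    simp only [hchar]
    refine StronglyMeasurable.integral_prod_right' (f := Set.indicator
      {q : ℝ × Ω | J (renewalCount τ q.1 q.2) q.2 = i}
        (fun q => Complex.exp (k * position τ ξ q.1 q.2 * Complex.I))) ?_
    have hm : Measurable fun q : ℝ × Ω =>
        Complex.exp (k * position τ ξ q.1 q.2 * Complex.I) := by fun_prop
    exact (hm.indicator (hJ (measurableSet_singleton i))).stronglyMeasurable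
  refine Integrable.mul_bdd (c := 1) hexp.ofReal hsm.aestronglyMeasurable (ae_of_all _ fun t => ?_)
  have hm : Measurable (position τ ξ t) := hpos.comp measurable_prodMk_left
  refine (norm_charFun_le (μ := statePositionLaw P J τ ξ i t) k).trans ?_
  rw [statePositionLaw, measureReal_def, Measure.map_apply hm MeasurableSet.univ,
    Set.preimage_univ, Measure.restrict_apply_univ]
  exact measureReal_le_one

end Transforms

/-! ### Small `k`, small `s` asymptotics -/

section Limits

variable {N : ℕ} {α B ε : Fin N → ℝ}

lemma braPsiKet_eq_sum (s : ℝ) : braPsiKet α B ε s = ∑ i, ε i * (B i * s ^ α i) := by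
  simp only [braPsiKet, Psi, dotProduct, Matrix.mulVec_diagonal, one_mul]
  exact Finset.sum_congr rfl fun i _ => mul_comm _ _

/-- The state `i₀` only witnesses that there is one. -/
lemma braPsiKet_pos (hε : ∀ i, 0 < ε i) (hB : ∀ i, 0 < B i) (i₀ : Fin N) {s : ℝ} (hs : 0 < s) :
    0 < braPsiKet α B ε s := by
  rw [braPsiKet_eq_sum]
  exact Finset.sum_pos (fun i _ => mul_pos (hε i) (mul_pos (hB i) (Real.rpow_pos_of_pos hs _)))
    ⟨i₀, Finset.mem_univ _⟩

lemma tendsto_braPsiKet (hα : ∀ i, 0 < α i) :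
    Tendsto (braPsiKet α B ε) (𝓝[>] 0) (𝓝 0) := by
  have h : ∀ i, Tendsto (fun s : ℝ => ε i * (B i * s ^ α i)) (𝓝[>] 0) (𝓝 0) := by
    intro i
    have h1 : Tendsto (fun s : ℝ => s ^ α i) (𝓝[>] 0) (𝓝 0) := by
      have := (Real.continuousAt_rpow_const 0 (α i) (Or.inr (hα i).le)).tendsto
      rw [Real.zero_rpow (hα i).ne'] at this
      exact this.mono_left nhdsWithin_le_nhds
    simpa using (h1.const_mul (B i)).const_mul (ε i)
  simp only [funext braPsiKet_eq_sum]
  simpa only [Finset.sum_const_zero] using tendsto_finsetSum Finset.univ fun i _ => h i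

/-- The smallest exponents govern `⟨Σ|Ψ(s)|eq⟩` as `s ↓ 0`. -/
lemma braPsiKet_isEquivalent (hε : ∀ i, 0 < ε i) (hB : ∀ i, 0 < B i) {i₁ : Fin N}
    (hi₁ : ∀ i, α i₁ ≤ α i) :
    braPsiKet α B ε ~[𝓝[>] 0] fun s => (∑ i with α i = α i₁, ε i * B i) * s ^ α i₁ := by
  have hpos : 0 < ∑ i with α i = α i₁, ε i * B i :=
    Finset.sum_pos (fun i _ => mul_pos (hε i) (hB i)) ⟨i₁, by simp⟩
  refine (isEquivalent_iff_tendsto_one ?_).2 ?_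
  · filter_upwards [self_mem_nhdsWithin] with s (hs : 0 < s)
    positivity
  · have h : ∀ i, Tendsto (fun s : ℝ => ε i * B i * s ^ (α i - α i₁)) (𝓝[>] 0)
        (𝓝 (if α i = α i₁ then ε i * B i else 0)) := by
      intro i
      have hle : 0 ≤ α i - α i₁ := sub_nonneg.2 (hi₁ i)
      have h1 := (Real.continuousAt_rpow_const 0 (α i - α i₁) (Or.inr hle)).tendsto
      have h2 := (h1.mono_left (nhdsWithin_le_nhds (s := Set.Ioi 0))).const_mul (ε i * B i)
      split_ifs with he
      · simp [he]
      · rwa [Real.zero_rpow (sub_ne_zero.2 he), mul_zero] at h2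
    have h3 := (tendsto_finsetSum Finset.univ fun i _ => h i).div_const
      (∑ i with α i = α i₁, ε i * B i)
    rw [← Finset.sum_filter, div_self hpos.ne'] at h3
    refine h3.congr' ?_
    filter_upwards [self_mem_nhdsWithin] with s (hs : 0 < s)
    rw [Pi.div_apply, braPsiKet_eq_sum, mul_comm _ (s ^ α i₁), ← div_div]
    congr 1
    rw [Finset.sum_div]
    refine Finset.sum_congr rfl fun i _ => ?_
    rw [Real.rpow_sub hs]
    ring

lemma isEquivalent_one_sub_exp_neg : (fun x : ℝ => 1 - Real.exp (-x)) ~[𝓝 0] fun x => x := by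
  have h : HasDerivAt (fun x : ℝ => 1 - Real.exp (-x)) 1 0 := by
    simpa using ((hasDerivAt_id (0 : ℝ)).neg.exp).const_sub 1
  have h1 := hasDerivAt_iff_isLittleO.1 h
  refine h1.congr (fun x => ?_) fun x => ?_ <;> simp

lemma isEquivalent_ofReal {X : Type*} {l : Filter X} {u v : X → ℝ} (h : u ~[l] v) :
    (fun x => (u x : ℂ)) ~[l] fun x => (v x : ℂ) := by
  refine isLittleO_iff.2 fun c hc => ?_
  filter_upwards [isLittleO_iff.1 h hc] with x hx
  simpa only [Pi.sub_apply, ← Complex.ofReal_sub, Complex.norm_real] using hx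

variable {φ : Fin N → Measure ℝ}

lemma sum_one_sub_waitLaplace_isEquivalent (hε : ∀ i, 0 < ε i) (hB : ∀ i, 0 < B i)
    (hφ : ∀ i, IsPowerLawWaiting (φ i) (α i) (B i)) :
    (fun s => ∑ i, ε i * (1 - waitLaplace φ s i)) ~[𝓝[>] 0] braPsiKet α B ε := by
  simp only [funext (braPsiKet_eq_sum (α := α) (B := B) (ε := ε))]
  refine isEquivalent_sum_of_eventually_nonneg (fun i _ => ?_) fun i _ =>
    IsEquivalent.refl.mul (hφ i).laplace
  filter_upwards [self_mem_nhdsWithin] with s (hs : 0 < s)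
  have := hε i
  have := hB i
  positivity

variable {M : Matrix (Fin N) (Fin N) ℝ} {init : Fin N → ℝ}
  {σ : ℝ} {Ω : Type*} [MeasurableSpace Ω] {P : Measure Ω} [IsProbabilityMeasure P]
  {J : ℕ → Ω → Fin N} {τ ξ : ℕ → Ω → ℝ}

/-- With `d = Λ(k) Φ(s)` and `f = 1 - Φ(s)` the resolvent estimate gives
`s g(k, s) ∼ ∑ ε (1 - Φ(s)) / ∑ ε (1 - Λ(k) Φ(s))`, and the denominator is equivalent to
`⟨Σ|Ψ(s)|eq⟩ + σ² k²`. -/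
theorem fourierLaplace_positionLaw_isEquivalent (hM : M ∈ Matrix.rowStochastic ℝ (Fin N))
    (hirr : M.IsIrreducible) (hε : ε ∈ stdSimplex ℝ (Fin N)) (hεM : ε ᵥ* M = ε)
    (hα : ∀ i, 0 < α i) (hB : ∀ i, 0 < B i) (hφ : ∀ i, IsPowerLawWaiting (φ i) (α i) (B i))
    (i₀ : Fin N) (hi : init ∈ stdSimplex ℝ (Fin N))
    (h : IsMultistateWalk P M init φ (fun _ => jumpLaw σ) J τ ξ) :
    (fun q : ℝ × ℝ => fourierLaplace (positionLaw P τ ξ) q.1 q.2)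
      ~[𝓝 0 ×ˢ 𝓝[>] 0] fun q => (limitPropagator α B ε σ q.1 q.2 : ℂ) := by
  have hφp := fun i => (hφ i).isProbabilityMeasure
  have hφ0 := fun i => (hφ i).pos
  have hεpos := equilibrium_pos hM hirr hε hεM
  have hs : ∀ᶠ q : ℝ × ℝ in 𝓝 0 ×ˢ 𝓝[>] 0, 0 < q.2 :=
    tendsto_snd.eventually self_mem_nhdsWithin
  have hex : ∀ q : ℝ × ℝ, ∃ S : ℝ, 0 < q.2 → HasSum (fun n => init ⬝ᵥ ((Matrix.diagonal
        (fun i => Real.exp (-(σ ^ 2 * q.1 ^ 2)) * waitLaplace φ q.2 i) * M) ^ n *ᵥ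
          fun i => 1 - waitLaplace φ q.2 i)) S ∧
      fourierLaplace (positionLaw P τ ξ) q.1 q.2 = ((S / q.2 : ℝ) : ℂ) := by
    intro q
    by_cases hq : 0 < q.2
    · obtain ⟨S, hS⟩ := exists_fourierLaplace_positionLaw_eq hM hi h hφ0 q.1 hq
      exact ⟨S, fun _ => hS⟩
    · exact ⟨0, fun h => absurd h hq⟩
  choose S hS using hex
  obtain ⟨K, -, hKb⟩ := exists_resolvent_estimate hM hirr hε hεM
  set F : ℝ × ℝ → ℝ := fun q => ∑ i, ε i * (1 - waitLaplace φ q.2 i)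
  set D : ℝ × ℝ → ℝ := fun q =>
    ∑ i, ε i * (1 - Real.exp (-(σ ^ 2 * q.1 ^ 2)) * waitLaplace φ q.2 i)
  set ψ : ℝ × ℝ → ℝ := fun q => braPsiKet α B ε q.2
  have hFψ : F ~[𝓝 0 ×ˢ 𝓝[>] 0] ψ :=
    (sum_one_sub_waitLaplace_isEquivalent hεpos hB hφ).comp_tendsto tendsto_snd
  have hψ0 : Tendsto ψ (𝓝 0 ×ˢ 𝓝[>] 0) (𝓝 0) := (tendsto_braPsiKet hα).comp tendsto_snd
  have hψpos : ∀ᶠ q in 𝓝 0 ×ˢ 𝓝[>] 0, 0 < ψ q := hs.mono fun q hq => braPsiKet_pos hεpos hB i₀ hq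
  have hk : Tendsto (fun q : ℝ × ℝ => σ ^ 2 * q.1 ^ 2) (𝓝 0 ×ˢ 𝓝[>] 0) (𝓝 0) := by
    have h1 : Tendsto (fun k : ℝ => σ ^ 2 * k ^ 2) (𝓝 0) (𝓝 0) := by
      have : Continuous fun k : ℝ => σ ^ 2 * k ^ 2 := by fun_prop
      simpa using this.tendsto 0
    exact h1.comp tendsto_fst
  have hΛ : Tendsto (fun q : ℝ × ℝ => Real.exp (-(σ ^ 2 * q.1 ^ 2))) (𝓝 0 ×ˢ 𝓝[>] 0) (𝓝 1) := by
    simpa [Function.comp_def] using (Real.continuous_exp.tendsto _).comp hk.neg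
  have hDsplit : ∀ q, D q = Real.exp (-(σ ^ 2 * q.1 ^ 2)) * F q +
      (1 - Real.exp (-(σ ^ 2 * q.1 ^ 2))) := by
    intro q
    have h1 : ∀ i, ε i * (1 - Real.exp (-(σ ^ 2 * q.1 ^ 2)) * waitLaplace φ q.2 i) =
        Real.exp (-(σ ^ 2 * q.1 ^ 2)) * (ε i * (1 - waitLaplace φ q.2 i)) +
          ε i * (1 - Real.exp (-(σ ^ 2 * q.1 ^ 2))) := fun i => by ring
    simp only [D, F, h1]
    rw [Finset.sum_add_distrib, ← Finset.mul_sum, ← Finset.sum_mul, hε.2, one_mul]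
  have hDeq : D ~[𝓝 0 ×ˢ 𝓝[>] 0] fun q => ψ q + σ ^ 2 * q.1 ^ 2 := by
    rw [funext hDsplit]
    refine isEquivalent_add_of_eventually_nonneg (hψpos.mono fun q hq => hq.le)
      (Eventually.of_forall fun q => by positivity) ?_
      (isEquivalent_one_sub_exp_neg.comp_tendsto hk)
    have h1 : (fun q : ℝ × ℝ => Real.exp (-(σ ^ 2 * q.1 ^ 2))) ~[𝓝 0 ×ˢ 𝓝[>] 0] fun _ => (1 : ℝ) :=
      (isEquivalent_const_iff_tendsto one_ne_zero).2 hΛ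
    exact (h1.mul hFψ).congr_right (Eventually.of_forall fun q => one_mul _)
  have hD0 : Tendsto D (𝓝 0 ×ˢ 𝓝[>] 0) (𝓝 0) :=
    hDeq.symm.tendsto_nhds (by simpa using hψ0.add hk)
  have hFpos : ∀ᶠ q in 𝓝 0 ×ˢ 𝓝[>] 0, 0 < F q := hs.mono fun q hq =>
    Finset.sum_pos (fun i _ => mul_pos (hεpos i) (sub_pos.2 (waitLaplace_lt_one hφ0 hq i)))
      ⟨i₀, Finset.mem_univ _⟩
  have hΛle : ∀ q : ℝ × ℝ, Real.exp (-(σ ^ 2 * q.1 ^ 2)) ≤ 1 := fun q =>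
    Real.exp_le_one_iff.2 (neg_nonpos.2 (by positivity))
  have hDpos : ∀ᶠ q in 𝓝 0 ×ˢ 𝓝[>] 0, 0 < D q := hFpos.mono fun q hq => by
    rw [hDsplit]
    have h1 := mul_pos (Real.exp_pos (-(σ ^ 2 * q.1 ^ 2))) hq
    have h2 := hΛle q
    linarith
  have hest : ∀ᶠ q in 𝓝 0 ×ˢ 𝓝[>] 0, |S q * D q - F q| ≤ K * D q * F q := hs.mono fun q hq =>
    hKb _ _ init (S q)
      (fun i => mul_nonneg (Real.exp_pos _).le (waitLaplace_nonneg _ i))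
      (fun i => (mul_le_of_le_one_left (waitLaplace_nonneg _ i) (hΛle q)).trans_lt
        (waitLaplace_lt_one hφ0 hq i))
      (fun i => (sub_pos.2 (waitLaplace_lt_one hφ0 hq i)).le) hi (hS q hq).1
  have hSeq := (isEquivalent_div_of_abs_mul_sub_le hD0 hDpos (hFpos.mono fun q hq => hq.le)
    hest).trans (hFψ.div hDeq)
  have hreal : (fun q : ℝ × ℝ => S q / q.2) ~[𝓝 0 ×ˢ 𝓝[>] 0]
      fun q => limitPropagator α B ε σ q.1 q.2 := by
    refine (hSeq.div IsEquivalent.refl).congr_right (Eventually.of_forall fun q => ?_)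
    simp only [limitPropagator, ψ, Pi.div_apply]
    ring
  refine (isEquivalent_ofReal hreal).congr_left ?_
  filter_upwards [hs] with q hq
  exact (hS q hq).2.symm

/-- With `d = Φ(s)` and `f = 1` the resolvent estimate gives
`⟨init| ∑ n, (Φ(s) M)ⁿ |Σ⟩ ∼ 1 / ∑ ε (1 - Φ(s))`. -/
theorem laplace_msd_isEquivalent (hM : M ∈ Matrix.rowStochastic ℝ (Fin N))
    (hirr : M.IsIrreducible) (hε : ε ∈ stdSimplex ℝ (Fin N)) (hεM : ε ᵥ* M = ε)
    (hα : ∀ i, 0 < α i) (hB : ∀ i, 0 < B i) (hφ : ∀ i, IsPowerLawWaiting (φ i) (α i) (B i))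
    (i₀ : Fin N) (hi : init ∈ stdSimplex ℝ (Fin N))
    (h : IsMultistateWalk P M init φ (fun _ => jumpLaw σ) J τ ξ) :
    (fun s : ℝ => ∫ t in Set.Ioi (0 : ℝ), Real.exp (-(s * t)) * msd P τ ξ t)
      ~[𝓝[>] 0] fun s => 2 * σ ^ 2 / (s * braPsiKet α B ε s) := by
  have hφp := fun i => (hφ i).isProbabilityMeasure
  have hφ0 := fun i => (hφ i).pos
  have hεpos := equilibrium_pos hM hirr hε hεM
  have hs : ∀ᶠ s : ℝ in 𝓝[>] 0, 0 < s := self_mem_nhdsWithin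
  have hex : ∀ s : ℝ, ∃ S : ℝ, 0 < s →
      HasSum (fun n => init ⬝ᵥ ((Matrix.diagonal (waitLaplace φ s) * M) ^ n *ᵥ 1)) S ∧
      ∫ t in Set.Ioi 0, Real.exp (-(s * t)) * msd P τ ξ t = 2 * σ ^ 2 / s * (S - 1) := by
    intro s
    by_cases hq : 0 < s
    · obtain ⟨S, hS⟩ := exists_laplace_msd_eq hM hi h hφ0 hq
      exact ⟨S, fun _ => hS⟩
    · exact ⟨0, fun h => absurd h hq⟩
  choose S hS using hex
  obtain ⟨K, -, hKb⟩ := exists_resolvent_estimate hM hirr hε hεM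
  set D : ℝ → ℝ := fun s => ∑ i, ε i * (1 - waitLaplace φ s i)
  have hDψ : D ~[𝓝[>] 0] braPsiKet α B ε := sum_one_sub_waitLaplace_isEquivalent hεpos hB hφ
  have hD0 : Tendsto D (𝓝[>] 0) (𝓝 0) := hDψ.symm.tendsto_nhds (tendsto_braPsiKet hα)
  have hDpos : ∀ᶠ s in 𝓝[>] 0, 0 < D s := hs.mono fun q hq =>
    Finset.sum_pos (fun i _ => mul_pos (hεpos i) (sub_pos.2 (waitLaplace_lt_one hφ0 hq i)))
      ⟨i₀, Finset.mem_univ _⟩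
  -- the term `n = 0` of the series does not belong to the mean squared displacement
  have hest : ∀ᶠ s in 𝓝[>] 0, |(S s - 1) * D s - 1| ≤ (K + 1) * D s * 1 := by
    filter_upwards [hs, hDpos] with s hs hD
    have h1 := hKb (waitLaplace φ s) 1 init (S s) (fun i => waitLaplace_nonneg _ i)
      (fun i => waitLaplace_lt_one hφ0 hs i) (fun i => zero_le_one) hi (hS s hs).1
    simp only [Pi.one_apply, mul_one, hε.2] at h1
    rw [abs_le] at h1 ⊢
    constructor <;> nlinarith [h1.1, h1.2]
  have hSeq := (isEquivalent_div_of_abs_mul_sub_le hD0 hDpos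
    (Eventually.of_forall fun _ => zero_le_one) hest).trans (IsEquivalent.refl.div hDψ)
  refine ((IsEquivalent.refl (u := fun s : ℝ => 2 * σ ^ 2 / s)).mul hSeq).congr_left ?_
    |>.congr_right (Eventually.of_forall fun s => ?_)
  · filter_upwards [hs] with s hs
    exact (hS s hs).2.symm
  · simp only [Pi.mul_apply, Pi.div_apply]
    rw [div_mul_div_comm, mul_one]

lemma integrableOn_laplace_msd (hM : M ∈ Matrix.rowStochastic ℝ (Fin N))
    (hi : init ∈ stdSimplex ℝ (Fin N))
    (h : IsMultistateWalk P M init φ (fun _ => jumpLaw σ) J τ ξ) (hσ : 0 < σ)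
    [∀ i, IsProbabilityMeasure (φ i)] (hφ : ∀ i, ∀ᵐ u ∂φ i, 0 < u) {s : ℝ} (hs : 0 < s) :
    IntegrableOn (fun t => Real.exp (-(s * t)) * msd P τ ξ t) (Set.Ioi 0) := by
  obtain ⟨S, hS, hint⟩ := exists_laplace_msd_eq hM hi h hφ hs
  -- the integral of a function that is not integrable would be zero, but here it is positive
  refine not_imp_comm.1 integral_undef ?_
  rw [hint]
  refine (mul_pos (by positivity) ?_).ne'
  have h1 := sum_le_hasSum (Finset.range 2) (fun n _ => ?_) hS
  · rw [Finset.sum_range_succ, Finset.sum_range_one, pow_zero, pow_one, Matrix.one_mulVec] at h1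
    have h2 : init ⬝ᵥ 1 = 1 := by simpa [dotProduct] using hi.2
    have h3 : 0 < init ⬝ᵥ ((Matrix.diagonal (waitLaplace φ s) * M) *ᵥ 1) := by
      have h4 := integral_exp_neg_epoch hM hi h hφ hs 1
      rw [pow_one] at h4
      rw [← h4]
      refine integral_exp_pos (Integrable.of_bound (Real.measurable_exp.comp
        ((measurable_epoch h.measurable_wait 1).const_mul s).neg).aestronglyMeasurable 1 ?_)
      filter_upwards [ae_wait_pos h hφ] with ω hω
      rw [Real.norm_of_nonneg (Real.exp_pos _).le, Real.exp_le_one_iff]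
      have := mul_nonneg hs.le (epoch_nonneg hω 1)
      linarith
    linarith
  · rw [← integral_exp_neg_epoch hM hi h hφ hs]
    exact integral_nonneg fun _ => (Real.exp_pos _).le

/-- The mean squared displacement increases with time, so that its asymptotics follow from those of
its Laplace transform. -/
theorem msd_isEquivalent (hM : M ∈ Matrix.rowStochastic ℝ (Fin N))
    (hirr : M.IsIrreducible) (hε : ε ∈ stdSimplex ℝ (Fin N)) (hεM : ε ᵥ* M = ε)
    (hα : ∀ i, 0 < α i) (hB : ∀ i, 0 < B i) (hφ : ∀ i, IsPowerLawWaiting (φ i) (α i) (B i))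
    (hσ : 0 < σ) {i₁ : Fin N} (hi₁ : ∀ i, α i₁ ≤ α i) (hi : init ∈ stdSimplex ℝ (Fin N))
    (h : IsMultistateWalk P M init φ (fun _ => jumpLaw σ) J τ ξ) :
    msd P τ ξ ~[atTop] fun t =>
      2 * σ ^ 2 / ((∑ i with α i = α i₁, ε i * B i) * Real.Gamma (1 + α i₁)) * t ^ α i₁ := by
  have hφp := fun i => (hφ i).isProbabilityMeasure
  have hφ0 := fun i => (hφ i).pos
  have hεpos := equilibrium_pos hM hirr hε hεM
  set b := ∑ i with α i = α i₁, ε i * B i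
  have hb : 0 < b := Finset.sum_pos (fun i _ => mul_pos (hεpos i) (hB i)) ⟨i₁, by simp⟩
  have hlap : (fun s : ℝ => ∫ t in Set.Ioi (0 : ℝ), Real.exp (-(s * t)) * msd P τ ξ t)
      ~[𝓝[>] 0] fun s => 2 * σ ^ 2 / b * s ^ (-(α i₁ + 1)) := by
    refine (laplace_msd_isEquivalent hM hirr hε hεM hα hB hφ i₁ hi h).trans ?_
    have h1 := (IsEquivalent.refl (u := fun _ : ℝ => 2 * σ ^ 2) (l := 𝓝[>] 0)).div
      ((IsEquivalent.refl (u := fun s : ℝ => s)).mul (braPsiKet_isEquivalent hεpos hB hi₁))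
    refine h1.congr_right ?_
    filter_upwards [self_mem_nhdsWithin] with s (hs : 0 < s)
    simp only [Pi.mul_apply, Pi.div_apply]
    rw [Real.rpow_neg hs.le, Real.rpow_add hs, Real.rpow_one]
    change 2 * σ ^ 2 / (s * (b * s ^ α i₁)) = _
    field_simp
  have hfin := isEquivalent_of_laplace_isEquivalent (monotoneOn_msd hM hi h hφ0)
    (fun t _ => integral_nonneg fun ω => sq_nonneg _)
    (fun s hs => integrableOn_laplace_msd hM hi h hσ hφ0 hs)
    (by positivity : 0 < 2 * σ ^ 2 / b) (hα i₁).le hlap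
  refine hfin.congr_right (Eventually.of_forall fun t => ?_)
  rw [div_div]

end Limits

/-! ### Fractional integrals and their Laplace transforms -/

section Fractional

variable {E : Type*} [NormedAddCommGroup E] [NormedSpace ℝ E]

/-- The Riemann–Liouville fractional integral of a vector-valued function. -/
def fracInt (β : ℝ) (f : ℝ → E) (t : ℝ) : E :=
  (Real.Gamma β)⁻¹ • ∫ u in (0 : ℝ)..t, (t - u) ^ (β - 1) • f u

lemma rlIntegral_eq_fracInt (β : ℝ) (f : ℝ → ℝ) (t : ℝ) : rlIntegral β f t = fracInt β f t := rfl

lemma fracInt_one (f : ℝ → E) (t : ℝ) : fracInt 1 f t = ∫ u in (0 : ℝ)..t, f u := by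
  simp [fracInt]

lemma fracInt_ofReal (β : ℝ) (f : ℝ → ℝ) (t : ℝ) :
    fracInt β (fun u => (f u : ℂ)) t = ((fracInt β f t : ℝ) : ℂ) := by
  simp only [fracInt, Complex.real_smul, ← Complex.ofReal_mul]
  rw [intervalIntegral.integral_ofReal, ← Complex.ofReal_mul]
  rfl

lemma intervalIntegrable_kernel {β : ℝ} (hβ : 0 < β) (t : ℝ) :
    IntervalIntegrable (fun u => (t - u) ^ (β - 1)) volume 0 t := by
  have h := (intervalIntegral.intervalIntegrable_rpow' (a := 0) (b := t) (r := β - 1)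
    (by linarith)).comp_sub_left t
  simpa using h.symm

lemma intervalIntegrable_kernel_smul {β : ℝ} (hβ : 0 < β) (t : ℝ) {f : ℝ → E}
    (hf : Continuous f) : IntervalIntegrable (fun u => (t - u) ^ (β - 1) • f u) volume 0 t :=
  (intervalIntegrable_kernel hβ t).smul_continuousOn hf.continuousOn

lemma fracInt_add {β : ℝ} (hβ : 0 < β) (t : ℝ) {f g : ℝ → E} (hf : Continuous f)
    (hg : Continuous g) : fracInt β (fun u => f u + g u) t = fracInt β f t + fracInt β g t := by
  simp only [fracInt, smul_add]
  rw [intervalIntegral.integral_add (intervalIntegrable_kernel_smul hβ t hf)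
    (intervalIntegrable_kernel_smul hβ t hg), smul_add]

lemma fracInt_const_mul {𝕜 : Type*} [RCLike 𝕜] (β t : ℝ) (c : 𝕜) (f : ℝ → 𝕜) :
    fracInt β (fun u => c * f u) t = c * fracInt β f t := by
  rw [fracInt, fracInt, mul_smul_comm, ← intervalIntegral.integral_const_mul]
  simp only [mul_smul_comm]

/-- After rescaling the interval `[0, t]` to `[0, 1]`, the fractional integral is visibly continuous
in `t`. -/
lemma fracInt_eq_scaled {β : ℝ} (hβ : 0 < β) (f : ℝ → E) {t : ℝ} (ht : 0 ≤ t) :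
    fracInt β f t =
      (Real.Gamma β)⁻¹ • t ^ β • ∫ r in (0 : ℝ)..1, (1 - r) ^ (β - 1) • f (t * r) := by
  rcases ht.eq_or_lt with rfl | ht
  · simp [fracInt, Real.zero_rpow hβ.ne']
  · rw [fracInt]
    congr 1
    have h := intervalIntegral.smul_integral_comp_mul_left (a := 0) (b := 1)
      (fun u => (t - u) ^ (β - 1) • f u) t
    rw [mul_zero, mul_one] at h
    have hpow : t ^ β = t * t ^ (β - 1) := by
      rw [← Real.rpow_one_add' ht.le (by linarith)]
      congr 1
      ring
    rw [← h, hpow, mul_smul, ← intervalIntegral.integral_smul (t ^ (β - 1))]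
    congr 1
    refine intervalIntegral.integral_congr fun r hr => ?_
    rw [Set.uIcc_of_le zero_le_one] at hr
    simp only [smul_smul]
    rw [← Real.mul_rpow ht.le (by linarith [hr.2]), mul_sub, mul_one]

lemma continuous_scaled {β : ℝ} (hβ : 0 < β) {f : ℝ → E} (hf : Continuous f) {C : ℝ}
    (hC : ∀ u, ‖f u‖ ≤ C) :
    Continuous fun t : ℝ =>
      (Real.Gamma β)⁻¹ • t ^ β • ∫ r in (0 : ℝ)..1, (1 - r) ^ (β - 1) • f (t * r) := by
  suffices h : Continuous fun t : ℝ => ∫ r in (0 : ℝ)..1, (1 - r) ^ (β - 1) • f (t * r) from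
    ((Real.continuous_rpow_const hβ.le).smul h).const_smul _
  have hk := intervalIntegrable_kernel hβ 1
  refine intervalIntegral.continuous_of_dominated_interval
    (bound := fun r => ‖(1 - r) ^ (β - 1)‖ * C) (fun t => ?_) (fun t => ?_) (hk.norm.mul_const C) ?_
  · exact hk.def'.aestronglyMeasurable.smul
      (by fun_prop : Continuous fun r => f (t * r)).aestronglyMeasurable
  · refine ae_of_all _ fun r _ => ?_
    rw [norm_smul]
    exact mul_le_mul_of_nonneg_left (hC _) (norm_nonneg _)
  · exact ae_of_all _ fun r _ => by fun_prop

lemma integrableOn_laplace_of_bounded {f : ℝ → E} (hf : Continuous f) {C : ℝ}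
    (hC : ∀ u, ‖f u‖ ≤ C) {s : ℝ} (hs : 0 < s) :
    IntegrableOn (fun t => Real.exp (-(s * t)) • f t) (Set.Ioi 0) := by
  have hexp : IntegrableOn (fun t : ℝ => Real.exp (-(s * t))) (Set.Ioi 0) := by
    simpa only [neg_mul] using exp_neg_integrableOn_Ioi 0 hs
  exact Integrable.smul_bdd hexp C hf.aestronglyMeasurable (ae_of_all _ hC)

/-- The Laplace transform turns the fractional integral of order `β` into `s ^ (-β)`. -/
lemma laplace_fracInt [CompleteSpace E] {β : ℝ} (hβ : 0 < β) {f : ℝ → E} (hf : Continuous f) {C : ℝ}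
    (hC : ∀ u, ‖f u‖ ≤ C) {s : ℝ} (hs : 0 < s) :
    IntegrableOn (fun t => Real.exp (-(s * t)) • fracInt β f t) (Set.Ioi 0) ∧
    ∫ t in Set.Ioi 0, Real.exp (-(s * t)) • fracInt β f t =
      s ^ (-β) • ∫ t in Set.Ioi 0, Real.exp (-(s * t)) • f t := by
  set g : ℝ → ℝ := fun v => v ^ (β - 1) * Real.exp (-(s * v))
  have hΓ : Real.Gamma β ≠ 0 := (Real.Gamma_pos_of_pos hβ).ne'
  have hgint : ∫ v in Set.Ioi 0, g v = (1 / s) ^ β * Real.Gamma β :=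
    Real.integral_rpow_mul_exp_neg_mul_Ioi hβ hs
  have hg : IntegrableOn g (Set.Ioi 0) := by
    refine not_imp_comm.1 integral_undef ?_
    rw [hgint]
    positivity
  have hfi := integrableOn_laplace_of_bounded hf hC hs
  -- `exp (-s t)` times the fractional integral is a convolution of functions on the half line
  set L : E →L[ℝ] ℝ →L[ℝ] E := (ContinuousLinearMap.lsmul ℝ ℝ).flip
  have hconv : ∀ t, ∫ u in (0 : ℝ)..t, L (Real.exp (-(s * u)) • f u) (g (t - u)) =
      Real.exp (-(s * t)) • ∫ u in (0 : ℝ)..t, (t - u) ^ (β - 1) • f u := by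
    intro t
    rw [← intervalIntegral.integral_smul]
    refine intervalIntegral.integral_congr fun u _ => ?_
    simp only [L, g, ContinuousLinearMap.flip_apply, ContinuousLinearMap.lsmul_apply, smul_smul]
    congr 1
    rw [mul_assoc, ← Real.exp_add, mul_comm]
    congr 2
    ring
  have hfun : ∀ t, Real.exp (-(s * t)) • fracInt β f t = (Real.Gamma β)⁻¹ •
      ∫ u in (0 : ℝ)..t, L (Real.exp (-(s * u)) • f u) (g (t - u)) := by
    intro t
    rw [hconv, fracInt, smul_comm]
  simp only [hfun]
  constructor
  · refine Integrable.smul _ ?_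
    refine (integrable_posConvolution hfi hg L).integrableOn.congr_fun (fun t ht => ?_)
      measurableSet_Ioi
    rw [posConvolution, Set.indicator_of_mem ht]
  · rw [integral_smul, integral_posConvolution hfi hg L, hgint]
    simp only [L, ContinuousLinearMap.flip_apply, ContinuousLinearMap.lsmul_apply, smul_smul]
    congr 1
    rw [one_div, Real.inv_rpow hs.le, Real.rpow_neg hs.le]
    field_simp

/-- Relaxation equations with a distributed fractional derivative are solved by the Laplace
transform. Both sides say that
`G = ∑ c i * I^{1 - α i} (w - w₀) + κ * I w` vanishes, as the Laplace transform of `G` is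
`s⁻¹ * ((∑ c i * s ^ α i + κ) * ŵ(s) - s⁻¹ * w₀ * ∑ c i * s ^ α i)`. -/
lemma relaxation_iff_laplace {N : ℕ} {α c : Fin N → ℝ} (hα : ∀ i, α i < 1) (κ : ℝ) {w : ℝ → ℂ}
    (hw : Continuous w) {C : ℝ} (hC : ∀ u, ‖w u‖ ≤ C) (w₀ : ℂ) :
    (∀ t, 0 ≤ t → ∑ i, c i • fracInt (1 - α i) (fun u => w u - w₀) t + κ • fracInt 1 w t = 0) ↔
      ∀ s : ℝ, 0 < s → (∑ i, c i * s ^ α i + κ) • ∫ t in Set.Ioi 0, Real.exp (-(s * t)) • w t =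
        (s⁻¹ * ∑ i, c i * s ^ α i) • w₀ := by
  have hβ : ∀ i, 0 < 1 - α i := fun i => sub_pos.2 (hα i)
  have hv : Continuous fun u => w u - w₀ := hw.sub continuous_const
  have hCv : ∀ u, ‖w u - w₀‖ ≤ C + ‖w₀‖ := fun u =>
    (norm_sub_le _ _).trans (add_le_add_left (hC u) _)
  set G : ℝ → ℂ := fun t =>
    ∑ i, c i • fracInt (1 - α i) (fun u => w u - w₀) t + κ • fracInt 1 w t
  have hlapG : ∀ s : ℝ, 0 < s → IntegrableOn (fun t => Real.exp (-(s * t)) • G t) (Set.Ioi 0) ∧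
      ∫ t in Set.Ioi 0, Real.exp (-(s * t)) • G t =
        s⁻¹ • ((∑ i, c i * s ^ α i + κ) • ∫ t in Set.Ioi 0, Real.exp (-(s * t)) • w t) -
          s⁻¹ • (s⁻¹ * ∑ i, c i * s ^ α i) • w₀ := by
    intro s hs
    have h1 := fun i => laplace_fracInt (hβ i) hv hCv hs
    have h2 := laplace_fracInt one_pos hw hC hs
    have hwi := integrableOn_laplace_of_bounded hw hC hs
    have hexp : ∫ t in Set.Ioi (0 : ℝ), Real.exp (-(s * t)) = s⁻¹ := by
      have := integral_exp_mul_Ioi (neg_lt_zero.2 hs) 0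
      simpa only [neg_mul, mul_zero, neg_zero, Real.exp_zero, neg_div_neg_eq, one_div] using this
    have hvint : ∫ t in Set.Ioi 0, Real.exp (-(s * t)) • (w t - w₀) =
        (∫ t in Set.Ioi 0, Real.exp (-(s * t)) • w t) - s⁻¹ • w₀ := by
      have hexpi : IntegrableOn (fun t : ℝ => Real.exp (-(s * t))) (Set.Ioi 0) := by
        simpa only [neg_mul] using exp_neg_integrableOn_Ioi 0 hs
      simp only [smul_sub]
      rw [integral_sub hwi (hexpi.smul_const w₀), integral_smul_const, hexp]
    have hsplit : ∀ t, Real.exp (-(s * t)) • G t =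
        ∑ i, c i • Real.exp (-(s * t)) • fracInt (1 - α i) (fun u => w u - w₀) t +
          κ • Real.exp (-(s * t)) • fracInt 1 w t := by
      intro t
      simp only [G, smul_add, Finset.smul_sum]
      congr 1
      · exact Finset.sum_congr rfl fun i _ => smul_comm _ _ _
      · exact smul_comm _ _ _
    have hi0 : ∀ i, Integrable (fun t => c i • Real.exp (-(s * t)) •
        fracInt (1 - α i) (fun u => w u - w₀) t) (volume.restrict (Set.Ioi 0)) :=
      fun i => (h1 i).1.smul (c i)
    have hi1 : Integrable (fun t => ∑ i, c i • Real.exp (-(s * t)) •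
        fracInt (1 - α i) (fun u => w u - w₀) t) (volume.restrict (Set.Ioi 0)) :=
      integrable_finsetSum _ fun i _ => hi0 i
    have hi2 : Integrable (fun t => κ • Real.exp (-(s * t)) • fracInt 1 w t)
        (volume.restrict (Set.Ioi 0)) := h2.1.smul κ
    simp only [hsplit]
    refine ⟨hi1.add hi2, ?_⟩
    rw [integral_add hi1 hi2, integral_finsetSum _ fun i _ => hi0 i, integral_smul, h2.2]
    simp only [integral_smul, (h1 _).2, hvint, Real.rpow_neg_one]
    have hpow : ∀ i, s ^ (-(1 - α i)) = s⁻¹ * s ^ α i := fun i => by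
      rw [← Real.rpow_neg_one s, ← Real.rpow_add hs]
      congr 1
      ring
    simp only [hpow, Complex.real_smul]
    push_cast
    have hsum : ∀ z : ℂ, ∑ i, (c i : ℂ) * (((s : ℂ)⁻¹ * ((s ^ α i : ℝ) : ℂ)) * z) =
        (s : ℂ)⁻¹ * (∑ i, (c i : ℂ) * ((s ^ α i : ℝ) : ℂ)) * z := fun z => by
      rw [Finset.mul_sum, Finset.sum_mul]
      exact Finset.sum_congr rfl fun i _ => by ring
    rw [hsum]
    ring
  constructor
  · intro h s hs
    have h1 := (hlapG s hs).2
    rw [setIntegral_congr_fun (g := fun _ => (0 : ℂ)) measurableSet_Ioi fun t ht => by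
      simp only [G]; rw [h t (le_of_lt ht), smul_zero], integral_zero, ← smul_sub] at h1
    exact sub_eq_zero.1 ((smul_eq_zero.1 h1.symm).resolve_left (inv_pos.2 hs).ne')
  · intro h
    -- the rescaled form of `G` is continuous on the whole line
    set G' : ℝ → ℂ := fun t => ∑ i, c i • ((Real.Gamma (1 - α i))⁻¹ • t ^ (1 - α i) •
      ∫ r in (0 : ℝ)..1, (1 - r) ^ (1 - α i - 1) • (w (t * r) - w₀)) +
        κ • ((Real.Gamma 1)⁻¹ • t ^ (1 : ℝ) •
          ∫ r in (0 : ℝ)..1, (1 - r) ^ ((1 : ℝ) - 1) • w (t * r))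
    have hGG' : ∀ t, 0 ≤ t → G t = G' t := by
      intro t ht
      simp only [G, G', fracInt_eq_scaled (hβ _) _ ht, fracInt_eq_scaled one_pos _ ht]
    have hG' : Continuous G' :=
      (continuous_finsetSum _ fun i _ => (continuous_scaled (hβ i) hv hCv).const_smul (c i)).add
        ((continuous_scaled one_pos hw hC).const_smul κ)
    intro t ht
    change G t = 0
    rw [hGG' t ht]
    refine eq_zero_of_laplace_eq_zero hG' ?_ (fun n => ?_) ht
    · refine (hlapG 1 one_pos).1.congr_fun (fun t ht => ?_) measurableSet_Ioi
      simp only [hGG' t (le_of_lt ht), one_mul]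
    · have hn : (0 : ℝ) < n + 1 := by positivity
      have h1 := (hlapG _ hn).2
      rw [h _ hn, sub_self] at h1
      rw [← h1]
      exact setIntegral_congr_fun measurableSet_Ioi fun t ht => by
        simp only [hGG' t (le_of_lt ht)]

end Fractional

/-! ### From the weak equation to characteristic functions -/

section Diffusion

variable {N : ℕ} {α B ε : Fin N → ℝ} {σ : ℝ} {W : ℝ≥0 → ProbabilityMeasure ℝ}

lemma continuous_integral_real (hW : Continuous W) {f : ℝ → ℝ} (hf : Continuous f) {C : ℝ}
    (hC : ∀ x, |f x| ≤ C) : Continuous fun u : ℝ => ∫ x, f x ∂(W u.toNNReal : Measure ℝ) :=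
  (continuous_iff_continuousAt.2 fun t => ProbabilityMeasure.tendsto_iff_forall_integral_tendsto.1
    (hW.tendsto t) (BoundedContinuousFunction.ofNormedAddCommGroup f hf C hC)).comp
    continuous_real_toNNReal

lemma continuous_charFun_time (hW : Continuous W) (k : ℝ) :
    Continuous fun u : ℝ => charFun (W u.toNNReal : Measure ℝ) k := by
  simp only [charFun_eq_integral_innerProbChar]
  exact (continuous_iff_continuousAt.2 fun t =>
    (ProbabilityMeasure.tendsto_iff_forall_integral_rclike_tendsto ℂ).1
    (hW.tendsto t) (BoundedContinuousFunction.innerProbChar k)).comp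
    continuous_real_toNNReal

/-- In Fourier–Laplace space the limiting propagator solves a relaxation equation with a
distributed fractional derivative. -/
lemma fourierLaplace_eq_limitPropagator_iff (hW : Continuous W) (hα : ∀ i, α i < 1)
    (hε : ∀ i, 0 < ε i) (hB : ∀ i, 0 < B i) (i₀ : Fin N) (k : ℝ) :
    (∀ s : ℝ, 0 < s → fourierLaplace (fun t => (W t.toNNReal : Measure ℝ)) k s =
        (limitPropagator α B ε σ k s : ℂ)) ↔
      ∀ t, 0 ≤ t → ∑ i, (ε i * B i) • fracInt (1 - α i)
          (fun u => charFun (W u.toNNReal : Measure ℝ) k - 1) t +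
        (σ ^ 2 * k ^ 2) • fracInt 1 (fun u => charFun (W u.toNNReal : Measure ℝ) k) t = 0 := by
  rw [relaxation_iff_laplace hα (σ ^ 2 * k ^ 2) (continuous_charFun_time hW k)
    (fun u => norm_charFun_le_one k) 1]
  refine forall₂_congr fun s hs => ?_
  have hψ := braPsiKet_pos (α := α) hε hB i₀ hs
  have hψs : ∑ i, ε i * B i * s ^ α i = braPsiKet α B ε s := by
    rw [braPsiKet_eq_sum]
    exact Finset.sum_congr rfl fun i _ => mul_assoc _ _ _
  have hne : (braPsiKet α B ε s : ℂ) + (σ : ℂ) ^ 2 * (k : ℂ) ^ 2 ≠ 0 := by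
    have : 0 < braPsiKet α B ε s + σ ^ 2 * k ^ 2 := by positivity
    exact_mod_cast this.ne'
  have hne' : (s : ℂ) ≠ 0 := by exact_mod_cast hs.ne'
  have hint : ∫ t in Set.Ioi 0, Real.exp (-(s * t)) • charFun (W t.toNNReal : Measure ℝ) k =
      fourierLaplace (fun t => (W t.toNNReal : Measure ℝ)) k s := by
    simp only [fourierLaplace, Complex.real_smul]
  rw [hψs, hint, limitPropagator]
  simp only [Complex.real_smul]
  push_cast
  rw [← mul_div_assoc, eq_div_iff hne, mul_one, mul_comm]

/-- The integrated equation of the distributed-order diffusion, with the integral over the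
exponents written as a sum. -/
lemma distributedOrder_sum_eq {b : ℝ → ℝ} (hb : ∀ i, b (α i) = B i) (hε : ∀ i, 0 < ε i)
    (g : ℝ → ℝ) (t : ℝ) :
    ∫ a, b a * rlIntegral (1 - a) g t ∂(∑ i, ENNReal.ofReal (ε i) • Measure.dirac (α i)) =
      ∑ i, ε i * B i * fracInt (1 - α i) g t := by
  rw [integral_finsetSum_measure fun i _ =>
    (integrable_dirac enorm_lt_top).smul_measure ENNReal.ofReal_ne_top]
  refine Finset.sum_congr rfl fun i _ => ?_
  rw [integral_smul_measure, integral_dirac, ENNReal.toReal_ofReal (hε i).le, hb,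
    rlIntegral_eq_fracInt, smul_eq_mul, mul_assoc]

lemma tendsto_fracInt {β : ℝ} (hβ : 0 < β) {g : ℕ → ℝ → ℝ} {g₀ : ℝ → ℝ} {C : ℝ}
    (hg : ∀ n, Continuous (g n)) (hC : ∀ n u, |g n u| ≤ C)
    (hlim : ∀ u, Tendsto (fun n => g n u) atTop (𝓝 (g₀ u))) (t : ℝ) :
    Tendsto (fun n => fracInt β (g n) t) atTop (𝓝 (fracInt β g₀ t)) := by
  have hk := intervalIntegrable_kernel hβ t
  refine Tendsto.const_smul (intervalIntegral.tendsto_integral_filter_of_dominated_convergence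
    (fun u => ‖(t - u) ^ (β - 1)‖ * C) (Eventually.of_forall fun n => ?_)
    (Eventually.of_forall fun n => ae_of_all _ fun u _ => ?_) (hk.norm.mul_const C)
    (ae_of_all _ fun u _ => (hlim u).const_smul _)) _
  · exact hk.def'.aestronglyMeasurable.smul (hg n).aestronglyMeasurable
  · rw [norm_smul]
    exact mul_le_mul_of_nonneg_left (hC n u) (norm_nonneg _)

/-- A smooth function which is bounded with its first two derivatives is the pointwise limit, along
with its second derivative, of its cutoffs `f x * χ (x / (n + 1))`, and the bounds are uniform. -/
lemma exists_cutoff {f : ℝ → ℝ} (hf : ContDiff ℝ (⊤ : ℕ∞) f) {C : ℝ} (h0 : ∀ x, |f x| ≤ C)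
    (h1 : ∀ x, |deriv f x| ≤ C) (h2 : ∀ x, |deriv (deriv f) x| ≤ C) :
    ∃ (F : ℕ → ℝ → ℝ) (C' : ℝ), (∀ n, ContDiff ℝ (⊤ : ℕ∞) (F n)) ∧
      (∀ n, HasCompactSupport (F n)) ∧ (∀ n, F n 0 = f 0) ∧ (∀ n x, |F n x| ≤ C') ∧
      (∀ n x, |deriv (deriv (F n)) x| ≤ C') ∧
      (∀ x, Tendsto (fun n => F n x) atTop (𝓝 (f x))) ∧
      ∀ x, Tendsto (fun n => deriv (deriv (F n)) x) atTop (𝓝 (deriv (deriv f) x)) := by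
  let χ : ContDiffBump (0 : ℝ) := ⟨1, 2, one_pos, one_lt_two⟩
  have hχ : ContDiff ℝ (⊤ : ℕ∞) χ := χ.contDiff
  have hχ' : ContDiff ℝ (⊤ : ℕ∞) (deriv χ) := ((contDiff_infty_iff_deriv (𝕜 := ℝ)).1 hχ).2
  have hf' : ContDiff ℝ (⊤ : ℕ∞) (deriv f) := ((contDiff_infty_iff_deriv (𝕜 := ℝ)).1 hf).2
  have hdχ : Differentiable ℝ χ := hχ.differentiable (by simp)
  have hdχ' : Differentiable ℝ (deriv χ) := hχ'.differentiable (by simp)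
  have hdf : Differentiable ℝ f := hf.differentiable (by simp)
  have hdf' : Differentiable ℝ (deriv f) := hf'.differentiable (by simp)
  obtain ⟨C₁, hC₁⟩ := hχ'.continuous.bounded_above_of_compact_support χ.hasCompactSupport.deriv
  obtain ⟨C₂, hC₂⟩ :=
    ((contDiff_infty_iff_deriv (𝕜 := ℝ)).1 hχ').2.continuous.bounded_above_of_compact_support
      χ.hasCompactSupport.deriv.deriv
  have hχ1 : ∀ x, |χ x| ≤ 1 := fun x => by rw [abs_of_nonneg χ.nonneg]; exact χ.le_one
  set a : ℕ → ℝ := fun n => 1 / ((n : ℝ) + 1)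
  have ha0 : ∀ n, 0 < a n := fun n => Nat.one_div_pos_of_nat
  have ha1 : ∀ n, a n ≤ 1 := fun n => by
    rw [div_le_one (by positivity)]
    linarith [(Nat.cast_nonneg n : (0 : ℝ) ≤ n)]
  have hat : Tendsto a atTop (𝓝 0) := tendsto_one_div_add_atTop_nhds_zero_nat
  have hC0 : 0 ≤ C := (abs_nonneg _).trans (h0 0)
  have hC₁0 : 0 ≤ C₁ := (norm_nonneg _).trans (hC₁ 0)
  have hC₂0 : 0 ≤ C₂ := (norm_nonneg _).trans (hC₂ 0)
  have hd : ∀ n, deriv (fun x => f x * χ (a n * x)) =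
      fun x => deriv f x * χ (a n * x) + f x * (deriv χ (a n * x) * a n) := by
    intro n
    ext x
    have e1 : HasDerivAt (fun x => χ (a n * x)) (deriv χ (a n * x) * a n) x := by
      have := (hdχ (a n * x)).hasDerivAt.comp x ((hasDerivAt_id x).const_mul (a n))
      simpa using! this
    exact ((hdf x).hasDerivAt.mul e1).deriv
  have hdd : ∀ n x, deriv (deriv (fun x => f x * χ (a n * x))) x =
      deriv (deriv f) x * χ (a n * x) + 2 * a n * (deriv f x * deriv χ (a n * x)) +
        a n ^ 2 * (f x * deriv (deriv χ) (a n * x)) := by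
    intro n x
    rw [hd]
    have e1 : HasDerivAt (fun x => χ (a n * x)) (deriv χ (a n * x) * a n) x := by
      have := (hdχ (a n * x)).hasDerivAt.comp x ((hasDerivAt_id x).const_mul (a n))
      simpa using! this
    have e2 : HasDerivAt (fun x => deriv χ (a n * x)) (deriv (deriv χ) (a n * x) * a n) x := by
      have := (hdχ' (a n * x)).hasDerivAt.comp x ((hasDerivAt_id x).const_mul (a n))
      simpa using! this
    have e3 := ((hdf' x).hasDerivAt.mul e1).add ((hdf x).hasDerivAt.mul (e2.mul_const (a n)))
    refine e3.deriv.trans ?_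
    ring
  have hax : ∀ x, Tendsto (fun n => a n * x) atTop (𝓝 0) := fun x => by
    simpa using hat.mul_const x
  have hχt : ∀ x, Tendsto (fun n => χ (a n * x)) atTop (𝓝 1) := fun x => by
    have h3 := (hχ.continuous.tendsto 0).comp (hax x)
    rwa [χ.one_of_mem_closedBall (Metric.mem_closedBall_self zero_le_one)] at h3
  refine ⟨fun n x => f x * χ (a n * x), C + 2 * (C * C₁) + C * C₂, fun n => ?_, fun n => ?_,
    fun n => ?_, fun n x => ?_, fun n x => ?_, fun x => ?_, fun x => ?_⟩
  · exact hf.mul (hχ.comp (contDiff_const.mul contDiff_id))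
  · exact (χ.hasCompactSupport.comp_homeomorph (Homeomorph.mulLeft₀ (a n) (ha0 n).ne')).mul_left
  · simp only [mul_zero]
    rw [χ.one_of_mem_closedBall (Metric.mem_closedBall_self zero_le_one), mul_one]
  · rw [abs_mul]
    have := mul_le_mul (h0 x) (hχ1 (a n * x)) (abs_nonneg _) hC0
    nlinarith [mul_nonneg hC0 hC₁0, mul_nonneg hC0 hC₂0]
  · rw [hdd]
    have b1 : |deriv (deriv f) x * χ (a n * x)| ≤ C := by
      rw [abs_mul]
      simpa using mul_le_mul (h2 x) (hχ1 (a n * x)) (abs_nonneg _) hC0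
    have b2 : |2 * a n * (deriv f x * deriv χ (a n * x))| ≤ 2 * (C * C₁) := by
      rw [abs_mul, abs_of_pos (show 0 < 2 * a n by linarith [ha0 n]), abs_mul]
      exact mul_le_mul (by linarith [ha1 n]) (mul_le_mul (h1 x) (hC₁ _) (abs_nonneg _) hC0)
        (by positivity) zero_le_two
    have b3 : |a n ^ 2 * (f x * deriv (deriv χ) (a n * x))| ≤ C * C₂ := by
      rw [abs_mul, abs_mul, abs_of_nonneg (sq_nonneg (a n))]
      have e1 := mul_le_mul (pow_le_one₀ (n := 2) (ha0 n).le (ha1 n))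
        (mul_le_mul (h0 x) (hC₂ (a n * x)) (norm_nonneg _) hC0) (by positivity) zero_le_one
      simpa using e1
    exact (abs_add_three _ _ _).trans (add_le_add_three b1 b2 b3)
  · simpa using (hχt x).const_mul (f x)
  · simp only [hdd]
    have e1 := (hχt x).const_mul (deriv (deriv f) x)
    have e2 := (hat.const_mul 2).mul
      (((hχ'.continuous.tendsto 0).comp (hax x)).const_mul (deriv f x))
    have e3 := (hat.pow 2).mul
      (((((contDiff_infty_iff_deriv (𝕜 := ℝ)).1 hχ').2.continuous.tendsto 0).comp
        (hax x)).const_mul (f x))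
    simpa using! (e1.add e2).add e3

/-- The weak equation extends from compactly supported test functions to smooth functions which
are bounded with their first two derivatives. -/
lemma equation_of_bounded (hW : Continuous W) (hα : ∀ i, α i < 1) {c : Fin N → ℝ} {D t : ℝ}
    (heq : ∀ f : ℝ → ℝ, ContDiff ℝ (⊤ : ℕ∞) f → HasCompactSupport f →
      ∑ i, c i * fracInt (1 - α i)
        (fun u => (∫ x, f x ∂(W u.toNNReal : Measure ℝ)) - f 0) t =
      D * fracInt 1 (fun u => ∫ x, deriv (deriv f) x ∂(W u.toNNReal : Measure ℝ)) t)
    {f : ℝ → ℝ} (hf : ContDiff ℝ (⊤ : ℕ∞) f) {C : ℝ} (h0 : ∀ x, |f x| ≤ C)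
    (h1 : ∀ x, |deriv f x| ≤ C) (h2 : ∀ x, |deriv (deriv f) x| ≤ C) :
    ∑ i, c i * fracInt (1 - α i)
        (fun u => (∫ x, f x ∂(W u.toNNReal : Measure ℝ)) - f 0) t =
      D * fracInt 1 (fun u => ∫ x, deriv (deriv f) x ∂(W u.toNNReal : Measure ℝ)) t := by
  obtain ⟨F, C', hF, hFc, hF0, hFb, hFb2, hFt, hFt2⟩ := exists_cutoff hf h0 h1 h2
  have hFc' : ∀ n, Continuous (F n) := fun n => (hF n).continuous
  have hFc2 : ∀ n, Continuous (deriv (deriv (F n))) := fun n =>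
    ((contDiff_infty_iff_deriv (𝕜 := ℝ)).1
      ((contDiff_infty_iff_deriv (𝕜 := ℝ)).1 (hF n)).2).2.continuous
  have hbd : ∀ g : ℝ → ℝ, (∀ x, |g x| ≤ C') → ∀ u : ℝ,
      |∫ x, g x ∂(W u.toNNReal : Measure ℝ)| ≤ C' := fun g hg u => by
    have := norm_integral_le_of_norm_le_const (μ := (W u.toNNReal : Measure ℝ))
      (ae_of_all _ fun x => (Real.norm_eq_abs _).trans_le (hg x))
    simpa using! this
  have hconv : ∀ (g : ℕ → ℝ → ℝ) (g₀ : ℝ → ℝ), (∀ n, Continuous (g n)) → (∀ n x, |g n x| ≤ C') →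
      (∀ x, Tendsto (fun n => g n x) atTop (𝓝 (g₀ x))) → ∀ u : ℝ,
      Tendsto (fun n => ∫ x, g n x ∂(W u.toNNReal : Measure ℝ)) atTop
        (𝓝 (∫ x, g₀ x ∂(W u.toNNReal : Measure ℝ))) := fun g g₀ hg hgb hgt u =>
    tendsto_integral_of_dominated_convergence (fun _ => C')
      (fun n => (hg n).aestronglyMeasurable) (integrable_const _)
      (fun n => ae_of_all _ fun x => hgb n x) (ae_of_all _ hgt)
  have hlhs : Tendsto (fun n => ∑ i, c i * fracInt (1 - α i)
      (fun u => (∫ x, F n x ∂(W u.toNNReal : Measure ℝ)) - F n 0) t) atTop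
      (𝓝 (∑ i, c i * fracInt (1 - α i)
        (fun u => (∫ x, f x ∂(W u.toNNReal : Measure ℝ)) - f 0) t)) := by
    refine tendsto_finsetSum _ fun i _ => Tendsto.const_mul _ ?_
    refine tendsto_fracInt (C := C' + C') (sub_pos.2 (hα i))
      (fun n => (continuous_integral_real hW (hFc' n) (hFb n)).sub continuous_const)
      (fun n u => (abs_sub _ _).trans (add_le_add (hbd _ (hFb n) u) (hFb n 0))) (fun u => ?_) t
    exact (hconv F f hFc' hFb hFt u).sub (hFt 0)
  have hrhs : Tendsto (fun n => D * fracInt 1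
      (fun u => ∫ x, deriv (deriv (F n)) x ∂(W u.toNNReal : Measure ℝ)) t) atTop
      (𝓝 (D * fracInt 1 (fun u => ∫ x, deriv (deriv f) x ∂(W u.toNNReal : Measure ℝ)) t)) := by
    refine Tendsto.const_mul _ (tendsto_fracInt one_pos
      (fun n => continuous_integral_real hW (hFc2 n) (hFb2 n)) (fun n u => hbd _ (hFb2 n) u)
      (fun u => hconv _ _ hFc2 hFb2 hFt2 u) t)
  refine tendsto_nhds_unique hlhs (hrhs.congr fun n => ?_)
  exact (heq (F n) (hF n) (hFc n)).symm

lemma deriv_deriv_cos_mul (k : ℝ) : deriv (fun x : ℝ => Real.cos (k * x)) =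
      (fun x => -k * Real.sin (k * x)) ∧
    deriv (fun x : ℝ => -k * Real.sin (k * x)) = fun x => -k ^ 2 * Real.cos (k * x) := by
  have hlin : ∀ x : ℝ, HasDerivAt (fun x => k * x) k x := fun x => by
    simpa using (hasDerivAt_id x).const_mul k
  refine ⟨funext fun x => ?_, funext fun x => ?_⟩
  · rw [(hlin x).cos.deriv]
    ring
  · rw [((hlin x).sin.const_mul (-k)).deriv]
    ring

lemma deriv_deriv_sin_mul (k : ℝ) : deriv (fun x : ℝ => Real.sin (k * x)) =
      (fun x => k * Real.cos (k * x)) ∧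
    deriv (fun x : ℝ => k * Real.cos (k * x)) = fun x => -k ^ 2 * Real.sin (k * x) := by
  have hlin : ∀ x : ℝ, HasDerivAt (fun x => k * x) k x := fun x => by
    simpa using (hasDerivAt_id x).const_mul k
  refine ⟨funext fun x => ?_, funext fun x => ?_⟩
  · rw [(hlin x).sin.deriv]
    ring
  · rw [((hlin x).cos.const_mul k).deriv]
    ring

lemma charFun_eq_cos_add_sin (μ : Measure ℝ) [IsProbabilityMeasure μ] (k : ℝ) :
    charFun μ k = ((∫ x, Real.cos (k * x) ∂μ : ℝ) : ℂ) +
      Complex.I * ((∫ x, Real.sin (k * x) ∂μ : ℝ) : ℂ) := by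
  have hc : Integrable (fun x => ((Real.cos (k * x) : ℝ) : ℂ)) μ :=
    Integrable.of_bound (by fun_prop : Measurable _).aestronglyMeasurable 1
      (ae_of_all _ fun x => by rw [Complex.norm_real]; exact Real.abs_cos_le_one _)
  have hs : Integrable (fun x => Complex.I * ((Real.sin (k * x) : ℝ) : ℂ)) μ :=
    (Integrable.of_bound (by fun_prop : Measurable _).aestronglyMeasurable 1
      (ae_of_all _ fun x => by
        rw [Complex.norm_real]; exact Real.abs_sin_le_one _)).const_mul Complex.I
  rw [charFun_apply_real, ← integral_complex_ofReal, ← integral_complex_ofReal,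
    ← integral_const_mul, ← integral_add hc hs]
  refine integral_congr_ae (ae_of_all _ fun x => ?_)
  simp only
  rw [Complex.exp_mul_I]
  push_cast
  ring

/-- Testing against `cos (k x)` and `sin (k x)` gives the equation of the characteristic
functions. -/
lemma charFun_equation (hW : Continuous W) (hα : ∀ i, α i < 1) {c : Fin N → ℝ} {D t : ℝ}
    (heq : ∀ f : ℝ → ℝ, ContDiff ℝ (⊤ : ℕ∞) f → HasCompactSupport f →
      ∑ i, c i * fracInt (1 - α i)
        (fun u => (∫ x, f x ∂(W u.toNNReal : Measure ℝ)) - f 0) t =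
      D * fracInt 1 (fun u => ∫ x, deriv (deriv f) x ∂(W u.toNNReal : Measure ℝ)) t) (k : ℝ) :
    ∑ i, c i • fracInt (1 - α i) (fun u => charFun (W u.toNNReal : Measure ℝ) k - 1) t +
      (D * k ^ 2) • fracInt 1 (fun u => charFun (W u.toNNReal : Measure ℝ) k) t = 0 := by
  have hcos1 : ∀ x : ℝ, |Real.cos (k * x)| ≤ 1 := fun x => Real.abs_cos_le_one _
  have hsin1 : ∀ x : ℝ, |Real.sin (k * x)| ≤ 1 := fun x => Real.abs_sin_le_one _
  have hk0 := abs_nonneg k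
  have hk2 := sq_nonneg k
  have hb1 : ∀ y : ℝ, |y| ≤ 1 → |y| ≤ 1 + |k| + k ^ 2 := fun y hy => by linarith
  have hb2 : ∀ y z : ℝ, |z| = |k| → |y| ≤ 1 → |z * y| ≤ 1 + |k| + k ^ 2 := fun y z hz hy => by
    rw [abs_mul, hz]
    have := mul_le_of_le_one_right hk0 hy
    linarith
  have hb3 : ∀ y : ℝ, |y| ≤ 1 → |-k ^ 2 * y| ≤ 1 + |k| + k ^ 2 := fun y hy => by
    rw [abs_mul, abs_neg, abs_of_nonneg hk2]
    have := mul_le_of_le_one_right hk2 hy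
    linarith
  have hcos := equation_of_bounded hW hα heq (f := fun x => Real.cos (k * x))
    (C := 1 + |k| + k ^ 2) (by fun_prop) (fun x => hb1 _ (hcos1 x))
    (fun x => by rw [(deriv_deriv_cos_mul k).1]; exact hb2 _ _ (abs_neg k) (hsin1 x))
    (fun x => by
      rw [(deriv_deriv_cos_mul k).1, (deriv_deriv_cos_mul k).2]; exact hb3 _ (hcos1 x))
  have hsin := equation_of_bounded hW hα heq (f := fun x => Real.sin (k * x))
    (C := 1 + |k| + k ^ 2) (by fun_prop) (fun x => hb1 _ (hsin1 x))
    (fun x => by rw [(deriv_deriv_sin_mul k).1]; exact hb2 _ _ rfl (hcos1 x))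
    (fun x => by
      rw [(deriv_deriv_sin_mul k).1, (deriv_deriv_sin_mul k).2]; exact hb3 _ (hsin1 x))
  rw [(deriv_deriv_cos_mul k).1, (deriv_deriv_cos_mul k).2] at hcos
  rw [(deriv_deriv_sin_mul k).1, (deriv_deriv_sin_mul k).2] at hsin
  simp only [integral_const_mul, fracInt_const_mul, mul_zero, Real.cos_zero, Real.sin_zero,
    sub_zero] at hcos hsin
  set wc : ℝ → ℝ := fun u => ∫ x, Real.cos (k * x) ∂(W u.toNNReal : Measure ℝ)
  set ws : ℝ → ℝ := fun u => ∫ x, Real.sin (k * x) ∂(W u.toNNReal : Measure ℝ)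
  change ∑ i, c i * fracInt (1 - α i) (fun u => wc u - 1) t = _ at hcos
  have hwc : Continuous wc := continuous_integral_real hW (by fun_prop) hcos1
  have hws : Continuous ws := continuous_integral_real hW (by fun_prop) hsin1
  have hw : ∀ u, charFun (W u.toNNReal : Measure ℝ) k = (wc u : ℂ) + Complex.I * (ws u : ℂ) :=
    fun u => charFun_eq_cos_add_sin _ k
  have hw1 : ∀ u, charFun (W u.toNNReal : Measure ℝ) k - 1 =
      ((wc u - 1 : ℝ) : ℂ) + Complex.I * (ws u : ℂ) := fun u => by
    rw [hw]; push_cast; ring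
  simp only [hw1]
  simp only [hw]
  have hadd : ∀ β : ℝ, 0 < β → ∀ y z : ℝ → ℝ, Continuous y → Continuous z →
      fracInt β (fun u => (y u : ℂ) + Complex.I * (z u : ℂ)) t =
        ((fracInt β y t : ℝ) : ℂ) + Complex.I * ((fracInt β z t : ℝ) : ℂ) := by
    intro β hβ y z hy hz
    rw [fracInt_add hβ t (by fun_prop) (by fun_prop), fracInt_const_mul, fracInt_ofReal,
      fracInt_ofReal]
  rw [hadd 1 one_pos wc ws hwc hws]
  simp only [hadd _ (sub_pos.2 (hα _)) (fun u => wc u - 1) ws (hwc.sub continuous_const) hws,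
    Complex.real_smul, mul_add, Finset.sum_add_distrib]
  have hc' := congrArg (fun y : ℝ => (y : ℂ)) hcos
  have hs' := congrArg (fun y : ℝ => (y : ℂ)) hsin
  push_cast at hc' hs'
  have hI : ∑ i, (c i : ℂ) * (Complex.I * ((fracInt (1 - α i) ws t : ℝ) : ℂ)) =
      Complex.I * ∑ i, (c i : ℂ) * ((fracInt (1 - α i) ws t : ℝ) : ℂ) := by
    rw [Finset.mul_sum]
    exact Finset.sum_congr rfl fun i _ => by ring
  rw [hI, hs', hc']
  push_cast
  ring

end Diffusion

/-! ### From characteristic functions to the weak equation -/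

section Inversion

open scoped SchwartzMap FourierTransform

/-- Fractional integration in time commutes with integration over a frequency. -/
lemma integral_mul_fracInt {β : ℝ} (hβ : 0 < β) {p : ℝ → ℂ} (hp : Integrable p) {a : ℝ → ℝ → ℂ}
    (ha : StronglyMeasurable (Function.uncurry a)) {C : ℝ} (hC : ∀ ξ u, ‖a ξ u‖ ≤ C) {t : ℝ}
    (ht : 0 ≤ t) : Integrable (fun ξ => p ξ * fracInt β (a ξ) t) ∧
      fracInt β (fun u => ∫ ξ, p ξ * a ξ u) t = ∫ ξ, p ξ * fracInt β (a ξ) t := by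
  have hk : Integrable (fun u : ℝ => (((t - u) ^ (β - 1) : ℝ) : ℂ))
      (volume.restrict (Set.Ioc 0 t)) :=
    ((intervalIntegrable_iff_integrableOn_Ioc_of_le ht).1 (intervalIntegrable_kernel hβ t)).ofReal
  have hI : Integrable (Function.uncurry fun ξ u : ℝ =>
      p ξ * (((t - u) ^ (β - 1) : ℝ) : ℂ) * a ξ u)
      ((volume : Measure ℝ).prod (volume.restrict (Set.Ioc 0 t))) :=
    (hp.mul_prod hk).mul_bdd (c := C) ha.aestronglyMeasurable
      (ae_of_all _ fun z => hC z.1 z.2)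
  have hinner : ∀ ξ, p ξ * fracInt β (a ξ) t = ((Real.Gamma β)⁻¹ : ℝ) *
      ∫ u in Set.Ioc 0 t, p ξ * (((t - u) ^ (β - 1) : ℝ) : ℂ) * a ξ u := fun ξ => by
    simp only [fracInt, Complex.real_smul, mul_assoc]
    rw [intervalIntegral.integral_of_le ht, integral_const_mul]
    ring
  simp only [hinner]
  refine ⟨hI.integral_prod_left.const_mul _, ?_⟩
  rw [integral_const_mul, integral_integral_swap hI, fracInt, intervalIntegral.integral_of_le ht,
    Complex.real_smul]
  congr 1
  refine integral_congr_ae (ae_of_all _ fun u => ?_)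
  simp only [Complex.real_smul]
  rw [← integral_const_mul]
  exact integral_congr_ae (ae_of_all _ fun ξ => by ring)

lemma schwartz_eq_integral (S : 𝓢(ℝ, ℂ)) (x : ℝ) :
    S x = ∫ ξ, 𝓕 S ξ * Complex.exp (((2 * Real.pi * ξ : ℝ) : ℂ) * x * Complex.I) := by
  have h : 𝓕⁻ (𝓕 S) = S := by simp
  conv_lhs => rw [← h, SchwartzMap.fourierInv_coe, Real.fourierInv_eq']
  refine integral_congr_ae (ae_of_all _ fun ξ => ?_)
  simp only [smul_eq_mul]
  rw [mul_comm]
  congr 3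
  simp only [RCLike.inner_apply, conj_trivial]
  push_cast
  ring

/-- Parseval's identity for a Schwartz function and a probability measure. The factor `2 π` comes
from the kernels `exp (-2 π i ξ x)` of `𝓕` and `exp (i k x)` of `charFun`. -/
lemma integral_schwartz_eq (S : 𝓢(ℝ, ℂ)) (μ : Measure ℝ) [IsProbabilityMeasure μ] :
    ∫ x, S x ∂μ = ∫ ξ, 𝓕 S ξ * charFun μ (2 * Real.pi * ξ) := by
  have hI : Integrable (Function.uncurry fun x ξ : ℝ => 𝓕 S ξ *
      Complex.exp (((2 * Real.pi * ξ : ℝ) : ℂ) * x * Complex.I)) (μ.prod volume) := by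
    have h1 : Integrable (fun z : ℝ × ℝ => (1 : ℂ) * 𝓕 S z.2) (μ.prod volume) :=
      (integrable_const (1 : ℂ)).mul_prod (𝓕 S).integrable
    simp only [one_mul] at h1
    refine h1.mul_bdd (c := 1) (Measurable.aestronglyMeasurable (by fun_prop))
      (ae_of_all _ fun z => ?_)
    rw [← Complex.ofReal_mul, Complex.norm_exp_ofReal_mul_I]
  simp only [schwartz_eq_integral S]
  rw [integral_integral_swap hI]
  refine integral_congr_ae (ae_of_all _ fun ξ => ?_)
  simp only [charFun_apply_real]
  rw [integral_const_mul]

lemma fourier_deriv_deriv (S : 𝓢(ℝ, ℂ)) (ξ : ℝ) :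
    𝓕 (SchwartzMap.derivCLM ℂ ℂ (SchwartzMap.derivCLM ℂ ℂ S)) ξ =
      -(((2 * Real.pi * ξ) ^ 2 : ℝ) : ℂ) * 𝓕 S ξ := by
  have h : ∀ T : 𝓢(ℝ, ℂ), 𝓕 (SchwartzMap.derivCLM ℂ ℂ T) ξ =
      2 * Real.pi * Complex.I * ξ * 𝓕 T ξ := fun T => by
    rw [SchwartzMap.fourier_coe, SchwartzMap.fourier_coe]
    have hT : (SchwartzMap.derivCLM ℂ ℂ T : ℝ → ℂ) = deriv T :=
      funext fun x => SchwartzMap.derivCLM_apply ℂ T x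
    rw [hT, Real.fourier_deriv T.integrable T.differentiable
      (hT ▸ (SchwartzMap.derivCLM ℂ ℂ T).integrable)]
    exact smul_eq_mul _ _
  rw [h, h]
  push_cast
  linear_combination (2 * Real.pi * ξ) ^ 2 * 𝓕 S ξ * Complex.I_sq

end Inversion

section Diffusion

open scoped SchwartzMap FourierTransform

variable {N : ℕ} {α B ε : Fin N → ℝ} {σ : ℝ} {W : ℝ≥0 → ProbabilityMeasure ℝ}

/-- The equation of the characteristic functions, integrated against the Fourier transform of a
test function, is the weak equation. -/
lemma equation_of_charFun (hW : Continuous W) (hα : ∀ i, α i < 1) {c : Fin N → ℝ} {D t : ℝ}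
    (ht : 0 ≤ t)
    (heq : ∀ k : ℝ,
      ∑ i, c i • fracInt (1 - α i) (fun u => charFun (W u.toNNReal : Measure ℝ) k - 1) t +
        (D * k ^ 2) • fracInt 1 (fun u => charFun (W u.toNNReal : Measure ℝ) k) t = 0)
    {f : ℝ → ℝ} (hf : ContDiff ℝ (⊤ : ℕ∞) f) (hfc : HasCompactSupport f) :
    ∑ i, c i * fracInt (1 - α i)
        (fun u => (∫ x, f x ∂(W u.toNNReal : Measure ℝ)) - f 0) t =
      D * fracInt 1 (fun u => ∫ x, deriv (deriv f) x ∂(W u.toNNReal : Measure ℝ)) t := by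
  have hfc' : HasCompactSupport fun x => (f x : ℂ) :=
    hfc.comp_left (g := fun y : ℝ => (y : ℂ)) Complex.ofReal_zero
  have hf' : ContDiff ℝ (⊤ : ℕ∞) fun x => (f x : ℂ) := Complex.ofRealCLM.contDiff.comp hf
  set S : 𝓢(ℝ, ℂ) := hfc'.toSchwartzMap hf'
  have hS : ∀ x, S x = (f x : ℂ) := fun x => rfl
  set T : 𝓢(ℝ, ℂ) := SchwartzMap.derivCLM ℂ ℂ (SchwartzMap.derivCLM ℂ ℂ S)
  have hdf : Differentiable ℝ f := hf.differentiable (by simp)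
  have hdf' : Differentiable ℝ (deriv f) :=
    ((contDiff_infty_iff_deriv (𝕜 := ℝ)).1 hf).2.differentiable (by simp)
  have hT : ∀ x, T x = ((deriv (deriv f) x : ℝ) : ℂ) := fun x => by
    have h1 : (SchwartzMap.derivCLM ℂ ℂ S : ℝ → ℂ) = fun x => ((deriv f x : ℝ) : ℂ) :=
      funext fun x => (SchwartzMap.derivCLM_apply ℂ S x).trans
        (hdf x).hasDerivAt.ofReal_comp.deriv
    rw [SchwartzMap.derivCLM_apply, h1]
    exact (hdf' x).hasDerivAt.ofReal_comp.deriv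
  set w : ℝ → ℝ → ℂ := fun ξ u => charFun (W u.toNNReal : Measure ℝ) (2 * Real.pi * ξ)
  have hw1 : ∀ ξ u, ‖w ξ u‖ ≤ 1 := fun ξ u => norm_charFun_le_one _
  have hwm : StronglyMeasurable (Function.uncurry w) :=
    stronglyMeasurable_uncurry_of_continuous_of_stronglyMeasurable
      (fun u => continuous_charFun.comp (by fun_prop))
      (fun ξ => (continuous_charFun_time hW _).stronglyMeasurable)
  have hwm1 : StronglyMeasurable (Function.uncurry fun ξ u => w ξ u - 1) :=
    hwm.sub stronglyMeasurable_const
  have hw2 : ∀ ξ u, ‖w ξ u - 1‖ ≤ 1 + 1 := fun ξ u =>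
    (norm_sub_le _ _).trans (add_le_add (hw1 ξ u) (by simp))
  have hwS : ∀ (R : 𝓢(ℝ, ℂ)) (u : ℝ), Integrable fun ξ => 𝓕 R ξ * w ξ u := fun R u =>
    (𝓕 R).integrable.mul_bdd (c := 1)
      (continuous_charFun.comp (by fun_prop)).aestronglyMeasurable
      (ae_of_all _ fun ξ => hw1 ξ u)
  have hl : ∀ u : ℝ, (((∫ x, f x ∂(W u.toNNReal : Measure ℝ)) - f 0 : ℝ) : ℂ) =
      ∫ ξ, 𝓕 S ξ * (w ξ u - 1) := fun u => by
    have h0 : (f 0 : ℂ) = ∫ ξ, 𝓕 S ξ := by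
      rw [← hS 0, schwartz_eq_integral]
      simp
    simp only [mul_sub, mul_one]
    rw [integral_sub (hwS S u) (𝓕 S).integrable, ← h0, Complex.ofReal_sub,
      ← integral_complex_ofReal]
    exact congrArg (· - _) (integral_schwartz_eq S _)
  have hr : ∀ u : ℝ, ((∫ x, deriv (deriv f) x ∂(W u.toNNReal : Measure ℝ) : ℝ) : ℂ) =
      ∫ ξ, 𝓕 T ξ * w ξ u := fun u => by
    rw [← integral_complex_ofReal]
    simp only [← hT]
    exact integral_schwartz_eq T _
  apply Complex.ofReal_injective
  simp only [Complex.ofReal_sum, Complex.ofReal_mul]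
  simp only [← fracInt_ofReal, hl, hr]
  rw [(integral_mul_fracInt one_pos (𝓕 T).integrable hwm hw1 ht).2]
  simp only [fun i => (integral_mul_fracInt (sub_pos.2 (hα i)) (𝓕 S).integrable hwm1 hw2 ht).2,
    ← integral_const_mul]
  rw [← integral_finsetSum _ fun i _ =>
    (integral_mul_fracInt (sub_pos.2 (hα i)) (𝓕 S).integrable hwm1 hw2 ht).1.const_mul _]
  refine integral_congr_ae (ae_of_all _ fun ξ => ?_)
  have h1 := heq (2 * Real.pi * ξ)
  simp only [Complex.real_smul] at h1
  simp only [T, fourier_deriv_deriv]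
  have h2 : ∑ i, (c i : ℂ) * (𝓕 S ξ * fracInt (1 - α i) (fun u => w ξ u - 1) t) =
      𝓕 S ξ * ∑ i, (c i : ℂ) * fracInt (1 - α i) (fun u => w ξ u - 1) t := by
    rw [Finset.mul_sum]
    exact Finset.sum_congr rfl fun i _ => by ring
  rw [h2]
  push_cast at h1 ⊢
  linear_combination 𝓕 S ξ * h1

/-- The initial value is read off from the Laplace transform `ŵ(s)` of the characteristic function
at infinity: `s ŵ(s)` tends to the initial value, and it tends to `1` since `⟨Σ|Ψ(s)|eq⟩ → ∞`. -/
lemma initial_eq_dirac (hW : Continuous W) (hα : ∀ i, 0 < α i)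
    (hε : ∀ i, 0 < ε i) (hB : ∀ i, 0 < B i) (i₀ : Fin N)
    (h : ∀ k s : ℝ, 0 < s → fourierLaplace (fun t => (W t.toNNReal : Measure ℝ)) k s =
      (limitPropagator α B ε σ k s : ℂ)) :
    (W 0 : Measure ℝ) = Measure.dirac 0 := by
  refine Measure.ext_of_charFun (funext fun k => ?_)
  set w : ℝ → ℂ := fun u => charFun (W u.toNNReal : Measure ℝ) k
  have hwc : Continuous w := continuous_charFun_time hW k
  have hlim : Tendsto (fun s : ℝ => ∫ v in Set.Ioi (0 : ℝ), (Real.exp (-v) : ℂ) * w (s⁻¹ * v))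
      atTop (𝓝 (∫ v in Set.Ioi (0 : ℝ), (Real.exp (-v) : ℂ) * w 0)) := by
    refine tendsto_integral_filter_of_dominated_convergence (fun v => Real.exp (-v))
      (Eventually.of_forall fun s => Continuous.aestronglyMeasurable (by fun_prop))
      (Eventually.of_forall fun s => ae_of_all _ fun v => ?_)
      (integrableOn_exp_neg_Ioi 0) (ae_of_all _ fun v => ?_)
    · rw [norm_mul, Complex.norm_real, Real.norm_of_nonneg (Real.exp_pos _).le]
      exact mul_le_of_le_one_right (Real.exp_pos _).le (norm_charFun_le_one k)
    · have h0 : Tendsto (fun s : ℝ => s⁻¹ * v) atTop (𝓝 0) := by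
        simpa using tendsto_inv_atTop_zero.mul_const v
      exact ((hwc.tendsto 0).comp h0).const_mul _
  have hone : ∫ v in Set.Ioi (0 : ℝ), (Real.exp (-v) : ℂ) * w 0 = w 0 := by
    rw [integral_mul_const, integral_complex_ofReal, integral_exp_neg_Ioi_zero]
    simp
  have hψ : Tendsto (braPsiKet α B ε) atTop atTop := by
    refine tendsto_atTop_mono' atTop ?_
      ((tendsto_rpow_atTop (hα i₀)).const_mul_atTop (mul_pos (hε i₀) (hB i₀)))
    filter_upwards [eventually_gt_atTop (0 : ℝ)] with s hs
    rw [braPsiKet_eq_sum, mul_assoc]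
    exact Finset.single_le_sum (f := fun i => ε i * (B i * s ^ α i)) (fun i _ =>
      mul_nonneg (hε i).le (mul_nonneg (hB i).le (Real.rpow_nonneg hs.le _))) (Finset.mem_univ i₀)
  have hratio : Tendsto (fun s => 1 - σ ^ 2 * k ^ 2 / (braPsiKet α B ε s + σ ^ 2 * k ^ 2)) atTop
      (𝓝 (1 - 0)) :=
    tendsto_const_nhds.sub (tendsto_const_nhds.div_atTop (tendsto_atTop_add_const_right _ _ hψ))
  have hlim' : Tendsto (fun s : ℝ => ∫ v in Set.Ioi (0 : ℝ), (Real.exp (-v) : ℂ) * w (s⁻¹ * v))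
      atTop (𝓝 ((1 - 0 : ℝ) : ℂ)) := by
    refine ((Complex.continuous_ofReal.tendsto _).comp hratio).congr' ?_
    filter_upwards [eventually_gt_atTop (0 : ℝ)] with s hs
    have hpos : 0 < braPsiKet α B ε s + σ ^ 2 * k ^ 2 :=
      add_pos_of_pos_of_nonneg (braPsiKet_pos hε hB i₀ hs) (by positivity)
    have e1 := integral_comp_mul_left_Ioi (fun v => (Real.exp (-v) : ℂ) * w (s⁻¹ * v)) 0 hs
    have e2 : (fun x => (Real.exp (-(s * x)) : ℂ) * w (s⁻¹ * (s * x))) =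
        fun x => (Real.exp (-(s * x)) : ℂ) * w x := by
      funext x
      rw [inv_mul_cancel_left₀ hs.ne']
    have e3 : ∫ x in Set.Ioi 0, (Real.exp (-(s * x)) : ℂ) * w x =
        (limitPropagator α B ε σ k s : ℂ) := h k s hs
    rw [e2, e3, mul_zero, eq_inv_smul_iff₀ hs.ne'] at e1
    rw [← e1, Complex.real_smul, ← Complex.ofReal_mul, Function.comp_apply, limitPropagator]
    congr 1
    field_simp
    ring
  have hw0 := tendsto_nhds_unique hlim hlim'
  rw [hone] at hw0
  simpa [w, charFun_dirac] using hw0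

/-- The limiting propagator is the Fourier–Laplace transform of the weak solutions of natural-form
distributed-order diffusion, and of nothing else. -/
theorem isDistributedOrderDiffusion_iff {b : ℝ → ℝ} (hb : ∀ i, b (α i) = B i)
    (hα : ∀ i, 0 < α i ∧ α i < 1) (hε : ∀ i, 0 < ε i) (hB : ∀ i, 0 < B i) (i₀ : Fin N)
    (hW : Continuous W) :
    IsDistributedOrderDiffusion (∑ i, ENNReal.ofReal (ε i) • Measure.dirac (α i)) b (σ ^ 2) W ↔
      ∀ k s : ℝ, 0 < s → fourierLaplace (fun t => (W t.toNNReal : Measure ℝ)) k s =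
        (limitPropagator α B ε σ k s : ℂ) := by
  have hα1 : ∀ i, α i < 1 := fun i => (hα i).2
  refine ⟨fun h k => ?_, fun h => ⟨initial_eq_dirac hW (fun i => (hα i).1) hε hB i₀ h,
    fun f hf hfc t ht => ?_⟩⟩
  · refine (fourierLaplace_eq_limitPropagator_iff hW hα1 hε hB i₀ k).2 fun t ht => ?_
    refine charFun_equation hW hα1 (fun f hf hfc => ?_) k
    rw [fracInt_one, ← h.equation f hf hfc t ht, distributedOrder_sum_eq hb hε]
  · rw [distributedOrder_sum_eq hb hε, ← fracInt_one]
    exact equation_of_charFun hW hα1 ht (fun k =>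
      (fourierLaplace_eq_limitPropagator_iff hW hα1 hε hB i₀ k).1 (h k) t ht) hf hfc

end Diffusion

end FCP

end

theorem mainTheorem2 {N : ℕ}
    -- an irreducible transition matrix and its equilibrium distribution
    (M : Matrix (Fin N) (Fin N) ℝ) (hM : M ∈ Matrix.rowStochastic ℝ (Fin N))
    (hirr : M.IsIrreducible)
    (ε : Fin N → ℝ) (hε : ε ∈ stdSimplex ℝ (Fin N)) (hεM : ε ᵥ* M = ε)
    -- power law waiting times and Gaussian jumps
    (α B : Fin N → ℝ) (hα : ∀ i, 0 < α i ∧ α i < 1) (hB : ∀ i, 0 < B i)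
    (φ : Fin N → Measure ℝ) (hφ : ∀ i, IsPowerLawWaiting (φ i) (α i) (B i))
    (σ : ℝ) (hσ : 0 < σ)
    -- a state with the smallest exponent
    (i₁ : Fin N) (hi₁ : ∀ i, α i₁ ≤ α i) :
    -- the claims on the process, for every initial distribution
    (∀ init ∈ stdSimplex ℝ (Fin N),
      ∀ {Ω : Type*} [MeasurableSpace Ω] (P : Measure Ω) [IsProbabilityMeasure P]
        (J : ℕ → Ω → Fin N) (τ ξ : ℕ → Ω → ℝ),
        IsMultistateWalk P M init φ (fun _ => jumpLaw σ) J τ ξ →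
        (∀ k s : ℝ, 0 < s → fourierLaplace (positionLaw P τ ξ) k s =
          ∑ i, fourierLaplace (statePositionLaw P J τ ξ i) k s) ∧
        ((fun q : ℝ × ℝ => fourierLaplace (positionLaw P τ ξ) q.1 q.2)
          ~[𝓝 0 ×ˢ 𝓝[>] 0] fun q => (limitPropagator α B ε σ q.1 q.2 : ℂ)) ∧
        (∀ t, 0 ≤ t → Integrable (fun ω => position τ ξ t ω ^ 2) P) ∧
        ((fun s : ℝ => ∫ t in Set.Ioi (0 : ℝ), Real.exp (-(s * t)) * msd P τ ξ t)
          ~[𝓝[>] 0] fun s => 2 * σ ^ 2 / (s * braPsiKet α B ε s)) ∧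
        (msd P τ ξ ~[atTop] fun t =>
          2 * σ ^ 2 / ((∑ i with α i = α i₁, ε i * B i) * Real.Gamma (1 + α i₁)) * t ^ α i₁) ∧
        ((∀ i, i ≠ i₁ → α i₁ < α i) →
          msd P τ ξ ~[atTop] fun t =>
            2 * (σ ^ 2 / B i₁) / (ε i₁ * Real.Gamma (1 + α i₁)) * t ^ α i₁)) ∧
    -- the limiting expression is that of natural-form distributed-order diffusion
    (∀ b : ℝ → ℝ, (∀ i, b (α i) = B i) →
      ∀ W : ℝ≥0 → ProbabilityMeasure ℝ, Continuous W →
        (IsDistributedOrderDiffusion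
            (∑ i, ENNReal.ofReal (ε i) • Measure.dirac (α i)) b (σ ^ 2) W ↔
          ∀ k s : ℝ, 0 < s →
            fourierLaplace (fun t => (W t.toNNReal : Measure ℝ)) k s =
              (limitPropagator α B ε σ k s : ℂ))) := by
  have hφp := fun i => (hφ i).isProbabilityMeasure
  have hφ0 := fun i => (hφ i).pos
  have hα0 := fun i => (hα i).1
  have hεpos := equilibrium_pos hM hirr hε hεM
  refine ⟨fun init hi Ω _ P _ J τ ξ h => ?_, fun b hb W hW =>
    isDistributedOrderDiffusion_iff hb hα hεpos hB i₁ hW⟩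
  have hmsd := msd_isEquivalent hM hirr hε hεM hα0 hB hφ hσ hi₁ hi h
  refine ⟨fun k s hs => fourierLaplace_positionLaw_eq_sum h k hs,
    fourierLaplace_positionLaw_isEquivalent hM hirr hε hεM hα0 hB hφ i₁ hi h,
    fun t ht => (hasSum_msd hM hi h hφ0 ht).1,
    laplace_msd_isEquivalent hM hirr hε hεM hα0 hB hφ i₁ hi h, hmsd, fun hlt => ?_⟩
  -- when the minimum is attained only once, the sum over the minimal exponents has one term
  have hfilter : (Finset.univ.filter fun i => α i = α i₁) = {i₁} := by
    ext i
    simp only [Finset.mem_filter, Finset.mem_univ, true_and, Finset.mem_singleton]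
    refine ⟨fun hi => ?_, fun hi => by rw [hi]⟩
    by_contra hne
    exact (hlt i hne).ne' hi
  refine hmsd.congr_right (Eventually.of_forall fun t => ?_)
  have hε1 := (hεpos i₁).ne'
  have hB1 := (hB i₁).ne'
  have hΓ := (Real.Gamma_pos_of_pos (show 0 < 1 + α i₁ by linarith [hα0 i₁])).ne'
  simp only [hfilter, Finset.sum_singleton]
  field_simp
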